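/- **Theorem.** For a finite simple undirected graph $G$ and an integer $k\ge 0$, the problem $5$-Path Vertex Cover asks whether there is a set $S\subseteq V(G)$ with $|S|\le k$ such that $G\setminus S$ contains no path on $5$ vertices as a (not necessarily induced) subgraph. $5$-Path Vertex Cover, parameterized by $k$, admits a kernel with $O(k^2)$ edges. Explicitly, there is an algorithm (a program for a random access machine with addition, subtraction and comparison at unit cost) that, given an instance $(G,k)$, runs in time polynomial in $|V(G)|+k$ and outputs an instance $(G',k')$ such that 1. $(G',k')$ is a yes-instance of $5$-Path Vertex Cover if and only if $(G,k)$ is one; 2. $|V(G')|+k'\le g(k)$ for some computable function $g$; 3. $|E(G')|\le \max\{4,\;245k^2+245k\}$; that is, $|E(G')|\le 245k^2+245k$ if $k\ge 1$, and $|E(G')|\le 4$ if $k=0$. -/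

import Mathlib

/-! ## Random access machines with unit cost

Programs act on finitely many natural-number registers and finitely many one-dimensional arrays
of natural numbers with indirect addressing. The arithmetic operations are addition, truncated
subtraction and comparison; there is no multiplication, so that after
`t` time units every stored number has at most `t` more bits than the largest number in the input
or in the program, and the unit-cost measure is polynomially equivalent to Turing machine time. -/

namespace RAM

/-- A memory state: the contents of the registers and of the arrays. -/
structure State where
  reg : ℕ → ℕ
  arr : ℕ → ℕ → ℕ

/-- Arithmetic expressions. `get a i` reads the cell of array `a` at index `i`. -/
inductive Expr where
  | lit (n : ℕ)
  | var (x : ℕ)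
  | get (a : ℕ) (i : Expr)
  | add (e₁ e₂ : Expr)
  | sub (e₁ e₂ : Expr)
  | lt (e₁ e₂ : Expr)
  | eq (e₁ e₂ : Expr)

/-- The value of an expression; comparisons have value `1` (true) or `0` (false), and `sub` is
truncated subtraction. -/
def Expr.eval (s : State) : Expr → ℕ
  | lit n => n
  | var x => s.reg x
  | get a i => s.arr a (i.eval s)
  | add e₁ e₂ => e₁.eval s + e₂.eval s
  | sub e₁ e₂ => e₁.eval s - e₂.eval s
  | lt e₁ e₂ => if e₁.eval s < e₂.eval s then 1 else 0
  | eq e₁ e₂ => if e₁.eval s = e₂.eval s then 1 else 0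

/-- The time to evaluate an expression: one unit for every operation and every operand. -/
def Expr.cost : Expr → ℕ
  | lit _ => 1
  | var _ => 1
  | get _ i => i.cost + 1
  | add e₁ e₂ => e₁.cost + e₂.cost + 1
  | sub e₁ e₂ => e₁.cost + e₂.cost + 1
  | lt e₁ e₂ => e₁.cost + e₂.cost + 1
  | eq e₁ e₂ => e₁.cost + e₂.cost + 1

/-- Programs: `assign x e` is `x := e`, `store a i e` is `a[i] := e`, `cond e p q` executes `p` if
`e` is nonzero and `q` otherwise, `loop e p` repeats `p` as long as `e` is nonzero. -/
inductive Program where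
  | skip
  | assign (x : ℕ) (e : Expr)
  | store (a : ℕ) (i e : Expr)
  | seq (p q : Program)
  | cond (e : Expr) (p q : Program)
  | loop (e : Expr) (p : Program)

/-- Write `v` to register `x`. -/
def State.setReg (s : State) (x v : ℕ) : State :=
  { s with reg := Function.update s.reg x v }

/-- Write `v` to the cell of array `a` at index `i`. -/
def State.setArr (s : State) (a i v : ℕ) : State :=
  { s with arr := Function.update s.arr a (Function.update (s.arr a) i v) }

/-- `Exec p s s' t`: program `p`, started in state `s`, halts in state `s'` after exactly `t` time
units. -/
inductive Exec : Program → State → State → ℕ → Prop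
  | skip (s : State) : Exec .skip s s 1
  | assign (x : ℕ) (e : Expr) (s : State) :
      Exec (.assign x e) s (s.setReg x (e.eval s)) (e.cost + 1)
  | store (a : ℕ) (i e : Expr) (s : State) :
      Exec (.store a i e) s (s.setArr a (i.eval s) (e.eval s)) (i.cost + e.cost + 1)
  | seq {p q : Program} {s s' s'' : State} {t t' : ℕ} :
      Exec p s s' t → Exec q s' s'' t' → Exec (.seq p q) s s'' (t + t')
  | cond_true {e : Expr} {p q : Program} {s s' : State} {t : ℕ} :
      e.eval s ≠ 0 → Exec p s s' t → Exec (.cond e p q) s s' (e.cost + 1 + t)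
  | cond_false {e : Expr} {p q : Program} {s s' : State} {t : ℕ} :
      e.eval s = 0 → Exec q s s' t → Exec (.cond e p q) s s' (e.cost + 1 + t)
  | loop_false {e : Expr} {p : Program} {s : State} :
      e.eval s = 0 → Exec (.loop e p) s s (e.cost + 1)
  | loop_true {e : Expr} {p : Program} {s s' s'' : State} {t t' : ℕ} :
      e.eval s ≠ 0 → Exec p s s' t → Exec (.loop e p) s' s'' t' →
      Exec (.loop e p) s s'' (e.cost + 1 + t + t')

end RAM

/-! ## Path vertex cover and kernels -/

namespace PathVertexCover

/-- `S` is a `d`-path vertex cover of `G`: the graph `G ∖ S` contains no path on `d` vertices as a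
(not necessarily induced) subgraph. -/
def IsPathVertexCover {V : Type*} (d : ℕ) (G : SimpleGraph V) (S : Finset V) : Prop :=
  (SimpleGraph.pathGraph d).Free (G.induce {v | v ∉ S})

/-- An instance `(G, k)`: a finite simple graph with vertices `0, …, n - 1`, and a natural number
`k`. -/
structure Instance where
  n : ℕ
  graph : SimpleGraph (Fin n)
  k : ℕ

/-- `(G, k)` is a yes-instance of `d`-Path Vertex Cover. -/
def Instance.IsYes (d : ℕ) (I : Instance) : Prop :=
  ∃ S : Finset (Fin I.n), S.card ≤ I.k ∧ IsPathVertexCover d I.graph S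

/-- The number of edges of the graph of an instance. -/
noncomputable def Instance.numEdges (I : Instance) : ℕ := I.graph.edgeSet.ncard

/-- The size `|G| + k` of an instance `(G, k)`, where `G` is given by its adjacency matrix. -/
def Instance.size (I : Instance) : ℕ := I.n ^ 2 + I.k

/-- The state `s` holds the instance `I`: register `0` holds the number `n` of vertices,
register `1` holds `k`, and the first `n ^ 2` cells of array `0` hold the adjacency matrix, row by
row. -/
def Instance.HeldBy (I : Instance) (s : RAM.State) : Prop :=
  s.reg 0 = I.n ∧ s.reg 1 = I.k ∧
    ∀ i j : Fin I.n, (I.graph.Adj i j → s.arr 0 (i * I.n + j) = 1) ∧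
      (¬ I.graph.Adj i j → s.arr 0 (i * I.n + j) = 0)

/-- `s` is the initial state on input `I`: it holds `I`, and the rest of the memory is zero. -/
def Instance.IsInitial (I : Instance) (s : RAM.State) : Prop :=
  I.HeldBy s ∧ (∀ x, 2 ≤ x → s.reg x = 0) ∧ (∀ p, I.n ^ 2 ≤ p → s.arr 0 p = 0) ∧
    ∀ a p, a ≠ 0 → s.arr a p = 0

/-- The program `P` computes the function `f` on instances in time polynomial in the size of the
input. -/
def ComputesInPolyTime (P : RAM.Program) (f : Instance → Instance) : Prop :=
  ∃ q : Polynomial ℕ, ∀ (I : Instance) (s : RAM.State), I.IsInitial s →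
    ∃ (s' : RAM.State) (t : ℕ), RAM.Exec P s s' t ∧ t ≤ q.eval I.size ∧ (f I).HeldBy s'

/-- `f` is a kernelization of `d`-Path Vertex Cover, parameterized by `k`: it is computed by an
algorithm in polynomial time, it maps every instance to an equivalent one, and the size of the
output is bounded by a computable function of the parameter of the input. -/
def IsKernelization (d : ℕ) (f : Instance → Instance) : Prop :=
  (∃ P : RAM.Program, ComputesInPolyTime P f) ∧
    (∀ I : Instance, (f I).IsYes d ↔ I.IsYes d) ∧
    ∃ g : ℕ → ℕ, Computable g ∧ ∀ I : Instance, (f I).size ≤ g I.k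

end PathVertexCover

/-! Throughout, the budget is stored as κ = k + 1 and a solution has fewer than κ vertices, so that
κ = 0 stands for a hopeless instance and the truncated decrement of κ is always sound.

Local reduction at a vertex v. Greedily build a matching in G - v whose edges all contain a neighbor
of v. If a solution avoids v, it misses at most one matching edge, because two missed edges yz and
y'z' give the path z y v y' z'. Hence more than κ matching edges force v into the solution
(`yes_iff_of_forced`). Otherwise the set T of matched vertices has size at most 2κ and meets every
edge at a neighbor of v that does not contain v. The unmatched neighbors of v then have all their
other neighbors in T. They compete for three slots at each t in T. If some of them stay without a
slot, a crown appears: a set U of vertices each of which has three private neighbors, such that the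
owners of these slots and the losers see only U and v. An exchange argument (`yes_of_crown`) allows
the edges from v to the losers that have a neighbor besides v to be deleted. Afterwards at most |T|
+ 3|T| ≤ 8κ neighbors of v are not pendant. This is `Tame`, and it survives all later deletions.

The crown is found by an auction, which needs only nested `for` loops. A bidder takes a cheapest
slot, raises its price by one and evicts the previous owner. In the end fewer distinct positive
prices occur than there are values below the cap N, so some value g is never a price. Whoever owns a
slot priced above g sees only vertices all of whose slots are priced above g, and losers see only
slots priced at least N. So the vertices with slots above g form the crown
(`yes_and_tame_of_auction`).

Global reduction and count. Edges on no path on five vertices are removed, and each vertex keeps at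
most one pendant neighbor. A maximal packing of disjoint paths on five vertices either certifies a
no-instance or yields a hitting set M with |M| ≤ 5k. Each vertex of M has at most 9(k+1) neighbors.
Every component of G - M that contains an edge meets one of the sets T belonging to M, and being
free of paths on five vertices it consists of at most four core vertices with leaves attached
(`exists_core`). Counting the edges at M, the core edges with one pendant per core vertex, and the
leaves adjacent to M gives 45 + 140 + 45 = 230 times k(k+1) (`exists_edges_card_le`).

The algorithm is written in a language of `for` loops bounded by register `2`, which holds N = 3n +
5. Its running time is a polynomial in N by construction (`exec_run`), and correctness follows from
an invariant rule for nested loops (`run_loops_sweep`). -/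

namespace RAM

/-! ### A language of bounded loops and its semantics -/

/-- Structured programs: every loop is a `for` loop whose variable runs over the numbers below the
value of register `2`. -/
inductive Cmd where
  | skip
  | assign (x : ℕ) (e : Expr)
  | store (a : ℕ) (i e : Expr)
  | seq (p q : Cmd)
  | cond (e : Expr) (p q : Cmd)
  | loop (x : ℕ) (p : Cmd)

namespace Cmd

/-- The translation of structured programs to programs. -/
def prog : Cmd → Program
  | skip => .skip
  | assign x e => .assign x e
  | store a i e => .store a i e
  | seq p q => .seq p.prog q.prog
  | cond e p q => .cond e p.prog q.prog
  | loop x p => .seq (.assign x (.lit 0))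
      (.loop (.lt (.var x) (.var 2)) (.seq p.prog (.assign x (.add (.var x) (.lit 1)))))

/-- The registers to which a structured program may write. -/
def wregs : Cmd → List ℕ
  | skip => []
  | assign x _ => [x]
  | store _ _ _ => []
  | seq p q => p.wregs ++ q.wregs
  | cond _ p q => p.wregs ++ q.wregs
  | loop x p => x :: p.wregs

/-- The arrays to which a structured program may write. -/
def warrs : Cmd → List ℕ
  | skip => []
  | assign _ _ => []
  | store a _ _ => [a]
  | seq p q => p.warrs ++ q.warrs
  | cond _ p q => p.warrs ++ q.warrs
  | loop _ p => p.warrs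

/-- No loop body writes to its loop variable, and nothing writes to register `2`. -/
def wf : Cmd → Bool
  | skip => true
  | assign x _ => x != 2
  | store _ _ _ => true
  | seq p q => p.wf && q.wf
  | cond _ p q => p.wf && q.wf
  | loop x p => x != 2 && !p.wregs.contains x && p.wf

/-- The state in which a structured program halts. -/
def run : Cmd → State → State
  | skip, s => s
  | assign x e, s => s.setReg x (e.eval s)
  | store a i e, s => s.setArr a (i.eval s) (e.eval s)
  | seq p q, s => q.run (p.run s)
  | cond e p q, s => if e.eval s ≠ 0 then p.run s else q.run s
  | loop x p, s =>
      (fun s => (p.run s).setReg x ((p.run s).reg x + 1))^[s.reg 2] (s.setReg x 0)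

/-- A bound for the running time in terms of the value of register `2`. -/
noncomputable def time : Cmd → Polynomial ℕ
  | skip => 1
  | assign _ e => (e.cost + 1 : ℕ)
  | store _ i e => (i.cost + e.cost + 1 : ℕ)
  | seq p q => p.time + q.time
  | cond e p q => (e.cost + 1 : ℕ) + p.time + q.time
  -- Each iteration pays 4 for the test and 4 for the increment; the initialization costs 2 and the
  -- last, failing test 4.
  | loop _ p => Polynomial.X * (p.time + 8) + 6

/-- `p` executed repeatedly for all values of the loop variables `xs`. -/
def loops (xs : List ℕ) (p : Cmd) : Cmd := xs.foldr loop p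

/-- `p` guarded by the conjunction of the conditions `es`. -/
def guard (es : List Expr) (p : Cmd) : Cmd := es.foldr (fun e q => cond e q skip) p

end Cmd

@[simp] theorem State.reg_setReg (s : State) (x v y : ℕ) :
    (s.setReg x v).reg y = if y = x then v else s.reg y := by
  simp [State.setReg, Function.update_apply]

@[simp] theorem State.arr_setReg (s : State) (x v : ℕ) : (s.setReg x v).arr = s.arr := rfl

@[simp] theorem State.reg_setArr (s : State) (a i v : ℕ) : (s.setArr a i v).reg = s.reg := rfl

@[simp] theorem State.arr_setArr (s : State) (a i v b : ℕ) :
    (s.setArr a i v).arr b = if b = a then Function.update (s.arr a) i v else s.arr b := by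
  simp only [State.setArr, Function.update_apply]

/-! ### Frame rule, running time and induction over loops -/

namespace Cmd

/-- `s` agrees with `s₀` outside of the given registers and arrays. -/
structure Frame (R A : List ℕ) (s₀ s : State) : Prop where
  reg : ∀ y, y ∉ R → s.reg y = s₀.reg y
  arr : ∀ a, a ∉ A → s.arr a = s₀.arr a

theorem Frame.refl (R A : List ℕ) (s : State) : Frame R A s s := ⟨fun _ _ => rfl, fun _ _ => rfl⟩

theorem Frame.trans {R A R' A' : List ℕ} {s₁ s₂ s₃ : State} (h₁ : Frame R A s₁ s₂)
    (h₂ : Frame R' A' s₂ s₃) (hR : R' ⊆ R) (hA : A' ⊆ A) : Frame R A s₁ s₃ :=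
  ⟨fun y hy => (h₂.reg y fun h => hy (hR h)).trans (h₁.reg y hy),
    fun y hy => (h₂.arr y fun h => hy (hA h)).trans (h₁.arr y hy)⟩

theorem Frame.setReg {R A : List ℕ} {s₀ s : State} (h : Frame R A s₀ s) {x : ℕ} (hx : x ∈ R)
    (v : ℕ) : Frame R A s₀ (s.setReg x v) := by
  refine ⟨fun y hy => ?_, fun a ha => h.arr a ha⟩
  rw [State.reg_setReg, if_neg (by rintro rfl; exact hy hx), h.reg y hy]

/-- The frame rule. The write sets are explicit lists, so for concrete programs the side conditions
are settled by `decide`. -/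
theorem frame_run (c : Cmd) (s : State) : Frame c.wregs c.warrs s (c.run s) := by
  induction c generalizing s with
  | skip => exact Frame.refl _ _ _
  | assign x e => exact (Frame.refl _ _ _).setReg (by simp [wregs]) _
  | store a i e =>
    refine ⟨fun y hy => rfl, fun b hb => ?_⟩
    rw [run, State.arr_setArr, if_neg (by simpa [warrs] using hb)]
  | seq p q hp hq =>
    have h1 : Frame (seq p q).wregs (seq p q).warrs s s := Frame.refl _ _ _
    exact (h1.trans (hp s) (by simp [wregs]) (by simp [warrs])).trans (hq _) (by simp [wregs])
      (by simp [warrs])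
  | cond e p q hp hq =>
    have h1 : Frame (cond e p q).wregs (cond e p q).warrs s s := Frame.refl _ _ _
    rw [run]
    split_ifs
    · exact h1.trans (hp s) (by simp [wregs]) (by simp [warrs])
    · exact h1.trans (hq s) (by simp [wregs]) (by simp [warrs])
  | loop x p hp =>
    have h1 : Frame (loop x p).wregs (loop x p).warrs s (s.setReg x 0) :=
      (Frame.refl _ _ _).setReg (by simp [wregs]) _
    rw [run]
    generalize s.reg 2 = n
    revert h1
    generalize s.setReg x 0 = s'
    intro h1
    induction n generalizing s' with
    | zero => exact h1
    | succ n ih =>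
      rw [Function.iterate_succ_apply]
      refine ih _ (Frame.setReg ?_ (by simp [wregs]) _)
      exact h1.trans (hp s') (by simp [wregs]) (by simp [warrs])

theorem not_mem_wregs_of_wf {c : Cmd} (h : c.wf) : 2 ∉ c.wregs := by
  induction c with
  | skip => simp [wregs]
  | assign x e =>
    simp only [wf, bne_iff_ne, ne_eq] at h
    simpa [wregs] using Ne.symm h
  | store a i e => simp [wregs]
  | seq p q hp hq => simp only [wf, Bool.and_eq_true] at h; simp [wregs, hp h.1, hq h.2]
  | cond e p q hp hq => simp only [wf, Bool.and_eq_true] at h; simp [wregs, hp h.1, hq h.2]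
  | loop x p hp =>
    simp only [wf, Bool.and_eq_true, bne_iff_ne, ne_eq] at h
    rw [wregs, List.mem_cons]
    rintro (h2 | h2)
    · exact h.1.1 h2.symm
    · exact hp h.2 h2

theorem reg_two_run {c : Cmd} (h : c.wf) (s : State) : (c.run s).reg 2 = s.reg 2 :=
  (frame_run c s).reg 2 (not_mem_wregs_of_wf h)

/-- A well-formed loop body changes neither its counter nor register `2`, so the unbounded loop of
the translation makes exactly the rounds that `run` iterates. -/
theorem exec_run (c : Cmd) (h : c.wf) (s : State) :
    ∃ t ≤ c.time.eval (s.reg 2), Exec c.prog s (c.run s) t := by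
  induction c generalizing s with
  | skip => exact ⟨1, by simp [time], Exec.skip s⟩
  | assign x e => exact ⟨_, by simp [time], Exec.assign x e s⟩
  | store a i e => exact ⟨_, by simp [time], Exec.store a i e s⟩
  | seq p q hp hq =>
    simp only [wf, Bool.and_eq_true] at h
    obtain ⟨t, ht, e⟩ := hp h.1 s
    obtain ⟨t', ht', e'⟩ := hq h.2 (p.run s)
    rw [reg_two_run h.1] at ht'
    exact ⟨t + t', by simp only [time, Polynomial.eval_add]; omega, e.seq e'⟩
  | cond e p q hp hq =>
    simp only [wf, Bool.and_eq_true] at h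
    rw [run]
    split_ifs with he
    · obtain ⟨t, ht, e'⟩ := hp h.1 s
      refine ⟨_, ?_, Exec.cond_true he e'⟩
      simp only [time, Polynomial.eval_add, Polynomial.eval_natCast, Nat.cast_id]
      omega
    · obtain ⟨t, ht, e'⟩ := hq h.2 s
      refine ⟨_, ?_, Exec.cond_false (not_not.1 he) e'⟩
      simp only [time, Polynomial.eval_add, Polynomial.eval_natCast, Nat.cast_id]
      omega
  | loop x p hp =>
    have h2 := h
    simp only [wf, Bool.and_eq_true, bne_iff_ne, ne_eq, Bool.not_eq_true', List.contains_eq_mem,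
      decide_eq_false_iff_not] at h
    obtain ⟨⟨hx2, hxp⟩, hwf⟩ := h
    set f : State → State := fun s => (p.run s).setReg x ((p.run s).reg x + 1) with hf
    have key : ∀ m (s : State), s.reg x + m = s.reg 2 →
        ∃ t ≤ m * (p.time.eval (s.reg 2) + 8) + 4,
          Exec (.loop (.lt (.var x) (.var 2)) (.seq p.prog (.assign x (.add (.var x) (.lit 1)))))
            s (f^[m] s) t := by
      intro m
      induction m with
      | zero =>
        intro s hs
        refine ⟨_, ?_, Exec.loop_false ?_⟩
        · simp [Expr.cost]
        · have : ¬ s.reg x < s.reg 2 := by omega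
          simp [Expr.eval, this]
      | succ m ih =>
        intro s hs
        obtain ⟨t, ht, e⟩ := hp hwf s
        have hr2 : (f s).reg 2 = s.reg 2 := by
          simp only [hf, State.reg_setReg, if_neg (Ne.symm hx2)]
          exact reg_two_run hwf s
        have hrx : (f s).reg x = s.reg x + 1 := by
          simp only [hf, State.reg_setReg, if_true]
          rw [(frame_run p s).reg x hxp]
        obtain ⟨t', ht', e'⟩ := ih (f s) (by omega)
        rw [hr2] at ht'
        rw [Function.iterate_succ_apply]
        refine ⟨_, ?_, Exec.loop_true ?_ (e.seq (Exec.assign x _ _)) e'⟩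
        · simp only [Expr.cost]
          have : (m + 1) * (p.time.eval (s.reg 2) + 8) =
            m * (p.time.eval (s.reg 2) + 8) + (p.time.eval (s.reg 2) + 8) := by ring
          omega
        · have : s.reg x < s.reg 2 := by omega
          simp [Expr.eval, this]
    obtain ⟨t, ht, e⟩ := key (s.reg 2) (s.setReg x 0) (by simp [Ne.symm hx2])
    refine ⟨_, ?_, (Exec.assign x (.lit 0) s).seq e⟩
    simp only [State.reg_setReg, if_neg (Ne.symm hx2)] at ht
    simp only [Expr.cost, time, Polynomial.eval_add, Polynomial.eval_mul, Polynomial.eval_X,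
      Polynomial.eval_ofNat]
    omega

/-- Induction over the iterations of a loop. -/
theorem run_loop_induction {x : ℕ} {c : Cmd} (h : (loop x c).wf) (s₀ : State)
    (P : ℕ → State → Prop) (h0 : P 0 (s₀.setReg x 0))
    (step : ∀ i s, i < s₀.reg 2 → s.reg x = i → Frame (loop x c).wregs (loop x c).warrs s₀ s →
      P i s → P (i + 1) ((c.run s).setReg x (i + 1))) :
    P (s₀.reg 2) ((loop x c).run s₀) := by
  simp only [wf, Bool.and_eq_true, bne_iff_ne, ne_eq, Bool.not_eq_true', List.contains_eq_mem,
    decide_eq_false_iff_not] at h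
  obtain ⟨⟨hx2, hxp⟩, hwf⟩ := h
  rw [run]
  have key : ∀ m ≤ s₀.reg 2, ∃ s, s = (fun s => (c.run s).setReg x ((c.run s).reg x + 1))^[m]
      (s₀.setReg x 0) ∧ s.reg x = m ∧ Frame (loop x c).wregs (loop x c).warrs s₀ s ∧ P m s := by
    intro m
    induction m with
    | zero =>
      intro _
      exact ⟨_, rfl, by simp, (Frame.refl _ _ _).setReg (by simp [wregs]) _, h0⟩
    | succ m ih =>
      intro hm
      obtain ⟨s, hs, hx, hF, hP⟩ := ih (by omega)
      refine ⟨_, rfl, ?_, ?_, ?_⟩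
      · rw [Function.iterate_succ_apply', ← hs]
        simp [(frame_run c s).reg x hxp, hx]
      · rw [Function.iterate_succ_apply', ← hs]
        exact (hF.trans (frame_run c s) (by simp [wregs]) (by simp [warrs])).setReg
          (by simp [wregs]) _
      · rw [Function.iterate_succ_apply', ← hs]
        have := step m s (by omega) hx hF hP
        rwa [(frame_run c s).reg x hxp, hx]
  obtain ⟨s, hs, -, -, hP⟩ := key _ le_rfl
  rw [← hs]
  exact hP

/-- A sweep over all values of the loop variables: an invariant `I` of the relevant part `π` of the
state is kept, the relation `R` holds between the start and the end, and a property `Q` which the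
body establishes for the current values of the variables, and which is stable under `R`, holds for
all values in the end. -/
theorem run_loops_sweep {α : Type*} (π : State → α) {xs : List ℕ} {c : Cmd}
    (hwf : (loops xs c).wf) (s₀ : State) (hπ : ∀ s, ∀ x ∈ xs, ∀ v, π (s.setReg x v) = π s)
    (I : α → Prop) (R : α → α → Prop) (hrefl : ∀ a, R a a)
    (htrans : ∀ a b c, R a b → R b c → R a c) (Q : List ℕ → α → Prop)
    (hQ : ∀ l a b, R a b → Q l a → Q l b)
    (step : ∀ s, Frame (loops xs c).wregs (loops xs c).warrs s₀ s →
      (∀ x ∈ xs, s.reg x < s₀.reg 2) → I (π s) →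
      I (π (c.run s)) ∧ R (π s) (π (c.run s)) ∧ Q (xs.map s.reg) (π (c.run s)))
    (h0 : I (π s₀)) :
    I (π ((loops xs c).run s₀)) ∧ R (π s₀) (π ((loops xs c).run s₀)) ∧
      ∀ l : List ℕ, l.length = xs.length → (∀ i ∈ l, i < s₀.reg 2) →
        Q l (π ((loops xs c).run s₀)) := by
  induction xs generalizing s₀ Q with
  | nil =>
    obtain ⟨h1, h2, h3⟩ := step s₀ (Frame.refl _ _ _) (by simp) h0
    refine ⟨h1, h2, fun l hl _ => ?_⟩
    obtain rfl : l = [] := List.length_eq_zero_iff.1 (by simpa using hl)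
    exact h3
  | cons x xs ih =>
    have hw := hwf
    simp only [loops, List.foldr_cons, wf, Bool.and_eq_true, bne_iff_ne, ne_eq,
      Bool.not_eq_true', List.contains_eq_mem, decide_eq_false_iff_not] at hw
    obtain ⟨⟨hx2, hxp⟩, hwf'⟩ := hw
    -- For the outermost variable, `Q` is recorded for the completed values only; stability under
    -- `R` carries it through the later iterations.
    have hind := run_loop_induction (x := x) (c := loops xs c) hwf s₀
      (fun i s => I (π s) ∧ R (π s₀) (π s) ∧ ∀ j < i, ∀ l : List ℕ, l.length = xs.length →
        (∀ i ∈ l, i < s₀.reg 2) → Q (j :: l) (π s)) ?_ ?_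
    · obtain ⟨h1, h2, h3⟩ := hind
      refine ⟨h1, h2, fun l hl hl' => ?_⟩
      cases l with
      | nil => simp at hl
      | cons j l =>
        exact h3 j (hl' j (by simp)) l (by simpa using hl)
          (fun i hi => hl' i (List.mem_cons_of_mem _ hi))
    · refine ⟨?_, ?_, fun j hj => absurd hj (by omega)⟩
      · rw [hπ _ x (by simp)]; exact h0
      · rw [hπ _ x (by simp)]; exact hrefl _
    · rintro i s hi hx hF ⟨hI, hR, hQs⟩
      have h2 : s.reg 2 = s₀.reg 2 := hF.reg 2 (not_mem_wregs_of_wf hwf)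
      have hih := ih hwf' s (fun s y hy v => hπ s y (by simp [hy]) v)
        (fun l => Q (i :: l)) (fun l a b => hQ _ a b) ?_ hI
      · obtain ⟨h1, h3, h4⟩ := hih
        rw [hπ _ x (by simp)]
        refine ⟨h1, htrans _ _ _ hR h3, fun j hj l hl hl' => ?_⟩
        rcases Nat.lt_succ_iff_lt_or_eq.1 hj with hj | rfl
        · exact hQ _ _ _ h3 (hQs j hj l hl hl')
        · exact h4 l hl (by rwa [h2])
      · intro s' hF' hlt hI'
        have hx' : s'.reg x = i := by rw [hF'.reg x hxp, hx]
        obtain ⟨h5, h6, h7⟩ := step s' (hF.trans hF' (by simp [loops, wregs])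
          (by simp [loops, warrs])) (by
            intro y hy
            rcases List.mem_cons.1 hy with rfl | hy
            · omega
            · rw [← h2]; exact hlt y hy) hI'
        refine ⟨h5, h6, ?_⟩
        simpa [hx'] using h7

/-- Counting the iterations of nested loops. -/
theorem run_loops_count {α : Type*} (π : State → α) {xs : List ℕ} {c : Cmd}
    (hwf : (loops xs c).wf) (s₀ : State) (hπ : ∀ s, ∀ x ∈ xs, ∀ v, π (s.setReg x v) = π s)
    (P : ℕ → α → Prop)
    (step : ∀ i s, Frame (loops xs c).wregs (loops xs c).warrs s₀ s →
      P i (π s) → P (i + 1) (π (c.run s))) (k : ℕ) (h0 : P k (π s₀)) :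
    P (k + s₀.reg 2 ^ xs.length) (π ((loops xs c).run s₀)) := by
  induction xs generalizing s₀ k with
  | nil => simpa [loops] using step k s₀ (Frame.refl _ _ _) h0
  | cons x xs ih =>
    have hw := hwf
    simp only [loops, List.foldr_cons, wf, Bool.and_eq_true, bne_iff_ne, ne_eq,
      Bool.not_eq_true', List.contains_eq_mem, decide_eq_false_iff_not] at hw
    obtain ⟨⟨hx2, hxp⟩, hwf'⟩ := hw
    have hind := run_loop_induction (x := x) (c := loops xs c) hwf s₀
      (fun i s => P (k + i * s₀.reg 2 ^ xs.length) (π s)) ?_ ?_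
    · rw [List.length_cons, pow_succ']
      exact hind
    · rw [hπ _ x (by simp)]; simpa using h0
    · intro i s hi hx hF hP
      have h2 : s.reg 2 = s₀.reg 2 := hF.reg 2 (not_mem_wregs_of_wf hwf)
      have := ih hwf' s (fun s y hy v => hπ s y (by simp [hy]) v) ?_ _ hP
      · rw [hπ _ x (by simp)]
        rw [h2] at this
        convert this using 1
        ring
      · intro i s' hF' hP'
        exact step i s' (hF.trans hF' (by simp [loops, wregs]) (by simp [loops, warrs])) hP'

theorem run_guard (es : List Expr) (p : Cmd) (s : State) :
    (guard es p).run s = if ∀ e ∈ es, e.eval s ≠ 0 then p.run s else s := by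
  induction es with
  | nil => simp [guard]
  | cons e es ih =>
    simp only [guard, List.foldr_cons, run] at ih ⊢
    rw [ih]
    by_cases h : e.eval s = 0 <;> simp [h]

end Cmd

end RAM

/-! ### Paths on five vertices and hitting sets -/

namespace PathVertexCover

open SimpleGraph

/-- `a b c d e` is a path on five vertices. -/
def IsP5 {V : Type*} (G : SimpleGraph V) (a b c d e : V) : Prop :=
  G.Adj a b ∧ G.Adj b c ∧ G.Adj c d ∧ G.Adj d e ∧
    a ≠ c ∧ a ≠ d ∧ a ≠ e ∧ b ≠ d ∧ b ≠ e ∧ c ≠ e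

/-- `S` meets every path on five vertices. -/
def Hits {V : Type*} (G : SimpleGraph V) (S : Finset V) : Prop :=
  ∀ a b c d e, IsP5 G a b c d e → a ∈ S ∨ b ∈ S ∨ c ∈ S ∨ d ∈ S ∨ e ∈ S

/-- Fewer than `κ` vertices meet every path on five vertices. -/
def Yes {V : Type*} (G : SimpleGraph V) (κ : ℕ) : Prop := ∃ S : Finset V, S.card < κ ∧ Hits G S

variable {V : Type*} {G G' : SimpleGraph V} {a b c d e v x : V}

theorem IsP5.reverse (h : IsP5 G a b c d e) : IsP5 G e d c b a := by
  obtain ⟨h1, h2, h3, h4, h5, h6, h7, h8, h9, h10⟩ := h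
  exact ⟨h4.symm, h3.symm, h2.symm, h1.symm, h10.symm, h9.symm, h7.symm, h8.symm, h6.symm, h5.symm⟩

theorem IsP5.mono (hG : G ≤ G') (h : IsP5 G a b c d e) : IsP5 G' a b c d e :=
  ⟨hG h.1, hG h.2.1, hG h.2.2.1, hG h.2.2.2.1, h.2.2.2.2⟩

theorem Hits.anti (hG : G ≤ G') {S : Finset V} (h : Hits G' S) : Hits G S :=
  fun _ _ _ _ _ hp => h _ _ _ _ _ (hp.mono hG)

theorem Yes.anti (hG : G ≤ G') {κ : ℕ} (h : Yes G' κ) : Yes G κ :=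
  let ⟨S, hS, hS'⟩ := h
  ⟨S, hS, hS'.anti hG⟩

theorem isP5_iff_copy : (∃ a b c d e, IsP5 G a b c d e) ↔ (pathGraph 5).IsContained G := by
  constructor
  · rintro ⟨a, b, c, d, e, h1, h2, h3, h4, h5, h6, h7, h8, h9, h10⟩
    refine ⟨⟨⟨![a, b, c, d, e], ?_⟩, ?_⟩⟩
    · intro i j hij
      rw [pathGraph_adj] at hij
      fin_cases i <;> fin_cases j <;> simp_all [G.adj_comm]
    · intro i j hij
      have := h1.ne; have := h2.ne; have := h3.ne; have := h4.ne
      fin_cases i <;> fin_cases j <;> simp_all [eq_comm]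
  · rintro ⟨⟨f, hf⟩⟩
    have adj : ∀ i j : Fin 5, i.val + 1 = j.val → G.Adj (f i) (f j) := fun i j h =>
      f.map_rel (pathGraph_adj.2 (Or.inl h))
    have ne : ∀ i j : Fin 5, i ≠ j → f i ≠ f j := fun i j h h' => h (hf h')
    exact ⟨f 0, f 1, f 2, f 3, f 4, adj 0 1 rfl, adj 1 2 rfl, adj 2 3 rfl, adj 3 4 rfl,
      ne _ _ (by decide), ne _ _ (by decide), ne _ _ (by decide), ne _ _ (by decide),
      ne _ _ (by decide), ne _ _ (by decide)⟩

theorem isPathVertexCover_iff_hits {S : Finset V} : IsPathVertexCover 5 G S ↔ Hits G S := by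
  rw [IsPathVertexCover, SimpleGraph.Free, ← isP5_iff_copy]
  constructor
  · intro h a b c d e hp
    by_contra! hn
    refine h ⟨⟨a, hn.1⟩, ⟨b, hn.2.1⟩, ⟨c, hn.2.2.1⟩, ⟨d, hn.2.2.2.1⟩, ⟨e, hn.2.2.2.2⟩, ?_⟩
    simpa [IsP5] using hp
  · rintro h ⟨a, b, c, d, e, hp⟩
    have := h a b c d e (by simpa [IsP5, Subtype.ext_iff] using hp)
    rcases this with h | h | h | h | h
    exacts [a.2 h, b.2 h, c.2 h, d.2 h, e.2 h]

/-- Yes-instances in terms of a copy of the graph with additional isolated vertices. -/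
theorem isYes_iff_yes {I : Instance} {G : SimpleGraph ℕ} (φ : Fin I.n → ℕ)
    (hφ : Function.Injective φ) (hadj : ∀ i j, I.graph.Adj i j ↔ G.Adj (φ i) (φ j))
    (hsupp : ∀ x y, G.Adj x y → x ∈ Set.range φ) : I.IsYes 5 ↔ Yes G (I.k + 1) := by
  classical
  simp only [Instance.IsYes, isPathVertexCover_iff_hits, Yes, Nat.lt_succ_iff]
  have tr : ∀ a b c d e, IsP5 I.graph a b c d e ↔ IsP5 G (φ a) (φ b) (φ c) (φ d) (φ e) := by
    intro a b c d e
    simp [IsP5, hadj, hφ.eq_iff]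
  constructor
  · rintro ⟨S, hS, hS'⟩
    refine ⟨S.image φ, Finset.card_image_le.trans hS, fun a b c d e hp => ?_⟩
    obtain ⟨a, rfl⟩ := hsupp _ _ hp.1
    obtain ⟨b, rfl⟩ := hsupp _ _ hp.2.1
    obtain ⟨c, rfl⟩ := hsupp _ _ hp.2.2.1
    obtain ⟨d, rfl⟩ := hsupp _ _ hp.2.2.2.1
    obtain ⟨e, rfl⟩ := hsupp _ _ hp.2.2.2.1.symm
    simpa [hφ.eq_iff] using hS' a b c d e ((tr _ _ _ _ _).2 hp)
  · rintro ⟨S, hS, hS'⟩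
    refine ⟨S.preimage φ hφ.injOn, ?_, fun a b c d e hp => ?_⟩
    · refine le_trans ?_ hS
      rw [← Finset.card_image_of_injective _ hφ]
      refine Finset.card_le_card fun y hy => ?_
      obtain ⟨x, hx, rfl⟩ := Finset.mem_image.1 hy
      exact Finset.mem_preimage.1 hx
    · simpa using hS' _ _ _ _ _ ((tr _ _ _ _ _).1 hp)

end PathVertexCover

/-! ### Safety of the reduction rules -/

namespace PathVertexCover

open SimpleGraph

variable {V : Type*} {G G' : SimpleGraph V} {v x : V}

/-- Removing a forced vertex from the graph and from the solution loses nothing. For κ = 0 both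
sides are false, so truncated subtraction does no harm. -/
theorem yes_iff_of_forced [DecidableEq V] {κ : ℕ}
    (hG' : ∀ y z, G'.Adj y z ↔ G.Adj y z ∧ y ≠ v ∧ z ≠ v)
    (hv : ∀ S : Finset V, S.card < κ → Hits G S → v ∈ S) : Yes G' (κ - 1) ↔ Yes G κ := by
  constructor
  · rintro ⟨S, hS, hH⟩
    refine ⟨insert v S, (Finset.card_insert_le _ _).trans_lt (by omega), fun a b c d e hp => ?_⟩
    by_contra! hn
    simp only [Finset.mem_insert, not_or] at hn
    have := hH a b c d e ⟨(hG' _ _).2 ⟨hp.1, by tauto⟩, (hG' _ _).2 ⟨hp.2.1, by tauto⟩,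
      (hG' _ _).2 ⟨hp.2.2.1, by tauto⟩, (hG' _ _).2 ⟨hp.2.2.2.1, by tauto⟩, hp.2.2.2.2⟩
    tauto
  · rintro ⟨S, hS, hH⟩
    have hvS := hv S hS hH
    refine ⟨S.erase v, ?_, fun a b c d e hp => ?_⟩
    · have := Finset.card_erase_add_one hvS
      omega
    · have h1 := ((hG' _ _).1 hp.1).2
      have h2 := ((hG' _ _).1 hp.2.2.1).2
      have h3 := ((hG' _ _).1 hp.2.2.2.1).2
      have := hH a b c d e (hp.mono fun y z h => ((hG' _ _).1 h).1)
      simp only [Finset.mem_erase]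
      tauto

theorem yes_of_isP5_imp {κ : ℕ} (h : ∀ a b c d e, IsP5 G a b c d e → IsP5 G' a b c d e)
    (hY : Yes G' κ) : Yes G κ :=
  let ⟨S, hS, hH⟩ := hY
  ⟨S, hS, fun _ _ _ _ _ hp => hH _ _ _ _ _ (h _ _ _ _ _ hp)⟩

/-- If the edges between `v` and `L` that are missing in `G'` end in vertices with no neighbors
outside of `S' ∪ {v}`, then a path of `G` that avoids `S'` can be rerouted in `G'`. -/
theorem hits_of_leaf_swap {L : Set V} {S S' : Finset V}
    (hG' : ∀ y z, G.Adj y z → G'.Adj y z ∨ (y = v ∧ z ∈ L) ∨ (z = v ∧ y ∈ L))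
    (hL : ∀ l ∈ L, ∀ z, G.Adj l z → z ∈ S' ∨ z = v) (hS : ∀ z ∈ S, z ∉ L → z ∈ S')
    (hvS : v ∉ S) (hxL : x ∈ L) (hxv : G'.Adj x v) (hxS : x ∉ S) (hH : Hits G' S) :
    Hits G S' := by
  -- A path that avoids `S'` and starts in `L` must continue to `v` and never returns to `L`.
  -- Replacing its first vertex by `x` gives a path of `G'`.
  have key : ∀ a b c d e, IsP5 G a b c d e → a ∈ L → a ∉ S' → b ∉ S' → c ∉ S' → d ∉ S' →
      e ∉ S' → False := by
    rintro a b c d e ⟨h1, h2, h3, h4, h5, h6, h7, h8, h9, h10⟩ ha na nb nc nd ne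
    obtain rfl : b = v := (hL a ha b h1).resolve_left nb
    have hc : c ∉ L := fun h => h8 (((hL c h d h3).resolve_left nd).symm)
    have hd : d ∉ L := fun h => h2.ne ((hL d h c h3.symm).resolve_left nc).symm
    have he : e ∉ L := fun h => h8 ((hL e h d h4.symm).resolve_left nd).symm
    have e1 : G'.Adj b c := by
      rcases hG' _ _ h2 with h | h | h
      · exact h
      · exact absurd h.2 hc
      · exact absurd h.1 h2.ne'
    have e2 : G'.Adj c d := by
      rcases hG' _ _ h3 with h | h | h
      · exact h
      · exact absurd h.2 hd
      · exact absurd h.2 hc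
    have e3 : G'.Adj d e := by
      rcases hG' _ _ h4 with h | h | h
      · exact h
      · exact absurd h.2 he
      · exact absurd h.2 hd
    rcases hH x b c d e ⟨hxv, e1, e2, e3, by rintro rfl; exact hc hxL, by rintro rfl; exact hd hxL,
      by rintro rfl; exact he hxL, h8, h9, h10⟩ with h | h | h | h | h
    · exact hxS h
    · exact hvS h
    · exact nc (hS _ h hc)
    · exact nd (hS _ h hd)
    · exact ne (hS _ h he)
  intro a b c d e hp
  by_contra! hn
  obtain ⟨na, nb, nc, nd, ne⟩ := hn
  have ha : a ∉ L := fun h => key a b c d e hp h na nb nc nd ne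
  have he : e ∉ L := fun h => key e d c b a hp.reverse h ne nd nc nb na
  obtain ⟨h1, h2, h3, h4, h5, h6, h7, h8, h9, h10⟩ := hp
  -- An inner vertex in `L` would have two distinct neighbors outside of `S'`, and both would be
  -- `v`.
  have hb : b ∉ L := fun h => h5 (((hL b h a h1.symm).resolve_left na).trans
    ((hL b h c h2).resolve_left nc).symm)
  have hc : c ∉ L := fun h => h8 (((hL c h b h2.symm).resolve_left nb).trans
    ((hL c h d h3).resolve_left nd).symm)
  have hd : d ∉ L := fun h => h10 (((hL d h c h3.symm).resolve_left nc).trans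
    ((hL d h e h4).resolve_left ne).symm)
  have tr : ∀ y z, y ∉ L → z ∉ L → G.Adj y z → G'.Adj y z := fun y z hy hz h => by
    rcases hG' _ _ h with h | h | h
    · exact h
    · exact absurd h.2 hz
    · exact absurd h.2 hy
  rcases hH a b c d e ⟨tr _ _ ha hb h1, tr _ _ hb hc h2, tr _ _ hc hd h3, tr _ _ hd he h4,
    h5, h6, h7, h8, h9, h10⟩ with h | h | h | h | h
  · exact na (hS _ h ha)
  · exact nb (hS _ h hb)
  · exact nc (hS _ h hc)
  · exact nd (hS _ h hd)
  · exact ne (hS _ h he)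

/-- Once `S'` contains all neighbors of `L`, a path avoiding `S'` cannot meet `L`, so it uses no
missing edge and is already hit by `S` outside of `L`. -/
theorem hits_of_isolated {L : Set V} {S S' : Finset V}
    (hG' : ∀ y z, G.Adj y z → G'.Adj y z ∨ (y = v ∧ z ∈ L) ∨ (z = v ∧ y ∈ L))
    (hL : ∀ l ∈ L, ∀ z, G.Adj l z → z ∈ S') (hS : ∀ z ∈ S, z ∉ L → z ∈ S') (hH : Hits G' S) :
    Hits G S' := by
  rintro a b c d e ⟨h1, h2, h3, h4, h5⟩
  by_contra! hn
  obtain ⟨na, nb, nc, nd, ne⟩ := hn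
  have ha : a ∉ L := fun h => nb (hL a h b h1)
  have hb : b ∉ L := fun h => nc (hL b h c h2)
  have hc : c ∉ L := fun h => nd (hL c h d h3)
  have hd : d ∉ L := fun h => ne (hL d h e h4)
  have he : e ∉ L := fun h => nd (hL e h d h4.symm)
  have tr : ∀ y z, y ∉ L → z ∉ L → G.Adj y z → G'.Adj y z := fun y z hy hz h => by
    rcases hG' _ _ h with h | h | h
    · exact h
    · exact absurd h.2 hz
    · exact absurd h.2 hy
  rcases hH a b c d e ⟨tr _ _ ha hb h1, tr _ _ hb hc h2, tr _ _ hc hd h3, tr _ _ hd he h4,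
    h5⟩ with h | h | h | h | h
  · exact na (hS _ h ha)
  · exact nb (hS _ h hb)
  · exact nc (hS _ h hc)
  · exact nd (hS _ h hd)
  · exact ne (hS _ h he)

/-- All missing edges contain `v`, so they do not matter to paths avoiding a set that contains `v`.
-/
theorem hits_of_mem {L : Set V} {S : Finset V}
    (hG' : ∀ y z, G.Adj y z → G'.Adj y z ∨ (y = v ∧ z ∈ L) ∨ (z = v ∧ y ∈ L)) (hv : v ∈ S)
    (hH : Hits G' S) : Hits G S := by
  rintro a b c d e ⟨h1, h2, h3, h4, h5⟩
  by_contra! hn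
  obtain ⟨na, nb, nc, nd, ne⟩ := hn
  have tr : ∀ y z, y ∉ S → z ∉ S → G.Adj y z → G'.Adj y z := fun y z hy hz h => by
    rcases hG' _ _ h with h | h | h
    · exact h
    · exact absurd (h.1 ▸ hv) hy
    · exact absurd (h.1 ▸ hv) hz
  have := hH a b c d e ⟨tr _ _ na nb h1, tr _ _ nb nc h2, tr _ _ nc nd h3, tr _ _ nd ne h4, h5⟩
  tauto

/-- Of two pendant neighbors of a vertex, one is superfluous. -/
theorem yes_of_twin_pendants [DecidableEq V] {κ : ℕ} {x' : V}
    (hG' : ∀ y z, G.Adj y z → G'.Adj y z ∨ (y = v ∧ z = x) ∨ (z = v ∧ y = x))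
    (hx : ∀ z, G.Adj x z → z = v) (hx' : ∀ z, G.Adj x' z → z = v) (h' : G'.Adj x' v)
    (hY : Yes G' κ) : Yes G κ := by
  obtain ⟨S, hS, hH⟩ := hY
  have hG'' : ∀ y z, G.Adj y z → G'.Adj y z ∨ (y = v ∧ z ∈ ({x, x'} : Set V)) ∨
      (z = v ∧ y ∈ ({x, x'} : Set V)) := fun y z h => by
    rcases hG' y z h with h | h | h <;> simp [h]
  by_cases hv : v ∈ S
  · exact ⟨S, hS, hits_of_mem hG'' hv hH⟩
  by_cases hxS : x' ∈ S
  -- A pendant in the solution is traded for its neighbor `v`, which isolates both twins.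
  · refine ⟨insert v (S.erase x'), (Finset.card_insert_le _ _).trans_lt ?_,
      hits_of_isolated hG'' ?_ ?_ hH⟩
    · rwa [Finset.card_erase_add_one hxS]
    · rintro l (rfl | rfl) z hz
      · simp [hx z hz]
      · simp [hx' z hz]
    · intro z hz hzL
      simp only [Set.mem_insert_iff, Set.mem_singleton_iff, not_or] at hzL
      simp [hz, hzL.2]
  · refine ⟨S, hS, hits_of_leaf_swap hG'' ?_ (fun z hz _ => hz) hv (by simp) h' hxS hH⟩
    rintro l (rfl | rfl) z hz
    · exact Or.inr (hx z hz)
    · exact Or.inr (hx' z hz)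

/-- The crown rule: if the vertices in `T` have three private neighbors each, which together with
the vertices of `D` are neighbors of `v` and have no neighbors outside of `T ∪ {v}`, then the edges
between `v` and `D` can be deleted. -/
theorem yes_of_crown [DecidableEq V] {κ : ℕ} {D T : Finset V} (o : V → Fin 3 → V)
    (hG' : ∀ y z, G.Adj y z → G'.Adj y z ∨ (y = v ∧ z ∈ D) ∨ (z = v ∧ y ∈ D))
    (hinj : ∀ t ∈ T, ∀ t' ∈ T, ∀ j j', o t j = o t' j' → t = t' ∧ j = j')
    (hov : ∀ t ∈ T, ∀ j, G'.Adj (o t j) v) (hot : ∀ t ∈ T, ∀ j, G'.Adj t (o t j))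
    (hoT : ∀ t ∈ T, ∀ j, o t j ∉ T)
    (ho : ∀ t ∈ T, ∀ j, ∀ z, G.Adj (o t j) z → z ∈ T ∨ z = v)
    (hD : ∀ x ∈ D, ∀ z, G.Adj x z → z ∈ T ∨ z = v) (hvT : v ∉ T) (hT : D.Nonempty → T.Nonempty)
    (hY : Yes G' κ) : Yes G κ := by
  obtain ⟨S, hS, hH⟩ := hY
  rcases D.eq_empty_or_nonempty with rfl | hDne
  · exact ⟨S, hS, hH.anti fun y z h => by simpa using hG' y z h⟩
  have hTpos := (hT hDne).card_pos
  set O : Finset V := (T ×ˢ Finset.univ).image fun p : V × Fin 3 => o p.1 p.2 with hO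
  have memO : ∀ z, z ∈ O ↔ ∃ t ∈ T, ∃ j, o t j = z := by
    intro z
    simp [hO]
  have cardO : O.card = 3 * T.card := by
    rw [hO, Finset.card_image_of_injOn, Finset.card_product]
    · simp [mul_comm]
    · rintro ⟨t, j⟩ h ⟨t', j'⟩ h' heq
      simp only [Finset.coe_product, Set.mem_prod, Finset.mem_coe] at h h'
      obtain ⟨h1, h2⟩ := hinj t h.1 t' h'.1 j j' heq
      simp [h1, h2]
  have hG'' : ∀ y z, G.Adj y z → G'.Adj y z ∨ (y = v ∧ z ∈ ((O ∪ D : Finset V) : Set V)) ∨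
      (z = v ∧ y ∈ ((O ∪ D : Finset V) : Set V)) := fun y z h => by
    rcases hG' y z h with h | h | h <;> simp [h]
  have hL : ∀ l ∈ ((O ∪ D : Finset V) : Set V), ∀ z, G.Adj l z → z ∈ T ∨ z = v := by
    intro l hl z hz
    rcases Finset.mem_union.1 (Finset.mem_coe.1 hl) with hl | hl
    · obtain ⟨t, ht, j, rfl⟩ := (memO l).1 hl
      exact ho t ht j z hz
    · exact hD l hl z hz
  by_cases hv : v ∈ S
  · exact ⟨S, hS, hits_of_mem hG'' hv hH⟩
  -- If all 3|T| private neighbors are in the solution, `T` together with `v` replaces them at no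
  -- greater cost, since |T| + 1 ≤ 3|T| for nonempty `T`.
  by_cases hOS : O ⊆ S
  · refine ⟨S \ O ∪ insert v T, ?_, hits_of_isolated hG'' ?_ ?_ hH⟩
    · have h1 := Finset.card_union_le (S \ O) (insert v T)
      have h2 := Finset.card_insert_le v T
      have h3 := Finset.card_sdiff_of_subset hOS
      have h4 := Finset.card_le_card hOS
      omega
    · intro l hl z hz
      rcases hL l hl z hz with h | h <;> simp [h]
    · intro z hz hzL
      have : z ∉ O := fun h => hzL (by simp [h])
      simp [hz, this]
  obtain ⟨x, hxO, hxS⟩ := Finset.not_subset.1 hOS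
  -- Otherwise the three private neighbors of `t` give a path of `G'` through `t` and `v` that
  -- avoids `S`; this is why three are needed.
  have hex : ∀ t ∈ T \ S, ∃ j, o t j ∈ S := by
    intro t ht
    obtain ⟨htT, htS⟩ := Finset.mem_sdiff.1 ht
    by_contra! hn
    have hne : ∀ j j', j ≠ j' → o t j ≠ o t j' := fun j j' h h' => h (hinj t htT t htT j j' h').2
    have := hH (o t 0) t (o t 1) v (o t 2) ⟨(hot t htT 0).symm, hot t htT 1, hov t htT 1,
      (hov t htT 2).symm, hne _ _ (by decide), (hov t htT 0).ne, hne _ _ (by decide),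
      fun h => hvT (h ▸ htT), (hot t htT 2).ne, hne _ _ (by decide)⟩
    simp [hn, htS, hv] at this
  choose! j hj using hex
  set W : Finset V := (T \ S).image fun t => o t (j t) with hW
  have cardW : W.card = (T \ S).card := by
    refine Finset.card_image_of_injOn fun t ht t' ht' h => ?_
    exact (hinj t (Finset.mem_sdiff.1 ht).1 t' (Finset.mem_sdiff.1 ht').1 _ _ h).1
  have hWS : W ⊆ S := by
    intro z hz
    obtain ⟨t, ht, rfl⟩ := Finset.mem_image.1 hz
    exact hj t ht
  have hWO : ∀ z ∈ W, ∃ t ∈ T, ∃ j, o t j = z := by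
    intro z hz
    obtain ⟨t, ht, rfl⟩ := Finset.mem_image.1 hz
    exact ⟨t, (Finset.mem_sdiff.1 ht).1, _, rfl⟩
  -- Each vertex of `T` that is added is paid for by one of its private neighbors in `S`, collected
  -- in `W`. The private neighbor `x` outside of `S` serves to reroute paths.
  refine ⟨S \ (O ∪ D) ∪ T, ?_, hits_of_leaf_swap (x := x) hG'' ?_ ?_ hv (by simp [hxO]) ?_ hxS hH⟩
  · have hsub : S \ (O ∪ D) ∪ T ⊆ S \ W ∪ T \ S := by
      intro z hz
      rw [Finset.mem_union, Finset.mem_sdiff, Finset.mem_sdiff]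
      by_cases hzS : z ∈ S
      · refine Or.inl ⟨hzS, fun hzW => ?_⟩
        obtain ⟨t, ht, i, rfl⟩ := hWO z hzW
        rcases Finset.mem_union.1 hz with h | h
        · exact (Finset.mem_sdiff.1 h).2 (Finset.mem_union_left _ ((memO _).2 ⟨t, ht, i, rfl⟩))
        · exact hoT t ht i h
      · rcases Finset.mem_union.1 hz with h | h
        · exact absurd (Finset.mem_sdiff.1 h).1 hzS
        · exact Or.inr ⟨h, hzS⟩
    have h1 := Finset.card_le_card hsub
    have h2 := Finset.card_union_le (S \ W) (T \ S)
    have h3 := Finset.card_sdiff_of_subset hWS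
    have h4 := Finset.card_le_card hWS
    omega
  · intro l hl z hz
    rcases hL l hl z hz with h | h <;> simp [h]
  · intro z hz hzL
    have : z ∉ O ∪ D := fun h => hzL (by simpa using h)
    exact Finset.mem_union_left _ (Finset.mem_sdiff.2 ⟨hz, this⟩)
  · obtain ⟨t, ht, i, rfl⟩ := (memO x).1 hxO
    exact hov t ht i

/-- The structure around a vertex `v` after the reductions at `v`: all edges that have an end among
the neighbors of `v`, but are not incident with `v`, meet a small set, and all but few neighbors of
`v` are pendant. -/
def Tame (G : SimpleGraph V) (κ : ℕ) (v : V) : Prop :=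
  ∃ T W : Finset V, T.card ≤ 2 * κ ∧ W.card ≤ 8 * κ ∧
    (∀ y z, G.Adj v y → G.Adj y z → z ≠ v → y ∈ T ∨ z ∈ T) ∧
    ∀ y, G.Adj v y → y ∉ W → ∀ z, G.Adj y z → z = v

theorem Tame.anti {κ : ℕ} (hG : G ≤ G') (h : Tame G' κ v) : Tame G κ v :=
  let ⟨T, W, hT, hW, h1, h2⟩ := h
  ⟨T, W, hT, hW, fun y z hy hz => h1 y z (hG hy) (hG hz),
    fun y hy hyW z hz => h2 y (hG hy) hyW z (hG hz)⟩

end PathVertexCover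

/-! ### Counting the edges of a reduced graph -/

namespace PathVertexCover

open SimpleGraph

variable {V : Type*} {G H : SimpleGraph V}

/-- A walk that leaves `P` steps onto a leaf and has to return the way it came, so every vertex of
the component is in `P` or is a leaf hanging on `P`. -/
theorem mem_or_leaf_of_reachable {P : Finset V} {t₀ t u w : V}
    (hP : ∀ p ∈ P, ∀ w ∉ P, H.Adj p w → ∀ z, H.Adj w z → z = p) (ht₀ : t₀ ∈ P)
    (ht : H.Reachable t t₀) (hu : H.Reachable t u) (h : H.Adj u w) :
    (u ∈ P ∧ w ∈ P) ∨ (u ∈ P ∧ ∀ z, H.Adj w z → z = u) ∨ (w ∈ P ∧ ∀ z, H.Adj u z → z = w) := by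
  have key : u ∈ P ∨ ∃ p ∈ P, ∀ z, H.Adj u z → z = p := by
    have hr : H.Reachable t₀ u := ht.symm.trans hu
    rw [reachable_iff_reflTransGen] at hr
    clear h
    induction hr with
    | refl => exact Or.inl ht₀
    | @tail b c hb hbc ih =>
      by_cases hc : c ∈ P
      · exact Or.inl hc
      rcases ih (hu.trans hbc.symm.reachable) with hbP | ⟨p, hp, hbp⟩
      · exact Or.inr ⟨b, hbP, hP b hbP c hc hbc⟩
      · exact absurd (hbp c hbc ▸ hp) hc
  rcases key with hu | ⟨p, hp, hup⟩
  · by_cases hw : w ∈ P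
    · exact Or.inl ⟨hu, hw⟩
    · exact Or.inr (Or.inl ⟨hu, hP u hu w hw h⟩)
  · obtain rfl := hup w h
    exact Or.inr (Or.inr ⟨hp, hup⟩)

/-- In a connected graph without paths on five vertices, all edges but those that end in a leaf lie
within a set of at most four vertices, and this set contains an end of every edge. -/
theorem exists_core [DecidableEq V] (hH : ∀ a b c d e, ¬ IsP5 H a b c d e) (t : V) :
    ∃ P : Finset V, P.card ≤ 4 ∧ ∀ u w, H.Reachable t u → H.Adj u w →
      (u ∈ P ∧ w ∈ P) ∨ (u ∈ P ∧ ∀ z, H.Adj w z → z = u) ∨ (w ∈ P ∧ ∀ z, H.Adj u z → z = w) := by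
  -- The core is the vertex set of a longest path in the component; the cases are four, three, two
  -- or one vertices.
  by_cases h4 : ∃ a b c d, H.Reachable t a ∧ H.Adj a b ∧ H.Adj b c ∧ H.Adj c d ∧
      a ≠ c ∧ a ≠ d ∧ b ≠ d
  · obtain ⟨a, b, c, d, ht, h1, h2, h3, h5, h6, h7⟩ := h4
    refine ⟨{a, b, c, d}, Finset.card_le_four, fun u w => mem_or_leaf_of_reachable ?_
      (by simp : a ∈ _) ht⟩
    have endp : ∀ a b c d w, H.Adj a b → H.Adj b c → H.Adj c d → a ≠ c → a ≠ d → b ≠ d →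
        w ≠ b → w ≠ c → w ≠ d → ¬ H.Adj a w := fun a b c d w h1 h2 h3 h5 h6 h7 hb hc hd haw =>
      hH w a b c d ⟨haw.symm, h1, h2, h3, hb, hc, hd, h5, h6, h7⟩
    -- A neighbor `w` of an inner vertex is a leaf: wherever a second neighbor `z` of `w` lies, on
    -- or off the path, it yields a path on five vertices.
    have mid : ∀ a b c d w z, H.Adj a b → H.Adj b c → H.Adj c d → a ≠ c → a ≠ d → b ≠ d →
        w ≠ a → w ≠ b → w ≠ c → w ≠ d → H.Adj b w → H.Adj w z → z = b := by
      intro a b c d w z h1 h2 h3 h5 h6 h7 hwa hwb hwc hwd hbw hwz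
      by_contra hzb
      by_cases hza : z = a
      · exact endp a b c d w h1 h2 h3 h5 h6 h7 hwb hwc hwd (hza ▸ hwz.symm)
      by_cases hzc : z = c
      · subst hzc
        exact hH a b w z d ⟨h1, hbw, hwz, h3, hwa.symm, h5, h6, h2.ne, h7, hwd⟩
      by_cases hzd : z = d
      · subst hzd
        exact endp z c b a w h3.symm h2.symm h1.symm h7.symm h6.symm h5.symm hwc hwb hwa hwz.symm
      · exact hH z w b c d ⟨hwz.symm, hbw.symm, h2, h3, hzb, hzc, hzd, hwc, hwd, h7⟩
    intro p hp w hw hpw z hwz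
    simp only [Finset.mem_insert, Finset.mem_singleton, not_or] at hp hw
    obtain ⟨wa, wb, wc, wd⟩ := hw
    rcases hp with rfl | rfl | rfl | rfl
    · exact absurd hpw (endp _ _ _ _ _ h1 h2 h3 h5 h6 h7 wb wc wd)
    · exact mid _ _ _ _ _ _ h1 h2 h3 h5 h6 h7 wa wb wc wd hpw hwz
    · exact mid _ _ _ _ _ _ h3.symm h2.symm h1.symm h7.symm h6.symm h5.symm wd wc wb wa hpw hwz
    · exact absurd hpw
        (endp _ _ _ _ _ h3.symm h2.symm h1.symm h7.symm h6.symm h5.symm wc wb wa)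
  by_cases h3 : ∃ a b c, H.Reachable t a ∧ H.Adj a b ∧ H.Adj b c ∧ a ≠ c
  · obtain ⟨a, b, c, ht, h1, h2, h5⟩ := h3
    have no4 : ∀ a' b' c' d', H.Reachable a a' → H.Adj a' b' → H.Adj b' c' → H.Adj c' d' →
        a' ≠ c' → a' ≠ d' → b' ≠ d' → False := fun a' b' c' d' hr e1 e2 e3 e4 e5 e6 =>
      h4 ⟨a', b', c', d', ht.trans hr, e1, e2, e3, e4, e5, e6⟩
    refine ⟨{a, b, c}, Finset.card_le_three.trans (by norm_num), fun u w =>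
      mem_or_leaf_of_reachable ?_ (by simp : a ∈ _) ht⟩
    intro p hp w hw hpw z hwz
    simp only [Finset.mem_insert, Finset.mem_singleton, not_or] at hp hw
    obtain ⟨wa, wb, wc⟩ := hw
    rcases hp with rfl | rfl | rfl
    · exact (no4 w p b c hpw.reachable hpw.symm h1 h2 wb wc h5).elim
    · by_contra hz
      by_cases hza : z = a
      · subst hza
        exact no4 z w p c (Reachable.refl _) hwz.symm hpw.symm h2 h1.ne h5 wc
      · exact no4 a p w z (Reachable.refl _) h1 hpw hwz (Ne.symm wa) (Ne.symm hza) (Ne.symm hz)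
    · exact (no4 a b p w (Reachable.refl _) h1 h2 hpw h5 (Ne.symm wa) (Ne.symm wb)).elim
  by_cases h2 : ∃ b, H.Adj t b
  · obtain ⟨b, h1⟩ := h2
    refine ⟨{t, b}, Finset.card_le_two.trans (by norm_num), fun u w =>
      mem_or_leaf_of_reachable ?_ (by simp : t ∈ _) (Reachable.refl _)⟩
    intro p hp w hw hpw z hwz
    simp only [Finset.mem_insert, Finset.mem_singleton, not_or] at hp hw
    rcases hp with rfl | rfl
    · exact (h3 ⟨w, p, b, hpw.reachable, hpw.symm, h1, hw.2⟩).elim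
    · exact (h3 ⟨t, p, w, Reachable.refl _, h1, hpw, Ne.symm hw.1⟩).elim
  · refine ⟨{t}, by simp, fun u w =>
      mem_or_leaf_of_reachable ?_ (by simp : t ∈ _) (Reachable.refl _)⟩
    intro p hp w hw hpw z hwz
    rw [Finset.mem_singleton] at hp
    exact (h2 ⟨w, hp ▸ hpw⟩).elim

/-- The edge `u w` lies on a path on five vertices. -/
def OnP5 (G : SimpleGraph V) (u w : V) : Prop :=
  ∃ x y z, IsP5 G u w x y z ∨ IsP5 G w u x y z ∨ IsP5 G x u w y z ∨ IsP5 G x w u y z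

/-- No vertex has two pendant neighbors. -/
def NoTwinPendants (G : SimpleGraph V) : Prop :=
  ∀ b w w', G.Adj w b → G.Adj w' b → (∀ z, G.Adj w z → z = b) → (∀ z, G.Adj w' z → z = b) → w = w'

/-- Near every edge of `H = G ∖ M` there is an edge of `H` with an end adjacent to `M`. -/
theorem exists_near_edge {M : Finset V} (hM : Hits G M)
    (hH : ∀ u w, H.Adj u w ↔ G.Adj u w ∧ u ∉ M ∧ w ∉ M) {u w : V} (huw : H.Adj u w)
    (h : OnP5 G u w) : ∃ m ∈ M, ∃ a b, G.Adj m a ∧ H.Adj a b ∧ H.Reachable a u := by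
  -- Follow the path from the edge `u w` to its first vertex in `M`; the last two vertices before it
  -- span the required edge.
  have first : ∀ u w x y z, H.Adj u w → IsP5 G u w x y z →
      ∃ m ∈ M, ∃ a b, G.Adj m a ∧ H.Adj a b ∧ H.Reachable a u := by
    rintro u w x y z huw hp
    obtain ⟨-, hu, hw⟩ := (hH u w).1 huw
    have hm := hM _ _ _ _ _ hp
    obtain ⟨h1, h2, h3, h4, -⟩ := hp
    by_cases hx : x ∈ M
    · exact ⟨x, hx, w, u, h2.symm, huw.symm, huw.symm.reachable⟩
    have hwx : H.Adj w x := (hH _ _).2 ⟨h2, hw, hx⟩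
    by_cases hy : y ∈ M
    · exact ⟨y, hy, x, w, h3.symm, hwx.symm, hwx.symm.reachable.trans huw.symm.reachable⟩
    have hxy : H.Adj x y := (hH _ _).2 ⟨h3, hx, hy⟩
    have hz : z ∈ M := by tauto
    exact ⟨z, hz, y, x, h4.symm, hxy.symm,
      hxy.symm.reachable.trans (hwx.symm.reachable.trans huw.symm.reachable)⟩
  have second : ∀ u w x y z, H.Adj u w → IsP5 G x u w y z →
      ∃ m ∈ M, ∃ a b, G.Adj m a ∧ H.Adj a b ∧ H.Reachable a u := by
    rintro u w x y z huw hp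
    obtain ⟨-, hu, hw⟩ := (hH u w).1 huw
    have hm := hM _ _ _ _ _ hp
    obtain ⟨h1, h2, h3, h4, -⟩ := hp
    by_cases hx : x ∈ M
    · exact ⟨x, hx, u, w, h1, huw, Reachable.refl _⟩
    by_cases hy : y ∈ M
    · exact ⟨y, hy, w, u, h3.symm, huw.symm, huw.symm.reachable⟩
    have hwy : H.Adj w y := (hH _ _).2 ⟨h3, hw, hy⟩
    have hz : z ∈ M := by tauto
    exact ⟨z, hz, y, w, h4.symm, hwy.symm, hwy.symm.reachable.trans huw.symm.reachable⟩
  obtain ⟨x, y, z, h | h | h | h⟩ := h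
  · exact first _ _ _ _ _ huw h
  · obtain ⟨m, hm, a, b, h1, h2, h3⟩ := first _ _ _ _ _ huw.symm h
    exact ⟨m, hm, a, b, h1, h2, h3.trans huw.symm.reachable⟩
  · exact second _ _ _ _ _ huw h
  · obtain ⟨m, hm, a, b, h1, h2, h3⟩ := second _ _ _ _ _ huw.symm h
    exact ⟨m, hm, a, b, h1, h2, h3.trans huw.symm.reachable⟩

/-- The number of edges of a reduced graph. -/
theorem exists_edges_card_le [DecidableEq V] {k : ℕ} {M : Finset V} (hM : Hits G M)
    (hMk : M.card ≤ 5 * k) (hT : ∀ v ∈ M, Tame G (k + 1) v) (hP5 : ∀ u w, G.Adj u w → OnP5 G u w)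
    (hp : NoTwinPendants G) :
    ∃ E : Finset (Sym2 V), E.card ≤ 230 * k ^ 2 + 230 * k ∧ ∀ u w, G.Adj u w → s(u, w) ∈ E := by
  choose! T W hTc hWc hTe hWp using hT
  have hpend : ∀ b, ∃ p, ∀ w, G.Adj w b → (∀ z, G.Adj w z → z = b) → w = p := by
    intro b
    by_cases h : ∃ p, G.Adj p b ∧ ∀ z, G.Adj p z → z = b
    · obtain ⟨p, h1, h2⟩ := h
      exact ⟨p, fun w h3 h4 => hp b w p h3 h1 h4 h2⟩
    · exact ⟨b, fun w h3 h4 => (h ⟨w, h3, h4⟩).elim⟩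
  choose pend hpend using hpend
  -- For `v` in `M`, a neighbor outside of `W v` is pendant, hence equal to `pend v`. So `N v`
  -- contains all neighbors, and 8(k+1) + 1 ≤ 9(k+1).
  set N : V → Finset V := fun v => insert (pend v) (W v) with hN
  have hNc : ∀ v ∈ M, (N v).card ≤ 9 * (k + 1) := fun v hv =>
    (Finset.card_insert_le _ _).trans (by have := hWc v hv; omega)
  have hNa : ∀ v ∈ M, ∀ y, G.Adj v y → y ∈ N v := by
    intro v hv y hy
    by_cases hyW : y ∈ W v
    · exact Finset.mem_insert_of_mem hyW
    · rw [hpend v y hy.symm (hWp v hv y hy hyW)]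
      exact Finset.mem_insert_self _ _
  set H : SimpleGraph V :=
    { Adj := fun u w => G.Adj u w ∧ u ∉ M ∧ w ∉ M
      symm := ⟨fun u w h => ⟨h.1.symm, h.2.2, h.2.1⟩⟩
      loopless := ⟨fun u h => h.1.ne rfl⟩ } with hHdef
  have hH : ∀ u w, H.Adj u w ↔ G.Adj u w ∧ u ∉ M ∧ w ∉ M := fun u w => Iff.rfl
  have hHP : ∀ a b c d e, ¬ IsP5 H a b c d e := by
    intro a b c d e h
    have h' : IsP5 G a b c d e := h.mono (show H ≤ G from fun u w h => h.1)
    obtain ⟨h1, h2, h3, h4, -⟩ := h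
    have := hM _ _ _ _ _ h'
    have := h1.2; have := h3.2; have := h4.2
    tauto
  choose P hPc hPe using exists_core hHP
  have hq : ∀ l, ∃ q, ∀ b, H.Adj l b → (∀ z, H.Adj l z → z = b) → b = q := by
    intro l
    by_cases h : ∃ b, H.Adj l b
    · obtain ⟨q, hq⟩ := h
      exact ⟨q, fun b _ h => (h q hq).symm⟩
    · exact ⟨l, fun b hb _ => (h ⟨b, hb⟩).elim⟩
  choose q hq using hq
  set A := M.biUnion N with hA
  set X := M.biUnion T with hX
  -- `E₁` takes the edges at `M`, `E₂` the pairs inside the cores and one pendant of `G` per core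
  -- vertex, `E₃` the edges of `H` at leaves of `H` that are adjacent to `M`.
  set E₁ := M.biUnion fun v => (N v).image fun y => s(v, y) with hE₁
  set E₂ := X.biUnion fun t => (P t).sym2 ∪ (P t).image fun p => s(p, pend p) with hE₂
  set E₃ := A.image fun l => s(l, q l) with hE₃
  have cA : A.card ≤ 5 * k * (9 * (k + 1)) :=
    (Finset.card_biUnion_le_card_mul _ _ _ hNc).trans (Nat.mul_le_mul_right _ hMk)
  have cX : X.card ≤ 5 * k * (2 * (k + 1)) :=
    (Finset.card_biUnion_le_card_mul _ _ _ hTc).trans (Nat.mul_le_mul_right _ hMk)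
  have c₁ : E₁.card ≤ 5 * k * (9 * (k + 1)) :=
    (Finset.card_biUnion_le_card_mul _ _ _ fun v hv =>
      Finset.card_image_le.trans (hNc v hv)).trans (Nat.mul_le_mul_right _ hMk)
  -- Per core, 10 unordered pairs (loops included) of at most four vertices, and 4 pendant edges.
  have c₂ : E₂.card ≤ 5 * k * (2 * (k + 1)) * 14 := by
    refine (Finset.card_biUnion_le_card_mul _ _ 14 fun t _ => ?_).trans
      (Nat.mul_le_mul_right _ cX)
    refine (Finset.card_union_le _ _).trans ?_
    have h1 : (P t).sym2.card ≤ 10 := by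
      rw [Finset.card_sym2]
      exact Nat.choose_le_choose 2 (Nat.succ_le_succ (hPc t))
    have h2 : ((P t).image fun p => s(p, pend p)).card ≤ 4 := Finset.card_image_le.trans (hPc t)
    omega
  have c₃ : E₃.card ≤ 5 * k * (9 * (k + 1)) := Finset.card_image_le.trans cA
  refine ⟨E₁ ∪ E₂ ∪ E₃, ?_, ?_⟩
  · have h1 := Finset.card_union_le (E₁ ∪ E₂) E₃
    have h2 := Finset.card_union_le E₁ E₂
    calc _ ≤ 5 * k * (9 * (k + 1)) + 5 * k * (2 * (k + 1)) * 14 + 5 * k * (9 * (k + 1)) := by omega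
      _ = _ := by ring
  · have mem₁ : ∀ u w, G.Adj u w → u ∈ M → s(u, w) ∈ E₁ := fun u w h hu =>
      Finset.mem_biUnion.2 ⟨u, hu, Finset.mem_image.2 ⟨w, hNa u hu w h, rfl⟩⟩
    have leaf : ∀ t ∈ X, ∀ u w, H.Adj u w → u ∈ P t → (∀ z, H.Adj w z → z = u) →
        s(u, w) ∈ E₁ ∪ E₂ ∪ E₃ := by
      intro t ht u w huw hu hw
      by_cases hwA : w ∈ A
      · refine Finset.mem_union_right _ (Finset.mem_image.2 ⟨w, hwA, ?_⟩)
        rw [← hq w u huw.symm hw, Sym2.eq_swap]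
      · refine Finset.mem_union_left _ (Finset.mem_union_right _ (Finset.mem_biUnion.2 ⟨t, ht, ?_⟩))
        refine Finset.mem_union_right _ (Finset.mem_image.2 ⟨u, hu, ?_⟩)
        -- A leaf of `H` with no neighbor in `M` is pendant in `G` as well, hence the unique one at
        -- `u`.
        rw [← hpend u w huw.1.symm fun z hz => ?_]
        by_cases hzM : z ∈ M
        · exact (hwA (Finset.mem_biUnion.2 ⟨z, hzM, hNa z hzM w hz.symm⟩)).elim
        · exact hw z ⟨hz, huw.2.2, hzM⟩
    intro u w huw
    by_cases hu : u ∈ M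
    · exact Finset.mem_union_left _ (Finset.mem_union_left _ (mem₁ u w huw hu))
    by_cases hw : w ∈ M
    · rw [Sym2.eq_swap]
      exact Finset.mem_union_left _ (Finset.mem_union_left _ (mem₁ w u huw.symm hw))
    have hHuw : H.Adj u w := ⟨huw, hu, hw⟩
    obtain ⟨m, hm, a, b, hma, hab, hau⟩ := exists_near_edge hM hH hHuw (hP5 u w huw)
    have hbm : b ≠ m := by
      rintro rfl
      exact hab.2.2 hm
    -- Tameness at `m` puts an end of the nearby edge `a b` into `T m`, so the component of `u`
    -- contains a vertex of `X` and its core is listed in `E₂`.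
    obtain ⟨t, htX, htu⟩ : ∃ t ∈ X, H.Reachable t u := by
      rcases hTe m hm a b hma hab.1 hbm with h | h
      · exact ⟨a, Finset.mem_biUnion.2 ⟨m, hm, h⟩, hau⟩
      · exact ⟨b, Finset.mem_biUnion.2 ⟨m, hm, h⟩, hab.symm.reachable.trans hau⟩
    rcases hPe t u w htu hHuw with h | h | h
    · refine Finset.mem_union_left _ (Finset.mem_union_right _ (Finset.mem_biUnion.2 ⟨t, htX, ?_⟩))
      exact Finset.mem_union_left _ (Finset.mk_mem_sym2_iff.2 h)
    · exact leaf t htX u w hHuw h.1 h.2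
    · rw [Sym2.eq_swap]
      exact leaf t htX w u hHuw.symm h.1 h.2

end PathVertexCover

namespace PathVertexCover

open SimpleGraph RAM RAM.Cmd

/-! ### Graphs in memory -/

/-- The array `A` holds the adjacency matrix of `G`, a graph with vertices below `N`. -/
structure Rep (N : ℕ) (A : ℕ → ℕ) (G : SimpleGraph ℕ) : Prop where
  val : ∀ i j, i < N → j < N → (A (i * N + j) ≠ 0 ↔ G.Adj i j)
  supp : ∀ i j, G.Adj i j → i < N

/-- Register `2` holds `N`, and array `1` holds the multiples of `N`. -/
structure Env (N : ℕ) (s : State) : Prop where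
  size : s.reg 2 = N
  row : ∀ i < N, s.arr 1 i = i * N

theorem Env.of_frame {N : ℕ} {R A : List ℕ} {s s' : State} (h : Env N s) (hF : Frame R A s s')
    (hR : 2 ∉ R) (hA : 1 ∉ A) : Env N s' :=
  ⟨by rw [hF.reg 2 hR, h.size], fun i hi => by rw [hF.arr 1 hA, h.row i hi]⟩

theorem index_eq_iff {N i j i' j' : ℕ} (hj : j < N) (hj' : j' < N) :
    i * N + j = i' * N + j' ↔ i = i' ∧ j = j' := by
  constructor
  · intro h
    have hN : 0 < N := by omega
    have h1 : i = i' := by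
      have := congrArg (· / N) h
      simpa [Nat.add_div_of_dvd_right, Nat.mul_div_cancel _ hN, Nat.div_eq_of_lt hj,
        Nat.div_eq_of_lt hj'] using this
    subst h1
    exact ⟨rfl, by omega⟩
  · rintro ⟨rfl, rfl⟩
    rfl

/-- This lets invariants about graphs be phrased as invariants about the contents of an array. -/
theorem Rep.unique {N : ℕ} {A : ℕ → ℕ} {G G' : SimpleGraph ℕ} (h : Rep N A G) (h' : Rep N A G') :
    G = G' := by
  ext i j
  constructor
  · intro hij
    exact (h'.val i j (h.supp _ _ hij) (h.supp _ _ hij.symm)).1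
      ((h.val i j (h.supp _ _ hij) (h.supp _ _ hij.symm)).2 hij)
  · intro hij
    exact (h.val i j (h'.supp _ _ hij) (h'.supp _ _ hij.symm)).1
      ((h'.val i j (h'.supp _ _ hij) (h'.supp _ _ hij.symm)).2 hij)

/-! ### Expressions and small programs -/

/-- The position of the entry `(x, y)` of a matrix with `N` columns. -/
def idx (x y : ℕ) : Expr := .add (.get 1 (.var x)) (.var y)

/-- The entry of the adjacency matrix. -/
def adj (x y : ℕ) : Expr := .get 2 (idx x y)

/-- The negation of a condition. -/
def isz (e : Expr) : Expr := .eq e (.lit 0)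

/-- The expressions have different values. -/
def neq (e f : Expr) : Expr := isz (.eq e f)

/-- Successor. -/
def suc (e : Expr) : Expr := .add e (.lit 1)

/-- Delete the edge between two vertices. -/
def delEdge (x y : ℕ) : Cmd := .seq (.store 2 (idx x y) (.lit 0)) (.store 2 (idx y x) (.lit 0))

theorem eval_idx {N : ℕ} {s : State} (h : Env N s) {x y : ℕ} (hx : s.reg x < N) :
    (idx x y).eval s = s.reg x * N + s.reg y := by
  simp [idx, Expr.eval, h.row _ hx]

theorem eval_adj {N : ℕ} {s : State} (h : Env N s) {G : SimpleGraph ℕ} (hG : Rep N (s.arr 2) G)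
    {x y : ℕ} (hx : s.reg x < N) (hy : s.reg y < N) :
    (adj x y).eval s ≠ 0 ↔ G.Adj (s.reg x) (s.reg y) := by
  rw [adj, Expr.eval, eval_idx h hx, hG.val _ _ hx hy]

@[simp] theorem eval_isz {s : State} {e : Expr} : (isz e).eval s ≠ 0 ↔ e.eval s = 0 := by
  by_cases h : e.eval s = 0 <;> simp [isz, Expr.eval, h]

@[simp] theorem eval_neq {s : State} {e f : Expr} :
    (neq e f).eval s ≠ 0 ↔ e.eval s ≠ f.eval s := by
  simp [neq, isz, Expr.eval]

@[simp] theorem eval_suc {s : State} {e : Expr} : (suc e).eval s = e.eval s + 1 := rfl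

@[simp] theorem eval_var {s : State} {x : ℕ} : (Expr.var x).eval s = s.reg x := rfl

@[simp] theorem eval_lit {s : State} {n : ℕ} : (Expr.lit n).eval s = n := rfl

@[simp] theorem eval_get {s : State} {a : ℕ} {e : Expr} :
    (Expr.get a e).eval s = s.arr a (e.eval s) := rfl

@[simp] theorem eval_lt {s : State} {e f : Expr} :
    (Expr.lt e f).eval s ≠ 0 ↔ e.eval s < f.eval s := by
  simp [Expr.eval]

@[simp] theorem eval_eq {s : State} {e f : Expr} :
    (Expr.eq e f).eval s ≠ 0 ↔ e.eval s = f.eval s := by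
  simp [Expr.eval]

/-- `G` without the edge between `x` and `y`. -/
def del (G : SimpleGraph ℕ) (x y : ℕ) : SimpleGraph ℕ := G.deleteEdges {s(x, y)}

theorem del_adj {G : SimpleGraph ℕ} {x y u v : ℕ} :
    (del G x y).Adj u v ↔ G.Adj u v ∧ ¬ (u = x ∧ v = y) ∧ ¬ (u = y ∧ v = x) := by
  simp [del, deleteEdges_adj]

theorem del_le (G : SimpleGraph ℕ) (x y : ℕ) : del G x y ≤ G := deleteEdges_le _

theorem rep_delEdge {N : ℕ} {s : State} (h : Env N s) {G : SimpleGraph ℕ}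
    (hG : Rep N (s.arr 2) G) {x y : ℕ} (hx : s.reg x < N) (hy : s.reg y < N) :
    Rep N (((delEdge x y).run s).arr 2) (del G (s.reg x) (s.reg y)) := by
  have h1 : Env N (s.setArr 2 (s.reg x * N + s.reg y) 0) := ⟨h.size, by simpa using h.row⟩
  have h2 : (idx y x).eval (s.setArr 2 (s.reg x * N + s.reg y) 0) = s.reg y * N + s.reg x := by
    rw [eval_idx h1 (by simpa using hy)]
    rfl
  refine ⟨fun i j hi hj => ?_, fun i j hij => hG.supp i j (del_adj.1 hij).1⟩
  simp only [delEdge, run, eval_idx h hx, eval_lit, h2, State.arr_setArr, if_true,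
    Function.update_apply, index_eq_iff hj hx, index_eq_iff hj hy, del_adj, ← hG.val i j hi hj]
  by_cases e1 : i = s.reg y ∧ j = s.reg x
  · simp [e1]
  · by_cases e2 : i = s.reg x ∧ j = s.reg y
    · simp [e2]
    · simp [e1, e2]

/-- A sweep that deletes edges. -/
theorem delete_sweep {N : ℕ} {xs : List ℕ} {es : List Expr} {x y : ℕ}
    (hwf : (loops xs (guard es (delEdge x y))).wf) {s₀ : State} (h : Env N s₀)
    (hfr : 2 ∉ (loops xs (guard es (delEdge x y))).wregs ∧
      1 ∉ (loops xs (guard es (delEdge x y))).warrs) {G : SimpleGraph ℕ}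
    (hG : Rep N (s₀.arr 2) G) (J : SimpleGraph ℕ → Prop) (hJ : J G)
    (Q : List ℕ → SimpleGraph ℕ → Prop) (hQ : ∀ l G₁ G₂, G₂ ≤ G₁ → Q l G₁ → Q l G₂)
    (step : ∀ s, Frame (loops xs (guard es (delEdge x y))).wregs
        (loops xs (guard es (delEdge x y))).warrs s₀ s → Env N s →
      (∀ x ∈ xs, s.reg x < N) → ∀ G', Rep N (s.arr 2) G' → G' ≤ G → J G' →
      ((∀ e ∈ es, e.eval s ≠ 0) → s.reg x < N ∧ s.reg y < N ∧ J (del G' (s.reg x) (s.reg y)) ∧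
        Q (xs.map s.reg) (del G' (s.reg x) (s.reg y))) ∧
      (¬ (∀ e ∈ es, e.eval s ≠ 0) → Q (xs.map s.reg) G')) :
    ∃ G', Rep N (((loops xs (guard es (delEdge x y))).run s₀).arr 2) G' ∧ G' ≤ G ∧ J G' ∧
      ∀ l : List ℕ, l.length = xs.length → (∀ i ∈ l, i < N) → Q l G' := by
  have hsw := run_loops_sweep (fun s => s.arr 2) hwf s₀
    (fun s x _ v => rfl) (fun A => ∃ G', Rep N A G' ∧ G' ≤ G ∧ J G')
    (fun A B => ∀ G₁, Rep N A G₁ → ∃ G₂, Rep N B G₂ ∧ G₂ ≤ G₁)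
    (fun A G₁ h => ⟨G₁, h, le_rfl⟩)
    (fun A B C h1 h2 G₁ hG₁ =>
      let ⟨G₂, hG₂, hle⟩ := h1 G₁ hG₁
      let ⟨G₃, hG₃, hle'⟩ := h2 G₂ hG₂
      ⟨G₃, hG₃, hle'.trans hle⟩)
    (fun l A => ∃ G', Rep N A G' ∧ Q l G')
    (fun l A B hR ⟨G', hG', hq⟩ =>
      let ⟨G₂, hG₂, hle⟩ := hR G' hG'
      ⟨G₂, hG₂, hQ _ _ _ hle hq⟩) ?_ ⟨G, hG, le_rfl, hJ⟩
  · obtain ⟨⟨G', h1, h2, h3⟩, -, h4⟩ := hsw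
    refine ⟨G', h1, h2, h3, fun l hl hl' => ?_⟩
    obtain ⟨G'', h5, h6⟩ := h4 l hl (by rwa [h.size])
    rwa [h1.unique h5]
  · rintro s hF hlt ⟨G', hG', hle, hJ'⟩
    have hE := h.of_frame hF hfr.1 hfr.2
    obtain ⟨s1, s2⟩ := step s hF hE (by rwa [h.size] at hlt) G' hG' hle hJ'
    rw [run_guard]
    split_ifs with hg
    · obtain ⟨hx, hy, hJ'', hQ'⟩ := s1 hg
      have hrep := rep_delEdge hE hG' hx hy
      refine ⟨⟨_, hrep, (del_le _ _ _).trans hle, hJ''⟩, fun G₁ hG₁ => ⟨_, hrep, ?_⟩,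
        ⟨_, hrep, hQ'⟩⟩
      rw [hG₁.unique hG']
      exact del_le _ _ _
    · exact ⟨⟨G', hG', hle, hJ'⟩, fun G₁ hG₁ => ⟨G₁, hG₁, le_rfl⟩, ⟨G', hG', s2 hg⟩⟩

/-! ### Greedy matchings -/

/-- Greedily match the neighbors of the vertex in register `4`; array `3` marks the matched
vertices, and register `3` counts the edges of the matching. -/
def matching : Cmd :=
  loops [10, 11] (guard [adj 4 10, adj 10 11, neq (.var 11) (.var 4), isz (.get 3 (.var 10)),
    isz (.get 3 (.var 11))] (.seq (.store 3 (.var 10) (.lit 1))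
      (.seq (.store 3 (.var 11) (.lit 1)) (.assign 3 (suc (.var 3))))))

/-- The properties of a matching of `c` edges with vertex set `T` in `G - v` every edge of which
contains a neighbor of `v`. -/
def MatchInv (G : SimpleGraph ℕ) (v : ℕ) (T : Finset ℕ) (c : ℕ) : Prop :=
  v ∉ T ∧ T.card = 2 * c ∧ ∀ S, Hits G S → v ∉ S → c ≤ (S ∩ T).card ∨
    (c = (S ∩ T).card + 1 ∧ ∃ y ∈ T, ∃ z ∈ T, y ∉ S ∧ z ∉ S ∧ G.Adj v y ∧ G.Adj y z)

/-- The second alternative of the invariant remembers a missed edge y'z'. If the new edge is missed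
too, the path z y v y' z' avoids `S`. -/
theorem MatchInv.step {G : SimpleGraph ℕ} {v y z c : ℕ} {T : Finset ℕ} (h : MatchInv G v T c)
    (hy : G.Adj v y) (hz : G.Adj y z) (hzv : z ≠ v) (hyT : y ∉ T) (hzT : z ∉ T) :
    MatchInv G v (insert y (insert z T)) (c + 1) := by
  obtain ⟨h1, h2, h3⟩ := h
  have hyT' : y ∉ insert z T := by simp [hyT, hz.ne]
  refine ⟨by simp [h1, hy.ne, Ne.symm hzv], ?_, fun S hS hvS => ?_⟩
  · rw [Finset.card_insert_of_notMem hyT', Finset.card_insert_of_notMem hzT, h2]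
    ring
  have hsub : S ∩ T ⊆ S ∩ insert y (insert z T) :=
    Finset.inter_subset_inter_left fun w hw => by simp [hw]
  by_cases hyz : y ∈ S ∨ z ∈ S
  · have hlt : (S ∩ T).card < (S ∩ insert y (insert z T)).card := by
      refine Finset.card_lt_card ((Finset.ssubset_iff_of_subset hsub).2 ?_)
      rcases hyz with hyS | hzS
      · exact ⟨y, by simp [hyS], by simp [hyT]⟩
      · exact ⟨z, by simp [hzS], by simp [hzT]⟩
    rcases h3 S hS hvS with h | ⟨h, y', hy', z', hz', h'⟩
    · exact Or.inl (by omega)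
    · by_cases hc : c + 1 ≤ (S ∩ insert y (insert z T)).card
      · exact Or.inl hc
      · exact Or.inr ⟨by omega, y', by simp [hy'], z', by simp [hz'], h'⟩
  · push Not at hyz
    have heq : S ∩ insert y (insert z T) = S ∩ T := by
      rw [Finset.inter_insert_of_notMem hyz.1, Finset.inter_insert_of_notMem hyz.2]
    rw [heq]
    rcases h3 S hS hvS with h | ⟨h, y', hy', z', hz', hyS, hzS, h4, h5⟩
    · by_cases hc : c + 1 ≤ (S ∩ T).card
      · exact Or.inl hc
      · exact Or.inr ⟨by omega, y, by simp, z, by simp, hyz.1, hyz.2, hy, hz⟩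
    · have e1 : z' ≠ v := fun e => h1 (e ▸ hz')
      have := hS z y v y' z' ⟨hz.symm, hy.symm, h4, h5, hzv, fun e => hzT (e ▸ hy'),
        fun e => hzT (e ▸ hz'), fun e => hyT (e ▸ hy'), fun e => hyT (e ▸ hz'), Ne.symm e1⟩
      tauto

/-- Marks are never removed, so an edge rejected at its turn still has a marked end when the sweep
is over: the greedy matching is maximal. -/
theorem matching_spec {N : ℕ} {s : State} (h : Env N s) {G : SimpleGraph ℕ}
    (hG : Rep N (s.arr 2) G) (hv : s.reg 4 < N) (h3 : ∀ i < N, s.arr 3 i = 0)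
    (hc : s.reg 3 = 0) :
    ∃ T : Finset ℕ, (∀ i < N, (matching.run s).arr 3 i ≠ 0 ↔ i ∈ T) ∧
      MatchInv G (s.reg 4) T ((matching.run s).reg 3) ∧
      ∀ y z, G.Adj (s.reg 4) y → G.Adj y z → z ≠ s.reg 4 → y ∈ T ∨ z ∈ T := by
  have hsw := run_loops_sweep (xs := [10, 11])
    (fun s => (s.arr 3, s.reg 3)) (by decide : matching.wf = true) s
    (by intro s x hx v; simp at hx; rcases hx with rfl | rfl <;> simp)
    (fun a => ∃ T : Finset ℕ, (∀ i < N, a.1 i ≠ 0 ↔ i ∈ T) ∧ MatchInv G (s.reg 4) T a.2)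
    (fun a b => ∀ i, a.1 i ≠ 0 → b.1 i ≠ 0) (fun a i h => h)
    (fun a b c h h' i hi => h' i (h i hi))
    (fun l a => ∀ y z, l = [y, z] → G.Adj (s.reg 4) y → G.Adj y z → z ≠ s.reg 4 →
      a.1 y ≠ 0 ∨ a.1 z ≠ 0)
    (fun l a b hR hq y z hl h1 h2 h3 => (hq y z hl h1 h2 h3).imp (hR y) (hR z)) ?_ ?_
  · obtain ⟨⟨T, h1, h2⟩, -, h4⟩ := hsw
    refine ⟨T, h1, h2, fun y z hy hz hzv => ?_⟩
    have hyN := hG.supp _ _ hz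
    have hzN := hG.supp _ _ hz.symm
    have := h4 [y, z] rfl (by simp [h.size, hyN, hzN]) y z rfl hy hz hzv
    rwa [← h1 y hyN, ← h1 z hzN]
  · rintro s' hF hlt ⟨T, hT, hM⟩
    have hE := h.of_frame hF (by decide) (by decide)
    have hG' : Rep N (s'.arr 2) G := by rwa [hF.arr 2 (by decide)]
    have h4 : s'.reg 4 = s.reg 4 := hF.reg 4 (by decide)
    have h10 : s'.reg 10 < N := by simpa [h.size] using hlt 10 (by simp)
    have h11 : s'.reg 11 < N := by simpa [h.size] using hlt 11 (by simp)
    rw [run_guard]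
    split_ifs with hg <;>
    simp only [List.forall_mem_cons, eval_adj hE hG' (h4 ▸ hv) h10, eval_adj hE hG' h10 h11,
      eval_neq, eval_isz, eval_get, eval_var, List.not_mem_nil, false_imp_iff, implies_true,
      and_true, h4] at hg
    · obtain ⟨g1, g2, g3, g4, g5⟩ := hg
      have hy : s'.reg 10 ∉ T := fun h => (hT _ h10).2 h g4
      have hz : s'.reg 11 ∉ T := fun h => (hT _ h11).2 h g5
      simp only [run, eval_var, eval_lit, eval_suc, State.arr_setArr, State.reg_setArr,
        State.arr_setReg, State.reg_setReg, if_true]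
      refine ⟨⟨_, fun i hi => ?_, hM.step g1 g2 g3 hy hz⟩, fun i hi => ?_, ?_⟩
      · rw [Finset.mem_insert, Finset.mem_insert, ← hT i hi]
        simp only [Function.update_apply]
        split_ifs with e1 e2 <;> simp [*]
      · simp only [Function.update_apply]
        split_ifs <;> simp [hi]
      · intro y z hl _ _ _
        simp only [List.map_cons, List.map_nil, List.cons.injEq, and_true] at hl
        obtain ⟨rfl, rfl⟩ := hl
        exact Or.inr (by simp)
    · refine ⟨⟨T, hT, hM⟩, fun i hi => hi, ?_⟩
      intro y z hl h1 h2 h3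
      simp only [List.map_cons, List.map_nil, List.cons.injEq, and_true] at hl
      obtain ⟨rfl, rfl⟩ := hl
      by_contra! hn
      exact hg ⟨h1, h2, h3, hn.1, hn.2⟩
  · refine ⟨∅, fun i hi => by simp [h3 i hi], by simp, by simp [hc], fun S _ _ => Or.inl ?_⟩
    simp [hc]

end PathVertexCover

namespace PathVertexCover

open SimpleGraph RAM RAM.Cmd

/-! ### Auctions

The unmatched neighbors `x` of `v` compete for slots `(t, j)` with `t ≠ v` a neighbor of `x` and
`j < 3`. A state consists of the flags `asg (x + 1)` of the vertices which have a slot, the owners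
`own (t * N + j)` of the slots, which are `x + 1` or `0`, and the prices of the slots. -/

/-- The state of an auction. -/
structure Auction where
  asg : ℕ → ℕ
  own : ℕ → ℕ
  price : ℕ → ℕ

/-- The vertex `x` may bid. -/
def Bidder (G : SimpleGraph ℕ) (v : ℕ) (T : Finset ℕ) (x : ℕ) : Prop := G.Adj v x ∧ x ∉ T

/-- All slots that the bidder `x` may buy cost at least `g`. -/
def Low (N : ℕ) (G : SimpleGraph ℕ) (v x g : ℕ) (a : Auction) : Prop :=
  ∀ t < N, ∀ j < 3, G.Adj x t → t ≠ v → g ≤ a.price (t * N + j)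

/-- The invariant of an auction: owners are bidders, and buy at the lowest price up to one unit. -/
structure AuctionInv (N : ℕ) (G : SimpleGraph ℕ) (v : ℕ) (T : Finset ℕ) (a : Auction) : Prop where
  owner : ∀ t < N, ∀ j < 3, ∀ x, a.own (t * N + j) = x + 1 →
    Bidder G v T x ∧ G.Adj x t ∧ t ≠ v ∧ a.asg (x + 1) ≠ 0 ∧
      ∀ t' < N, ∀ j' < 3, G.Adj x t' → t' ≠ v → a.price (t * N + j) ≤ a.price (t' * N + j') + 1
  pos : ∀ t < N, ∀ j < 3, a.price (t * N + j) ≠ 0 → a.own (t * N + j) ≠ 0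
  inj : ∀ t < N, ∀ j < 3, ∀ t' < N, ∀ j' < 3, a.own (t * N + j) = a.own (t' * N + j') →
    a.own (t * N + j) ≠ 0 → t = t' ∧ j = j'
  asg : ∀ x < N, a.asg (x + 1) ≠ 0 → ∃ t < N, ∃ j < 3, a.own (t * N + j) = x + 1
  le : ∀ t < N, ∀ j < 3, a.price (t * N + j) ≤ N

/-- The auction is over: a bidder without a slot cannot afford one. -/
def Final (N : ℕ) (G : SimpleGraph ℕ) (v : ℕ) (T : Finset ℕ) (a : Auction) : Prop :=
  ∀ x < N, Bidder G v T x → a.asg (x + 1) = 0 → Low N G v x N a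

/-- The sum of all prices. -/
def Auction.total (N : ℕ) (a : Auction) : ℕ :=
  ∑ p ∈ Finset.range N ×ˢ Finset.range 3, a.price (p.1 * N + p.2)

/-- The bidder `x` buys the slot `(t, j)`. -/
def Auction.buy (N x t j : ℕ) (a : Auction) : Auction where
  -- The previous owner loses its flag. A free slot has owner 0, and cell 0 is the flag of no vertex
  -- because of the shift by one.
  asg := Function.update (Function.update a.asg (a.own (t * N + j)) 0) (x + 1) 1
  own := Function.update a.own (t * N + j) (x + 1)
  price := Function.update a.price (t * N + j) (a.price (t * N + j) + 1)

/-- `b` is a state of an auction that may follow the state `a`. -/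
def Follows (N : ℕ) (G : SimpleGraph ℕ) (v : ℕ) (T : Finset ℕ) (a b : Auction) : Prop :=
  a.total N ≤ b.total N ∧ (a.total N = b.total N → a = b) ∧ (Final N G v T a → b = a)

section

variable {N : ℕ} {G : SimpleGraph ℕ} {v : ℕ} {T : Finset ℕ}

theorem Follows.refl (a : Auction) : Follows N G v T a a := ⟨le_rfl, fun _ => rfl, fun _ => rfl⟩

theorem Follows.trans {a b c : Auction} (h : Follows N G v T a b) (h' : Follows N G v T b c) :
    Follows N G v T a c := by
  refine ⟨h.1.trans h'.1, fun e => ?_, fun hF => ?_⟩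
  · have h1 := h.2.1 (le_antisymm h.1 (e ▸ h'.1))
    exact h1.trans (h'.2.1 (le_antisymm h'.1 (e ▸ h.1)))
  · have h1 := h.2.2 hF
    rw [h'.2.2 (h1 ▸ hF), h1]

theorem total_buy {x t j : ℕ} (hN : 3 ≤ N) (ht : t < N) (hj : j < 3) (a : Auction) :
    (a.buy N x t j).total N = a.total N + 1 := by
  have : ∀ p ∈ Finset.range N ×ˢ Finset.range 3, (a.buy N x t j).price (p.1 * N + p.2) =
      a.price (p.1 * N + p.2) + if p = (t, j) then 1 else 0 := by
    rintro ⟨t', j'⟩ hp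
    simp only [Finset.mem_product, Finset.mem_range] at hp
    simp only [Auction.buy, Function.update_apply,
      index_eq_iff (hp.2.trans_le hN) (hj.trans_le hN), Prod.mk.injEq]
    split_ifs with h
    · rw [h.1, h.2]
    · rfl
  rw [Auction.total, Finset.sum_congr rfl this, Finset.sum_add_distrib, Finset.sum_ite_eq',
    if_pos (by simp [ht, hj])]
  rfl

theorem total_le {a : Auction} (h : AuctionInv N G v T a) : a.total N ≤ 3 * N * N := by
  refine (Finset.sum_le_card_nsmul _ _ N fun p hp => ?_).trans ?_
  · simp only [Finset.mem_product, Finset.mem_range] at hp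
    exact h.le _ hp.1 _ hp.2
  · simp [Finset.card_product, mul_comm]

/-- The buyer's slot now costs g + 1 while all its options cost at least g. The other owners keep
their bound since prices only rise. -/
theorem AuctionInv.buy {a : Auction} (h : AuctionInv N G v T a) (hN : 3 ≤ N) {x t j g : ℕ}
    (ht : t < N) (hj : j < 3) (hg : g < N) (hx : Bidder G v T x) (hxa : a.asg (x + 1) = 0)
    (hxt : G.Adj x t) (htv : t ≠ v) (hp : a.price (t * N + j) = g) (hl : Low N G v x g a) :
    AuctionInv N G v T (a.buy N x t j) := by
  have own' : ∀ t' < N, ∀ j' < 3, (a.buy N x t j).own (t' * N + j') =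
      if t' = t ∧ j' = j then x + 1 else a.own (t' * N + j') := fun t' ht' j' hj' => by
    simp only [Auction.buy, Function.update_apply, index_eq_iff (hj'.trans_le hN) (hj.trans_le hN)]
  have price' : ∀ t' < N, ∀ j' < 3, (a.buy N x t j).price (t' * N + j') =
      if t' = t ∧ j' = j then g + 1 else a.price (t' * N + j') := fun t' ht' j' hj' => by
    simp only [Auction.buy, Function.update_apply, index_eq_iff (hj'.trans_le hN) (hj.trans_le hN),
      hp]
  have price_le : ∀ t' < N, ∀ j' < 3, a.price (t' * N + j') ≤
      (a.buy N x t j).price (t' * N + j') := fun t' ht' j' hj' => by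
    rw [price' t' ht' j' hj']
    split_ifs with e
    · rw [e.1, e.2, hp]; omega
    · exact le_rfl
  have nox : ∀ t' < N, ∀ j' < 3, a.own (t' * N + j') ≠ x + 1 := fun t' ht' j' hj' e =>
    (h.owner t' ht' j' hj' x e).2.2.2.1 hxa
  have asg' : ∀ y, (a.buy N x t j).asg y = if y = x + 1 then 1 else
      if y = a.own (t * N + j) then 0 else a.asg y := fun y => by
    simp only [Auction.buy, Function.update_apply]
  constructor
  · intro t' ht' j' hj' y hy
    rw [own' t' ht' j' hj'] at hy
    split_ifs at hy with e
    · obtain ⟨rfl, rfl⟩ := e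
      obtain rfl : x = y := by omega
      refine ⟨hx, hxt, htv, by simp [asg'], fun t'' ht'' j'' hj'' h1 h2 => ?_⟩
      rw [price' t' ht j' hj, if_pos ⟨rfl, rfl⟩]
      exact Nat.succ_le_succ ((hl t'' ht'' j'' hj'' h1 h2).trans (price_le t'' ht'' j'' hj''))
    · obtain ⟨h1, h2, h3, h4, h5⟩ := h.owner t' ht' j' hj' y hy
      refine ⟨h1, h2, h3, ?_, fun t'' ht'' j'' hj'' h6 h7 => ?_⟩
      · rw [asg', if_neg (fun e' => nox t' ht' j' hj' (hy.trans e')), if_neg]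
        · exact h4
        · intro e'
          exact e (h.inj t' ht' j' hj' t ht j hj (hy.trans e') (by omega))
      · rw [price' t' ht' j' hj', if_neg e]
        exact (h5 t'' ht'' j'' hj'' h6 h7).trans (Nat.succ_le_succ (price_le t'' ht'' j'' hj''))
  · intro t' ht' j' hj' hp'
    rw [own' t' ht' j' hj']
    rw [price' t' ht' j' hj'] at hp'
    split_ifs at hp' ⊢ with e
    · omega
    · exact h.pos t' ht' j' hj' hp'
  · intro t₁ ht₁ j₁ hj₁ t₂ ht₂ j₂ hj₂ he hne
    rw [own' t₁ ht₁ j₁ hj₁] at he hne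
    rw [own' t₂ ht₂ j₂ hj₂] at he
    split_ifs at he hne with e₁ e₂ e₂
    · exact ⟨e₁.1.trans e₂.1.symm, e₁.2.trans e₂.2.symm⟩
    · exact absurd he.symm (nox t₂ ht₂ j₂ hj₂)
    · exact absurd he (nox t₁ ht₁ j₁ hj₁)
    · exact h.inj t₁ ht₁ j₁ hj₁ t₂ ht₂ j₂ hj₂ he hne
  · intro y hy hya
    rw [asg'] at hya
    split_ifs at hya with e₁ e₂
    · exact ⟨t, ht, j, hj, by rw [own' t ht j hj, if_pos ⟨rfl, rfl⟩, e₁]⟩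
    · exact absurd rfl hya
    · obtain ⟨t', ht', j', hj', ho⟩ := h.asg y hy hya
      refine ⟨t', ht', j', hj', ?_⟩
      rw [own' t' ht' j' hj', if_neg, ho]
      rintro ⟨rfl, rfl⟩
      exact e₂ ho.symm
  · intro t' ht' j' hj'
    rw [price' t' ht' j' hj']
    split_ifs
    · omega
    · exact h.le t' ht' j' hj'

/-- Once the auction is over, the edges between `v` and the bidders without a slot can be deleted.
-/
theorem yes_and_tame_of_auction {n κ κ' : ℕ} {G' : SimpleGraph ℕ} {a : Auction}
    (h : AuctionInv N G v T a) (hF : Final N G v T a) (hN : 3 * n + 5 ≤ N)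
    (hsupp : ∀ i j, G.Adj i j → i < n)
    (hT : ∀ y z, G.Adj v y → G.Adj y z → z ≠ v → y ∈ T ∨ z ∈ T) (hTc : T.card ≤ 2 * κ')
    (hG' : ∀ y z, G'.Adj y z ↔ G.Adj y z ∧
      ¬ (y = v ∧ Bidder G v T z ∧ a.asg (z + 1) = 0 ∧ ∃ t, G.Adj z t ∧ t ≠ v) ∧
      ¬ (z = v ∧ Bidder G v T y ∧ a.asg (y + 1) = 0 ∧ ∃ t, G.Adj y t ∧ t ≠ v)) :
    (Yes G' κ → Yes G κ) ∧ Tame G' κ' v := by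
  classical
  have hnN : n < N := by omega
  have owner_lt : ∀ t < N, ∀ j < 3, a.own (t * N + j) ≠ 0 → t < n := by
    intro t ht j hj ho
    obtain ⟨x, hx⟩ := Nat.exists_eq_succ_of_ne_zero ho
    exact hsupp t x (h.owner t ht j hj x hx).2.1.symm
  constructor
  -- Slots with a positive price are owned and thus belong to vertices below `n`. So at most 3n
  -- values occur among the N - 1 ≥ 3n + 4 integers strictly between 0 and N.
  · obtain ⟨g, hg0, hgN, hg⟩ : ∃ g, 0 < g ∧ g < N ∧
        ∀ t < N, ∀ j < 3, a.price (t * N + j) ≠ g := by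
      by_contra! hn
      have hsub : Finset.Ioo 0 N ⊆ (Finset.range n ×ˢ Finset.range 3).image
          fun p => a.price (p.1 * N + p.2) := by
        intro g hg
        rw [Finset.mem_Ioo] at hg
        obtain ⟨t, ht, j, hj, e⟩ := hn g hg.1 hg.2
        refine Finset.mem_image.2 ⟨(t, j), ?_, e⟩
        have := owner_lt t ht j hj (h.pos t ht j hj (by omega))
        simp [this, hj]
      have := (Finset.card_le_card hsub).trans Finset.card_image_le
      simp only [Nat.card_Ioo, Finset.card_product, Finset.card_range] at this
      omega
    set D : Finset ℕ := (Finset.range n).filter fun x => Bidder G v T x ∧ a.asg (x + 1) = 0 ∧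
      ∃ t, G.Adj x t ∧ t ≠ v with hD
    set U : Finset ℕ := (Finset.range n).filter fun t => ∃ j < 3, g < a.price (t * N + j) with hU
    have mem_U : ∀ t, t ∈ U ↔ t < n ∧ ∃ j < 3, g < a.price (t * N + j) := fun t => by simp [hU]
    have memD : ∀ x, x ∈ D ↔ Bidder G v T x ∧ a.asg (x + 1) = 0 ∧ ∃ t, G.Adj x t ∧ t ≠ v := by
      intro x
      rw [hD, Finset.mem_filter, Finset.mem_range]
      exact ⟨fun h => h.2, fun h => ⟨hsupp x v h.1.1.symm, h⟩⟩
    -- If one slot of `t` costs more than g, its owner ensures that the other slots of `t` cost at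
    -- least g, and g itself is not a price. The same reasoning gives `bid` below.
    have high : ∀ t ∈ U, ∀ j < 3, g < a.price (t * N + j) := by
      intro t ht j hj
      obtain ⟨htn, j', hj', hp⟩ := (mem_U t).1 ht
      have htN : t < N := by omega
      obtain ⟨x, hx⟩ := Nat.exists_eq_succ_of_ne_zero (h.pos t htN j' hj' (by omega))
      obtain ⟨-, h2, h3, -, h5⟩ := h.owner t htN j' hj' x hx
      have := h5 t htN j hj h2 h3
      have := hg t htN j hj
      omega
    have own : ∀ t ∈ U, ∀ j < 3, ∃ x, a.own (t * N + j) = x + 1 ∧ t < N := by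
      intro t ht j hj
      have htn := ((mem_U t).1 ht).1
      have htN : t < N := by omega
      obtain ⟨x, hx⟩ := Nat.exists_eq_succ_of_ne_zero
        (h.pos t htN j hj (by have := high t ht j hj; omega))
      exact ⟨x, hx, htN⟩
    have bid : ∀ t ∈ U, ∀ j < 3, ∀ z, G.Adj (a.own (t * N + j) - 1) z → z ∈ U ∨ z = v := by
      intro t ht j hj z hz
      by_cases hzv : z = v
      · exact Or.inr hzv
      obtain ⟨x, hx, htN⟩ := own t ht j hj
      rw [hx, Nat.add_sub_cancel] at hz
      have hzn := hsupp _ _ hz.symm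
      have h1 := (h.owner t htN j hj x hx).2.2.2.2 z (by omega) 0 (by norm_num) hz hzv
      have h2 := high t ht j hj
      have h3 := hg z (by omega) 0 (by norm_num)
      exact Or.inl ((mem_U z).2 ⟨hzn, 0, by norm_num, by omega⟩)
    have memU : ∀ x ∈ D, ∀ z, G.Adj x z → z ≠ v → z ∈ U := by
      intro x hx z hz hzv
      have hx' := (memD x).1 hx
      have hxn := hsupp _ _ hz
      have hzn := hsupp _ _ hz.symm
      have h1 := hF x (by omega) hx'.1 hx'.2.1 z (by omega) 0 (by norm_num) hz hzv
      exact (mem_U z).2 ⟨hzn, 0, by norm_num, by omega⟩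
    refine yes_of_crown (v := v) (D := D) (T := U) (fun t j => a.own (t * N + j) - 1) ?_ ?_ ?_ ?_ ?_
      ?_ ?_ ?_ ?_
    · intro y z hyz
      by_cases h' : G'.Adj y z
      · exact Or.inl h'
      · rw [hG'] at h'
        rw [memD, memD]
        by_contra hc
        exact h' ⟨hyz, fun e => hc (Or.inr (Or.inl e)), fun e => hc (Or.inr (Or.inr e))⟩
    · intro t ht t' ht' j j' he
      obtain ⟨x, hx, htN⟩ := own t ht j j.2
      obtain ⟨x', hx', htN'⟩ := own t' ht' j' j'.2
      have := h.inj t htN j j.2 t' htN' j' j'.2 (by omega) (by omega)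
      exact ⟨this.1, Fin.ext this.2⟩
    · intro t ht j
      obtain ⟨x, hx, htN⟩ := own t ht j j.2
      obtain ⟨h1, h2, h3, h4, -⟩ := h.owner t htN j j.2 x hx
      simp only [hx, Nat.add_sub_cancel, hG']
      exact ⟨h1.1.symm, fun h => h1.1.ne h.1.symm, fun h => h4 h.2.2.1⟩
    · intro t ht j
      obtain ⟨x, hx, htN⟩ := own t ht j j.2
      obtain ⟨h1, h2, h3, h4, -⟩ := h.owner t htN j j.2 x hx
      simp only [hx, Nat.add_sub_cancel, hG']
      exact ⟨h2.symm, fun h => h3 h.1, fun h => h1.1.ne h.1.symm⟩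
    · intro t ht j hmem
      obtain ⟨x, hx, htN⟩ := own t ht j j.2
      obtain ⟨h1, -⟩ := h.owner t htN j j.2 x hx
      simp only [hx, Nat.add_sub_cancel] at hmem
      -- An owner in `U` would itself have a slot with an owner y, and the edge between the two
      -- unmatched neighbors of `v` contradicts the maximality of the matching.
      obtain ⟨y, hy, hxN⟩ := own x hmem 0 (by norm_num)
      obtain ⟨h5, h6, h7, -⟩ := h.owner x hxN 0 (by norm_num) y hy
      rcases hT y x h5.1 h6 h7 with h | h
      · exact h5.2 h
      · exact h1.2 h
    · exact fun t ht j => bid t ht j j.2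
    · intro x hx z hz
      by_cases hzv : z = v
      · exact Or.inr hzv
      · exact Or.inl (memU x hx z hz hzv)
    · intro hv
      obtain ⟨x, hx, hvN⟩ := own v hv 0 (by norm_num)
      exact (h.owner v hvN 0 (by norm_num) x hx).2.2.1 rfl
    · rintro ⟨x, hx⟩
      obtain ⟨t, ht, htv⟩ := ((memD x).1 hx).2.2
      exact ⟨t, memU x hx t ht htv⟩
  -- Flagged bidders own slots at vertices of `T`, three per vertex, so the union has size at most
  -- 4|T| ≤ 8κ'.
  · refine ⟨T, T ∪ (Finset.range N).filter (fun x => a.asg (x + 1) ≠ 0), hTc, ?_, ?_, ?_⟩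
    · have hsub : (Finset.range N).filter (fun x => a.asg (x + 1) ≠ 0) ⊆
          (T ×ˢ Finset.range 3).image fun p => a.own (p.1 * N + p.2) - 1 := by
        intro x hx
        rw [Finset.mem_filter, Finset.mem_range] at hx
        obtain ⟨t, ht, j, hj, ho⟩ := h.asg x hx.1 hx.2
        obtain ⟨h1, h2, h3, -⟩ := h.owner t ht j hj x ho
        refine Finset.mem_image.2 ⟨(t, j), ?_, by simp [ho]⟩
        have := (hT x t h1.1 h2 h3).resolve_left h1.2
        simp [this, hj]
      have h1 := (Finset.card_le_card hsub).trans Finset.card_image_le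
      rw [Finset.card_product, Finset.card_range] at h1
      exact (Finset.card_union_le _ _).trans (by omega)
    · exact fun y z hy hz => hT y z ((hG' _ _).1 hy).1 ((hG' _ _).1 hz).1
    · intro y hy hyW z hz
      simp only [Finset.mem_union, Finset.mem_filter, Finset.mem_range, not_or, not_and,
        not_not] at hyW
      obtain ⟨hy1, hy2, hy3⟩ := (hG' _ _).1 hy
      have hyn := hsupp _ _ hy1.symm
      by_contra hzv
      exact hy2 ⟨rfl, ⟨hy1, hyW.1⟩, hyW.2 (by omega), z, ((hG' _ _).1 hz).1, hzv⟩

end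

end PathVertexCover

/-! ### The auction and the crown rule as programs -/

namespace PathVertexCover

open SimpleGraph RAM RAM.Cmd

/-- The current bidder buys the current slot, if it is one of the cheapest. -/
def buyBody : Cmd :=
  guard [.lt (.var 16) (.lit 3), isz (.get 4 (suc (.var 10))), adj 4 10, isz (.get 3 (.var 10)),
    adj 10 11, neq (.var 11) (.var 4), .eq (.get 6 (idx 11 16)) (.var 15)]
    (.seq (.store 4 (.get 5 (idx 11 16)) (.lit 0)) (.seq (.store 4 (suc (.var 10)) (.lit 1))
      (.seq (.store 5 (idx 11 16) (suc (.var 10)))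
        (.store 6 (idx 11 16) (suc (.get 6 (idx 11 16)))))))

/-- The bidder in register `10` buys one of the cheapest slots. -/
def bidBody : Cmd := .loop 15 (loops [11, 16] buyBody)

/-- The auction for the vertex in register `4`. -/
def auction : Cmd := loops [12, 13, 14] (.loop 10 bidBody)

/-- The state of the auction that is held in memory. -/
def auctionOf (s : State) : Auction := ⟨s.arr 4, s.arr 5, s.arr 6⟩

/-- The memory holds the graph `G`, the vertex `v` and the set `T` of marked vertices. -/
structure Ctx (N : ℕ) (G : SimpleGraph ℕ) (v : ℕ) (T : Finset ℕ) (s : State) : Prop where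
  env : Env N s
  rep : Rep N (s.arr 2) G
  vertex : s.reg 4 = v
  lt : v < N
  mark : ∀ i < N, s.arr 3 i ≠ 0 ↔ i ∈ T

section

variable {N : ℕ} {G : SimpleGraph ℕ} {v : ℕ} {T : Finset ℕ}

theorem Ctx.of_frame {R A : List ℕ} {s s' : State} (h : Ctx N G v T s) (hF : Frame R A s s')
    (hR : 2 ∉ R ∧ 4 ∉ R) (hA : 1 ∉ A ∧ 2 ∉ A ∧ 3 ∉ A) : Ctx N G v T s' :=
  ⟨h.env.of_frame hF hR.1 hA.1, by rw [hF.arr 2 hA.2.1]; exact h.rep,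
    by rw [hF.reg 4 hR.2, h.vertex], h.lt, by rw [hF.arr 3 hA.2.2]; exact h.mark⟩

theorem run_buyBody {s : State} (h : Ctx N G v T s) (hx : s.reg 10 < N) (ht : s.reg 11 < N) :
    (auctionOf (buyBody.run s) = (auctionOf s).buy N (s.reg 10) (s.reg 11) (s.reg 16) ∧
      s.reg 16 < 3 ∧ Bidder G v T (s.reg 10) ∧ (auctionOf s).asg (s.reg 10 + 1) = 0 ∧
      G.Adj (s.reg 10) (s.reg 11) ∧ s.reg 11 ≠ v ∧
      (auctionOf s).price (s.reg 11 * N + s.reg 16) = s.reg 15) ∨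
    (auctionOf (buyBody.run s) = auctionOf s ∧
      (s.reg 16 < 3 → Bidder G v T (s.reg 10) → (auctionOf s).asg (s.reg 10 + 1) = 0 →
      G.Adj (s.reg 10) (s.reg 11) → s.reg 11 ≠ v →
      (auctionOf s).price (s.reg 11 * N + s.reg 16) ≠ s.reg 15)) := by
  have hrow := h.env.row _ ht
  have hmark : s.arr 3 (s.reg 10) = 0 ↔ s.reg 10 ∉ T := by
    rw [← h.mark _ hx, not_not]
  rw [buyBody, run_guard]
  split_ifs with hg <;>
  simp only [List.forall_mem_cons, eval_adj h.env h.rep (h.vertex ▸ h.lt) hx,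
    eval_adj h.env h.rep hx ht, eval_idx h.env ht, eval_neq, eval_isz, eval_get, eval_var, eval_suc,
    eval_lt, eval_eq, eval_lit, List.not_mem_nil, false_imp_iff, implies_true, and_true,
    h.vertex, hmark] at hg
  · refine Or.inl ⟨?_, hg.1, ⟨hg.2.2.1, hg.2.2.2.1⟩, hg.2.1, hg.2.2.2.2⟩
    simp [auctionOf, Auction.buy, run, idx, Expr.eval, suc, hrow]
  · refine Or.inr ⟨rfl, fun h1 h2 h3 h4 h5 h6 => hg ⟨h1, h3, h2.1, h2.2, h4, h5, h6⟩⟩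

/-- If the bidder has no slot after the sweep, it bought nothing and the state never changed. Then
no available slot costs exactly the current level, which raises the lower bound by one. -/
theorem bid_level {s : State} (h : Ctx N G v T s) (hN : 3 ≤ N) (hx : s.reg 10 < N)
    (hg : s.reg 15 < N) (ha : AuctionInv N G v T (auctionOf s))
    (hl : Bidder G v T (s.reg 10) → (auctionOf s).asg (s.reg 10 + 1) = 0 →
      Low N G v (s.reg 10) (s.reg 15) (auctionOf s)) :
    AuctionInv N G v T (auctionOf ((loops [11, 16] buyBody).run s)) ∧
    Follows N G v T (auctionOf s) (auctionOf ((loops [11, 16] buyBody).run s)) ∧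
    (Bidder G v T (s.reg 10) →
      (auctionOf ((loops [11, 16] buyBody).run s)).asg (s.reg 10 + 1) = 0 →
      Low N G v (s.reg 10) (s.reg 15 + 1) (auctionOf ((loops [11, 16] buyBody).run s))) := by
  have hsw := run_loops_sweep (xs := [11, 16]) auctionOf
    (by decide : (loops [11, 16] buyBody).wf = true) s
    (fun s x _ w => rfl)
    (fun a => AuctionInv N G v T a ∧ (Bidder G v T (s.reg 10) → a.asg (s.reg 10 + 1) = 0 →
      Low N G v (s.reg 10) (s.reg 15) a))
    (fun a b => Follows N G v T a b ∧ (b.asg (s.reg 10 + 1) = 0 → b = a))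
    (fun a => ⟨Follows.refl a, fun _ => rfl⟩)
    (fun a b c h1 h2 => ⟨h1.1.trans h2.1, fun hc => by
      have e := h2.2 hc
      rw [e, h1.2 (e ▸ hc)]⟩)
    (fun l a => ∀ t j, l = [t, j] → j < 3 → Bidder G v T (s.reg 10) → a.asg (s.reg 10 + 1) = 0 →
      G.Adj (s.reg 10) t → t ≠ v → a.price (t * N + j) ≠ s.reg 15)
    (fun l a b hR hq t j hl hj hb h0 => by
      have e := hR.2 h0
      exact e ▸ hq t j hl hj hb (e ▸ h0)) ?_ ⟨ha, hl⟩
  · obtain ⟨⟨h1, h2⟩, ⟨h3, -⟩, h4⟩ := hsw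
    refine ⟨h1, h3, fun hb h0 t ht j hj hxt htv => ?_⟩
    have h5 := h2 hb h0 t ht j hj hxt htv
    have h6 := h4 [t, j] rfl (by simp [h.env.size, ht]; omega) t j rfl hj hb h0 hxt htv
    omega
  · rintro s' hF hlt ⟨hI, hL⟩
    have hC := h.of_frame hF (by decide) (by decide)
    have e10 : s'.reg 10 = s.reg 10 := hF.reg 10 (by decide)
    have e15 : s'.reg 15 = s.reg 15 := hF.reg 15 (by decide)
    have h11 : s'.reg 11 < N := by simpa [h.env.size] using hlt 11 (by simp)
    rw [← e10, ← e15] at hL ⊢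
    have hx' : s'.reg 10 < N := by rw [e10]; exact hx
    have hg' : s'.reg 15 < N := by rw [e15]; exact hg
    rcases run_buyBody hC hx' h11 with ⟨he, h1, h2, h3, h4, h5, h6⟩ | ⟨he, h1⟩
    · rw [he]
      have asg1 : ((auctionOf s').buy N (s'.reg 10) (s'.reg 11) (s'.reg 16)).asg
          (s'.reg 10 + 1) ≠ 0 := by simp [Auction.buy]
      have hlow := hL h2 h3
      have htot := total_buy (x := s'.reg 10) hN h11 h1 (auctionOf s')
      refine ⟨⟨hI.buy hN h11 h1 hg' h2 h3 h4 h5 h6 hlow, fun _ h0 => absurd h0 asg1⟩,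
        ⟨⟨by omega, fun e => by omega, fun hfin => ?_⟩, fun h0 => absurd h0 asg1⟩,
        fun t j _ _ _ h0 => absurd h0 asg1⟩
      have := hfin _ hx' h2 h3 _ h11 _ h1 h4 h5
      omega
    · rw [he]
      refine ⟨⟨hI, hL⟩, ⟨Follows.refl _, fun _ => rfl⟩, ?_⟩
      intro t j hl hj hb h0 hxt htv
      simp only [List.map_cons, List.map_nil, List.cons.injEq, and_true] at hl
      obtain ⟨rfl, rfl⟩ := hl
      exact h1 hj hb h0 hxt htv

/-- Trying the price levels in increasing order makes the bidder buy at the lowest price. -/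
theorem bid_spec {s : State} (h : Ctx N G v T s) (hN : 3 ≤ N) (hx : s.reg 10 < N)
    (ha : AuctionInv N G v T (auctionOf s)) :
    AuctionInv N G v T (auctionOf (bidBody.run s)) ∧
    Follows N G v T (auctionOf s) (auctionOf (bidBody.run s)) ∧
    (Bidder G v T (s.reg 10) → (auctionOf (bidBody.run s)).asg (s.reg 10 + 1) = 0 →
      Low N G v (s.reg 10) N (auctionOf (bidBody.run s))) := by
  have hind := run_loop_induction (x := 15) (c := loops [11, 16] buyBody) (by decide) s
    (fun g s' => AuctionInv N G v T (auctionOf s') ∧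
      Follows N G v T (auctionOf s) (auctionOf s') ∧
      (Bidder G v T (s.reg 10) → (auctionOf s').asg (s.reg 10 + 1) = 0 →
        Low N G v (s.reg 10) g (auctionOf s'))) ?_ ?_
  · rwa [h.env.size] at hind
  · exact ⟨ha, Follows.refl _, fun _ _ t _ j _ _ _ => Nat.zero_le _⟩
  · rintro g s' hg hs' hF ⟨h1, h2, h3⟩
    have e10 : s'.reg 10 = s.reg 10 := hF.reg 10 (by decide)
    rw [h.env.size] at hg
    have := bid_level (h.of_frame hF (by decide) (by decide)) hN (by omega) (by omega) h1
      (by rwa [e10, hs'])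
    rw [e10, hs'] at this
    exact ⟨this.1, h2.trans this.2.1, this.2.2⟩

/-- If the total price is the same after a round, then by `Follows` the state never changed, so what
held for each bidder at its turn holds for all bidders at once. -/
theorem round_spec {s : State} (h : Ctx N G v T s) (hN : 3 ≤ N)
    (ha : AuctionInv N G v T (auctionOf s)) :
    AuctionInv N G v T (auctionOf ((loop 10 bidBody).run s)) ∧
    Follows N G v T (auctionOf s) (auctionOf ((loop 10 bidBody).run s)) ∧
    ((auctionOf s).total N < (auctionOf ((loop 10 bidBody).run s)).total N ∨
      Final N G v T (auctionOf ((loop 10 bidBody).run s))) := by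
  have hsw := run_loops_sweep (xs := [10]) (c := bidBody) auctionOf (by decide) s
    (fun s x _ w => rfl)
    (fun a => AuctionInv N G v T a ∧ Follows N G v T (auctionOf s) a)
    (Follows N G v T) Follows.refl (fun a b c => Follows.trans)
    (fun l a => ∀ x, l = [x] → (auctionOf s).total N < a.total N ∨
      ((auctionOf s).total N = a.total N ∧
        (Bidder G v T x → a.asg (x + 1) = 0 → Low N G v x N a)))
    (fun l a b hR hq x hl => ?_) ?_ ⟨ha, Follows.refl _⟩
  · obtain ⟨⟨h1, h2⟩, -, h4⟩ := hsw
    refine ⟨h1, h2, ?_⟩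
    by_cases ht : (auctionOf s).total N < (auctionOf ((loop 10 bidBody).run s)).total N
    · exact Or.inl ht
    · refine Or.inr fun x hx => ?_
      exact ((h4 [x] rfl (by simpa [h.env.size] using hx) x rfl).resolve_left ht).2
  · rcases hq x hl with h1 | ⟨h1, h2⟩
    · exact Or.inl (h1.trans_le hR.1)
    · rcases hR.1.lt_or_eq with h3 | h3
      · exact Or.inl (h1.trans_lt h3)
      · rw [← hR.2.1 h3]
        exact Or.inr ⟨h1, h2⟩
  · rintro s' hF hlt ⟨hI, hfol⟩
    have h10 : s'.reg 10 < N := by simpa [h.env.size] using hlt 10 (by simp)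
    obtain ⟨h1, h2, h3⟩ := bid_spec (h.of_frame hF (by decide) (by decide)) hN h10 hI
    refine ⟨⟨h1, hfol.trans h2⟩, h2, fun x hl => ?_⟩
    simp only [List.map_cons, List.map_nil, List.cons.injEq, and_true] at hl
    subst hl
    rcases (hfol.trans h2).1.lt_or_eq with h4 | h4
    · exact Or.inl h4
    · exact Or.inr ⟨h4, h3⟩

/-- There are N³ rounds, and each raises the total price until the auction is over. The total never
exceeds 3N², which is less than N³ as N ≥ 4. -/
theorem auction_spec {s : State} (h : Ctx N G v T s) (hN : 4 ≤ N)
    (h4 : ∀ i < N, s.arr 4 (i + 1) = 0) (h5 : ∀ i < N, ∀ j < N, s.arr 5 (i * N + j) = 0)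
    (h6 : ∀ i < N, ∀ j < N, s.arr 6 (i * N + j) = 0) :
    AuctionInv N G v T (auctionOf (auction.run s)) ∧
      Final N G v T (auctionOf (auction.run s)) := by
  have hc := run_loops_count (xs := [12, 13, 14]) (c := loop 10 bidBody) auctionOf (by decide) s
    (fun s x _ w => rfl)
    (fun k a => AuctionInv N G v T a ∧ (k ≤ a.total N ∨ Final N G v T a)) ?_ 0 ?_
  · obtain ⟨h1, h2⟩ := hc
    refine ⟨h1, h2.resolve_left fun h3 => ?_⟩
    have h7 := total_le h1
    rw [h.env.size] at h3
    simp only [List.length_cons, List.length_nil] at h3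
    have h8 : 4 * (N * N) ≤ N * (N * N) := Nat.mul_le_mul_right _ hN
    have h9 : 0 < N * N := by positivity
    have e1 : N ^ 3 = N * (N * N) := by ring
    have e2 : 3 * N * N = 3 * (N * N) := by ring
    have h10 := h3.trans h7
    simp only [Nat.zero_add, Nat.reduceAdd] at h10
    omega
  · rintro k s' hF ⟨h1, h2⟩
    obtain ⟨h7, h8, h9⟩ := round_spec (h.of_frame hF (by decide) (by decide)) (by omega) h1
    refine ⟨h7, ?_⟩
    rcases h2 with h2 | h2
    · exact h9.imp (fun h => by omega) id
    · right
      rw [h8.2.2 h2]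
      exact h2
  · refine ⟨⟨fun t ht j hj x hx => ?_, fun t ht j hj hp => ?_, fun t ht j hj _ _ _ _ _ hne => ?_,
      fun x hx hne => ?_, fun t ht j hj => ?_⟩, Or.inl (Nat.zero_le _)⟩
    · simp [auctionOf, h5 t ht j (by omega)] at hx
    · exact absurd (h6 t ht j (by omega)) hp
    · exact absurd (h5 t ht j (by omega)) hne
    · exact absurd (h4 x hx) hne
    · simp [auctionOf, h6 t ht j (by omega)]

/-- Delete the edges between the vertex in register `4` and the bidders without a slot. -/
def crown : Cmd :=
  loops [10, 11] (guard [adj 4 10, isz (.get 3 (.var 10)), isz (.get 4 (suc (.var 10))),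
    adj 10 11, neq (.var 11) (.var 4)] (delEdge 10 4))

theorem crown_spec {s : State} (h : Ctx N G v T s) :
    ∃ G', Rep N ((crown.run s).arr 2) G' ∧ ∀ y z, G'.Adj y z ↔ G.Adj y z ∧
      ¬ (y = v ∧ Bidder G v T z ∧ s.arr 4 (z + 1) = 0 ∧ ∃ t, G.Adj z t ∧ t ≠ v) ∧
      ¬ (z = v ∧ Bidder G v T y ∧ s.arr 4 (y + 1) = 0 ∧ ∃ t, G.Adj y t ∧ t ≠ v) := by
  have hsw := delete_sweep (xs := [10, 11]) (x := 10) (y := 4)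
    (by decide : crown.wf = true) h.env (by decide) h.rep
    (fun G' => ∀ y z, G.Adj y z → ¬ G'.Adj y z →
      (y = v ∧ Bidder G v T z ∧ s.arr 4 (z + 1) = 0 ∧ ∃ t, G.Adj z t ∧ t ≠ v) ∨
      (z = v ∧ Bidder G v T y ∧ s.arr 4 (y + 1) = 0 ∧ ∃ t, G.Adj y t ∧ t ≠ v))
    (fun y z h1 h2 => absurd h1 h2)
    (fun l G' => ∀ x t, l = [x, t] → x ∉ T → s.arr 4 (x + 1) = 0 → G.Adj x t → t ≠ v →
      ¬ G'.Adj v x)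
    (fun l G₁ G₂ hle hq x t hl h1 h2 h3 h4 h5 => hq x t hl h1 h2 h3 h4 (hle h5)) ?_
  · obtain ⟨G', hrep, hle, hJ, hQ⟩ := hsw
    refine ⟨G', hrep, fun y z => ⟨fun hyz => ⟨hle hyz, ?_, ?_⟩, fun hyz => ?_⟩⟩
    · rintro ⟨rfl, hb, h0, t, ht, htv⟩
      have h1 := h.rep.supp _ _ ht
      have h2 := h.rep.supp _ _ ht.symm
      exact hQ [z, t] rfl (by simp [h1, h2]) z t rfl hb.2 h0 ht htv hyz
    · rintro ⟨rfl, hb, h0, t, ht, htv⟩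
      have h1 := h.rep.supp _ _ ht
      have h2 := h.rep.supp _ _ ht.symm
      exact hQ [y, t] rfl (by simp [h1, h2]) y t rfl hb.2 h0 ht htv hyz.symm
    · by_contra hn
      rcases hJ y z hyz.1 hn with h1 | h1
      · exact hyz.2.1 h1
      · exact hyz.2.2 h1
  · intro s' hF hE hlt G' hrep hle hJ
    have e4 : s'.reg 4 = v := by rw [hF.reg 4 (by decide), h.vertex]
    have h10 : s'.reg 10 < N := hlt 10 (by simp)
    have h11 : s'.reg 11 < N := hlt 11 (by simp)
    have hmark : s'.arr 3 (s'.reg 10) = 0 ↔ s'.reg 10 ∉ T := by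
      rw [hF.arr 3 (by decide), ← h.mark _ h10, not_not]
    simp only [List.forall_mem_cons, eval_adj hE hrep (e4 ▸ h.lt) h10, eval_adj hE hrep h10 h11,
      eval_neq, eval_isz, eval_get, eval_var, eval_suc, List.not_mem_nil, false_imp_iff,
      implies_true, and_true, e4, hmark, hF.arr 4 (by decide), List.map_cons, List.map_nil,
      List.cons.injEq]
    -- The guard consults the current graph, not `G`. As only edges at `v` disappear, both agree on
    -- the edge from `x` to `t`.
    have keep : ∀ x t, x ∉ T → G.Adj v x → G.Adj x t → t ≠ v → G'.Adj x t := by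
      intro x t hxT hvx hxt htv
      by_contra hn
      rcases hJ x t hxt hn with h1 | h1
      · exact hvx.ne h1.1.symm
      · exact htv h1.1
    refine ⟨fun ⟨g1, g2, g3, g4, g5⟩ => ⟨h10, h.lt, fun y z hyz hn => ?_, ?_⟩, ?_⟩
    · by_cases hy : G'.Adj y z
      · rw [del_adj] at hn
        have hb : Bidder G v T (s'.reg 10) := ⟨hle g1, g2⟩
        have hex : ∃ t, G.Adj (s'.reg 10) t ∧ t ≠ v := ⟨_, hle g4, g5⟩
        by_cases hc : y = s'.reg 10 ∧ z = v
        · right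
          rw [hc.1]
          exact ⟨hc.2, hb, g3, hex⟩
        · left
          have hc' : y = v ∧ z = s'.reg 10 := by
            by_contra hc'
            exact hn ⟨hy, hc, hc'⟩
          rw [hc'.2]
          exact ⟨hc'.1, hb, g3, hex⟩
      · exact hJ y z hyz hy
    · rintro x t ⟨rfl, rfl⟩ - - - - hadj
      exact (del_adj.1 hadj).2.2 ⟨rfl, rfl⟩
    · rintro hg x t ⟨rfl, rfl⟩ h1 h2 h3 h4 h5
      exact hg ⟨h5, h1, h2, keep _ _ h1 (hle h5) h3 h4, h4⟩

end

end PathVertexCover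

/-! ### Applying the local reductions at every vertex -/

namespace PathVertexCover

open SimpleGraph RAM RAM.Cmd

theorem zero_sweep {N : ℕ} {xs : List ℕ} {a : ℕ} {e : Expr}
    (hwf : (loops xs (.store a e (.lit 0))).wf) {s₀ : State} (h : s₀.reg 2 = N) (ev : List ℕ → ℕ)
    (he : ∀ s, Frame (loops xs (.store a e (.lit 0))).wregs (loops xs (.store a e (.lit 0))).warrs
      s₀ s → (∀ x ∈ xs, s.reg x < N) → e.eval s = ev (xs.map s.reg)) (l : List ℕ)
    (hl : l.length = xs.length) (hl' : ∀ i ∈ l, i < N) :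
    ((loops xs (.store a e (.lit 0))).run s₀).arr a (ev l) = 0 := by
  have hsw := run_loops_sweep (fun s => s.arr a) hwf s₀ (fun s x _ v => rfl) (fun _ => True)
    (fun A B => ∀ i, A i = 0 → B i = 0) (fun A i h => h) (fun A B C h h' i hi => h' i (h i hi))
    (fun l A => A (ev l) = 0) (fun l A B hR hq => hR _ hq) ?_ trivial
  · exact hsw.2.2 l hl (by rwa [h])
  · intro s hF hlt _
    rw [h] at hlt
    simp only [run, he s hF hlt, eval_lit, State.arr_setArr, if_true, Function.update_apply,
      true_and]
    exact ⟨fun i hi => by simp [hi], trivial⟩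

/-- Initialize the arrays for the next vertex. -/
def clear : Cmd :=
  .seq (loops [10] (.store 3 (.var 10) (.lit 0))) (.seq (loops [10] (.store 4 (suc (.var 10))
    (.lit 0))) (.seq (loops [10, 11] (.store 5 (idx 10 11) (.lit 0)))
      (.seq (loops [10, 11] (.store 6 (idx 10 11) (.lit 0))) (.assign 3 (.lit 0)))))

theorem clear_spec {N : ℕ} {s : State} (h : Env N s) :
    (∀ i < N, (clear.run s).arr 3 i = 0) ∧ (∀ i < N, (clear.run s).arr 4 (i + 1) = 0) ∧
    (∀ i < N, ∀ j < N, (clear.run s).arr 5 (i * N + j) = 0) ∧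
    (∀ i < N, ∀ j < N, (clear.run s).arr 6 (i * N + j) = 0) ∧ (clear.run s).reg 3 = 0 := by
  set p₁ := loops [10] (.store 3 (.var 10) (.lit 0)) with hp₁
  set p₂ := loops [10] (.store 4 (suc (.var 10)) (.lit 0)) with hp₂
  set p₃ := loops [10, 11] (.store 5 (idx 10 11) (.lit 0)) with hp₃
  set p₄ := loops [10, 11] (.store 6 (idx 10 11) (.lit 0)) with hp₄
  have F₁ := frame_run p₁ s
  have F₂ := frame_run p₂ (p₁.run s)
  have F₃ := frame_run p₃ (p₂.run (p₁.run s))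
  have F₄ := frame_run p₄ (p₃.run (p₂.run (p₁.run s)))
  have E₁ := h.of_frame F₁ (by decide) (by decide)
  have E₂ := E₁.of_frame F₂ (by decide) (by decide)
  have E₃ := E₂.of_frame F₃ (by decide) (by decide)
  have hrun : clear.run s = (p₄.run (p₃.run (p₂.run (p₁.run s)))).setReg 3 0 := rfl
  have ev : ∀ (c : Cmd) {s₀}, Env N s₀ → 2 ∉ c.wregs → 1 ∉ c.warrs → ∀ s,
      Frame c.wregs c.warrs s₀ s →
      (∀ x ∈ [10, 11], s.reg x < N) → (idx 10 11).eval s =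
        (fun l : List ℕ => l[0]! * N + l[1]!) ([10, 11].map s.reg) := by
    intro c s₀ hE hR hA s hF hlt
    rw [eval_idx (hE.of_frame hF hR hA) (hlt 10 (by simp))]
    simp
  rw [hrun]
  refine ⟨fun i hi => ?_, fun i hi => ?_, fun i hi j hj => ?_, fun i hi j hj => ?_, by simp⟩
  · rw [State.arr_setReg, F₄.arr 3 (by decide), F₃.arr 3 (by decide), F₂.arr 3 (by decide)]
    exact zero_sweep (by decide : p₁.wf = true) h.size (fun l => l[0]!) (fun s _ _ => by simp) [i]
      rfl (by simpa using hi)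
  · rw [State.arr_setReg, F₄.arr 4 (by decide), F₃.arr 4 (by decide)]
    exact zero_sweep (by decide : p₂.wf = true) E₁.size (fun l => l[0]! + 1)
      (fun s _ _ => by simp) [i] rfl (by simpa using hi)
  · rw [State.arr_setReg, F₄.arr 5 (by decide)]
    exact zero_sweep (by decide : p₃.wf = true) E₂.size (fun l => l[0]! * N + l[1]!)
      (ev p₃ E₂ (by decide) (by decide)) [i, j] rfl (by simp [hi, hj])
  · rw [State.arr_setReg]
    exact zero_sweep (by decide : p₄.wf = true) E₃.size (fun l => l[0]! * N + l[1]!)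
      (ev p₄ E₃ (by decide) (by decide)) [i, j] rfl (by simp [hi, hj])

/-- Delete the vertex in register `4`. -/
def isolate : Cmd := loops [10] (guard [] (delEdge 4 10))

theorem isolate_spec {N v : ℕ} {s : State} (h : Env N s) {G : SimpleGraph ℕ}
    (hG : Rep N (s.arr 2) G) (h4 : s.reg 4 = v) (hv : v < N) :
    ∃ G', Rep N ((isolate.run s).arr 2) G' ∧ ∀ y z, G'.Adj y z ↔ G.Adj y z ∧ y ≠ v ∧ z ≠ v := by
  have hsw := delete_sweep (xs := [10]) (es := []) (x := 4) (y := 10)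
    (by decide : isolate.wf = true) h (by decide) hG
    (fun G' => ∀ y z, y ≠ v → z ≠ v → G.Adj y z → G'.Adj y z)
    (fun y z _ _ h => h) (fun l G' => ∀ y, l = [y] → ¬ G'.Adj v y)
    (fun l G₁ G₂ hle hq y hl h => hq y hl (hle h)) ?_
  · obtain ⟨G', hrep, hle, hJ, hQ⟩ := hsw
    have hno : ∀ y, ¬ G'.Adj v y := fun y hy =>
      hQ [y] rfl (by simpa using hrep.supp _ _ hy.symm) y rfl hy
    refine ⟨G', hrep, fun y z => ⟨fun hyz => ⟨hle hyz, ?_, ?_⟩, fun hyz => hJ y z hyz.2.1 hyz.2.2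
      hyz.1⟩⟩
    · rintro rfl
      exact hno _ hyz
    · rintro rfl
      exact hno _ hyz.symm
  · intro s' hF hE hlt G' hrep hle hJ
    have e4 : s'.reg 4 = v := by rw [hF.reg 4 (by decide), h4]
    refine ⟨fun _ => ⟨by rwa [e4], hlt 10 (by simp), fun y z hy hz hyz => ?_, ?_⟩,
      fun hn => absurd (by simp) hn⟩
    · rw [del_adj, e4]
      exact ⟨hJ y z hy hz hyz, fun e => hy e.1, fun e => hz e.2⟩
    · intro y hl hadj
      simp only [List.map_cons, List.map_nil, List.cons.injEq, and_true] at hl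
      rw [del_adj, e4] at hadj
      exact hadj.2.1 ⟨rfl, hl.symm⟩

/-- The reductions at the vertex in register `4`. -/
def reduceVertex : Cmd :=
  .seq clear (.seq matching (.cond (.lt (.var 1) (.var 3))
    (.seq isolate (.assign 1 (.sub (.var 1) (.lit 1)))) (.seq auction crown)))

/-- Register `1` may have dropped already; tameness is measured by the fixed bound `κ₀` so that it
is the same for all vertices. -/
theorem reduceVertex_spec {N n v κ₀ : ℕ} {s : State} (h : Env N s) {G : SimpleGraph ℕ}
    (hG : Rep N (s.arr 2) G) (h4 : s.reg 4 = v) (hv : v < N) (hsupp : ∀ i j, G.Adj i j → i < n)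
    (hN : 3 * n + 5 ≤ N) (hκ : s.reg 1 ≤ κ₀) :
    ∃ G', Rep N ((reduceVertex.run s).arr 2) G' ∧ G' ≤ G ∧
      (Yes G' ((reduceVertex.run s).reg 1) ↔ Yes G (s.reg 1)) ∧
      (reduceVertex.run s).reg 1 ≤ κ₀ ∧ Tame G' κ₀ v := by
  obtain ⟨c3, c4, c5, c6, cr⟩ := clear_spec h
  have F₁ := frame_run clear s
  set s₁ := clear.run s with hs₁
  have E₁ : Env N s₁ := h.of_frame F₁ (by decide) (by decide)
  have r₁ : s₁.reg 4 = v := by rw [F₁.reg 4 (by decide), h4]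
  have G₁ : Rep N (s₁.arr 2) G := by rwa [F₁.arr 2 (by decide)]
  obtain ⟨T, hT, ⟨hvT, hTc, hpack⟩, hcov⟩ := matching_spec E₁ G₁ (by rwa [r₁]) c3 cr
  have F₂ := frame_run matching s₁
  set s₂ := matching.run s₁ with hs₂
  rw [r₁] at hpack hcov hvT
  have hC : Ctx N G v T s₂ := ⟨E₁.of_frame F₂ (by decide) (by decide),
    by rwa [F₂.arr 2 (by decide)], by rw [F₂.reg 4 (by decide), r₁], hv, hT⟩
  have e1 : s₂.reg 1 = s.reg 1 := by rw [F₂.reg 1 (by decide), F₁.reg 1 (by decide)]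
  have hrun : reduceVertex.run s = if (Expr.lt (.var 1) (.var 3)).eval s₂ ≠ 0 then
      (isolate.run s₂).setReg 1 ((isolate.run s₂).reg 1 - 1) else crown.run (auction.run s₂) := rfl
  rw [hrun]
  simp only [eval_lt, eval_var]
  split_ifs with hc
  · obtain ⟨G', hrep, hG'⟩ := isolate_spec hC.env hC.rep hC.vertex hv
    have F₃ := frame_run isolate s₂
    refine ⟨G', hrep, fun y z hyz => ((hG' _ _).1 hyz).1, ?_, ?_, ∅, ∅, by simp, by simp,
      fun y z hy => absurd rfl ((hG' _ _).1 hy).2.1, fun y hy => absurd rfl ((hG' _ _).1 hy).2.1⟩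
    · rw [State.reg_setReg, if_pos rfl, F₃.reg 1 (by decide), e1]
      refine yes_iff_of_forced hG' fun S hS hH => ?_
      by_contra hvS
      have h1 := Finset.card_le_card (Finset.inter_subset_left (s₁ := S) (s₂ := T))
      -- A solution without `v` would give at most |S| + 1 ≤ κ matching edges, but there are more
      -- than κ.
      rcases hpack S hH hvS with h2 | ⟨h2, -⟩ <;> omega
    · rw [State.reg_setReg, if_pos rfl, F₃.reg 1 (by decide), e1]
      omega
  · obtain ⟨hI, hF⟩ := auction_spec hC (by omega)
      (fun i hi => by rw [F₂.arr 4 (by decide)]; exact c4 i hi)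
      (fun i hi j hj => by rw [F₂.arr 5 (by decide)]; exact c5 i hi j hj)
      (fun i hi j hj => by rw [F₂.arr 6 (by decide)]; exact c6 i hi j hj)
    have F₃ := frame_run auction s₂
    have F₄ := frame_run crown (auction.run s₂)
    obtain ⟨G', hrep, hG'⟩ := crown_spec (hC.of_frame F₃ (by decide) (by decide))
    have hle : G' ≤ G := fun y z hyz => ((hG' _ _).1 hyz).1
    have := yes_and_tame_of_auction (κ := s.reg 1) (κ' := κ₀) hI hF hN hsupp hcov (by omega) hG'
    rw [F₄.reg 1 (by decide), F₃.reg 1 (by decide), e1]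
    exact ⟨G', hrep, hle, ⟨this.1, fun hY => hY.anti hle⟩, hκ, this.2⟩

/-- The reductions at all vertices. -/
def reduceVertices : Cmd := .loop 4 reduceVertex

theorem reduceVertices_spec {N n : ℕ} {s : State} (h : Env N s) {G : SimpleGraph ℕ}
    (hG : Rep N (s.arr 2) G) (hsupp : ∀ i j, G.Adj i j → i < n) (hN : 3 * n + 5 ≤ N) :
    ∃ G', Rep N ((reduceVertices.run s).arr 2) G' ∧ G' ≤ G ∧
      (Yes G' ((reduceVertices.run s).reg 1) ↔ Yes G (s.reg 1)) ∧
      (reduceVertices.run s).reg 1 ≤ s.reg 1 ∧ ∀ v < N, Tame G' (s.reg 1) v := by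
  have hind := run_loop_induction (x := 4) (c := reduceVertex) (by decide) s
    (fun v s' => ∃ G', Rep N (s'.arr 2) G' ∧ G' ≤ G ∧ (Yes G' (s'.reg 1) ↔ Yes G (s.reg 1)) ∧
      s'.reg 1 ≤ s.reg 1 ∧ ∀ u < v, Tame G' (s.reg 1) u) ?_ ?_
  · rwa [h.size] at hind
  · exact ⟨G, hG, le_rfl, by simp, by simp, fun u hu => absurd hu (by omega)⟩
  · rintro v s' hv hs' hF ⟨G', hrep, hle, hY, hκ, hT⟩
    rw [h.size] at hv
    obtain ⟨G'', h1, h2, h3, h4, h5⟩ := reduceVertex_spec (h.of_frame hF (by decide) (by decide))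
      hrep hs' hv (fun i j hij => hsupp i j (hle hij)) hN hκ
    refine ⟨G'', h1, h2.trans hle, ?_, ?_, fun u hu => ?_⟩
    · simpa using h3.trans hY
    · simpa using h4
    · rcases Nat.lt_succ_iff_lt_or_eq.1 hu with hu | rfl
      · exact (hT u hu).anti h2
      · exact h5

end PathVertexCover

namespace PathVertexCover

open SimpleGraph RAM RAM.Cmd

/-! ### Edges that lie on no path on five vertices -/

/-- The registers `10, …, 14` hold a path on five vertices. -/
def pathGuard : List Expr :=
  [adj 10 11, adj 11 12, adj 12 13, adj 13 14, neq (.var 10) (.var 12), neq (.var 10) (.var 13),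
    neq (.var 10) (.var 14), neq (.var 11) (.var 13), neq (.var 11) (.var 14),
    neq (.var 12) (.var 14)]

theorem pathGuard_iff {N : ℕ} {s : State} (h : Env N s) {G : SimpleGraph ℕ}
    (hG : Rep N (s.arr 2) G) (hlt : ∀ x ∈ [10, 11, 12, 13, 14], s.reg x < N) :
    (∀ e ∈ pathGuard, e.eval s ≠ 0) ↔
      IsP5 G (s.reg 10) (s.reg 11) (s.reg 12) (s.reg 13) (s.reg 14) := by
  have h10 := hlt 10 (by simp)
  have h11 := hlt 11 (by simp)
  have h12 := hlt 12 (by simp)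
  have h13 := hlt 13 (by simp)
  have h14 := hlt 14 (by simp)
  simp only [pathGuard, List.forall_mem_cons, eval_adj h hG h10 h11, eval_adj h hG h11 h12,
    eval_adj h hG h12 h13, eval_adj h hG h13 h14, eval_neq, eval_var, List.not_mem_nil,
    false_imp_iff, implies_true, and_true, IsP5, ne_eq]

theorem OnP5.symm {V : Type*} {G : SimpleGraph V} {u w : V} (h : OnP5 G u w) : OnP5 G w u := by
  obtain ⟨x, y, z, h⟩ := h
  exact ⟨x, y, z, by tauto⟩

/-- Flag the edges that lie on a path on five vertices in array `7`. -/
def flagPaths : Cmd :=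
  loops [10, 11, 12, 13, 14] (guard pathGuard (.seq (.store 7 (idx 10 11) (.lit 1))
    (.seq (.store 7 (idx 11 10) (.lit 1)) (.seq (.store 7 (idx 11 12) (.lit 1))
      (.store 7 (idx 12 11) (.lit 1))))))

/-- Flagging the first two edges of each path suffices, since the reversed path takes care of the
other two. -/
theorem flagPaths_spec {N : ℕ} {s : State} (h : Env N s) {G : SimpleGraph ℕ}
    (hG : Rep N (s.arr 2) G) (h7 : ∀ u < N, ∀ w < N, s.arr 7 (u * N + w) = 0) :
    ∀ u < N, ∀ w < N, (flagPaths.run s).arr 7 (u * N + w) ≠ 0 ↔ OnP5 G u w := by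
  have hsw := run_loops_sweep (xs := [10, 11, 12, 13, 14]) (fun s => s.arr 7)
    (by decide : flagPaths.wf = true) s (fun s x _ v => rfl)
    (fun F => ∀ u < N, ∀ w < N, F (u * N + w) ≠ 0 → OnP5 G u w)
    (fun A B => ∀ i, A i ≠ 0 → B i ≠ 0) (fun A i h => h)
    (fun A B C h h' i hi => h' i (h i hi))
    (fun l F => ∀ a b c d e, l = [a, b, c, d, e] → IsP5 G a b c d e →
      F (a * N + b) ≠ 0 ∧ F (b * N + a) ≠ 0 ∧ F (b * N + c) ≠ 0 ∧ F (c * N + b) ≠ 0)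
    (fun l A B hR hq a b c d e hl hp =>
      let ⟨h1, h2, h3, h4⟩ := hq a b c d e hl hp
      ⟨hR _ h1, hR _ h2, hR _ h3, hR _ h4⟩) ?_
    (fun u hu w hw hne => absurd (h7 u hu w hw) hne)
  · obtain ⟨h1, -, h2⟩ := hsw
    refine fun u hu w hw => ⟨h1 u hu w hw, ?_⟩
    have key : ∀ a b c d e, IsP5 G a b c d e → _ := fun a b c d e hp =>
      h2 [a, b, c, d, e] rfl (by
        have h1 := hG.supp _ _ hp.1
        have h2 := hG.supp _ _ hp.2.1
        have h3 := hG.supp _ _ hp.2.2.1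
        have h4 := hG.supp _ _ hp.2.2.2.1
        have h5 := hG.supp _ _ hp.2.2.2.1.symm
        simp [h.size, h1, h2, h3, h4, h5]) a b c d e rfl hp
    rintro ⟨x, y, z, hp | hp | hp | hp⟩
    · exact (key _ _ _ _ _ hp).1
    · exact (key _ _ _ _ _ hp).2.1
    · exact (key _ _ _ _ _ hp).2.2.1
    · exact (key _ _ _ _ _ hp).2.2.2
  · rintro s' hF hlt hI
    rw [h.size] at hlt
    have hE := h.of_frame hF (by decide) (by decide)
    have hrep : Rep N (s'.arr 2) G := by rwa [hF.arr 2 (by decide)]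
    have h10 := hlt 10 (by simp)
    have h11 := hlt 11 (by simp)
    have h12 := hlt 12 (by simp)
    rw [run_guard]
    split_ifs with hg <;> rw [pathGuard_iff hE hrep hlt] at hg
    · have on1 : OnP5 G (s'.reg 10) (s'.reg 11) := ⟨_, _, _, Or.inl hg⟩
      have on2 : OnP5 G (s'.reg 11) (s'.reg 12) := ⟨_, _, _, Or.inr (Or.inr (Or.inl hg))⟩
      simp only [run, idx, Expr.eval, State.arr_setArr, State.reg_setArr, if_true,
        show (1 : ℕ) ≠ 7 by decide, if_false, hE.row _ h10, hE.row _ h11, hE.row _ h12,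
        Function.update_apply]
      refine ⟨fun u hu w hw => ?_, fun i hi => ?_, fun a b c d e hl _ => ?_⟩
      · simp only [index_eq_iff hw h10, index_eq_iff hw h11, index_eq_iff hw h12]
        split_ifs with e1 e2 e3 e4
        · rw [e1.1, e1.2]
          exact fun _ => on2.symm
        · rw [e2.1, e2.2]
          exact fun _ => on2
        · rw [e3.1, e3.2]
          exact fun _ => on1.symm
        · rw [e4.1, e4.2]
          exact fun _ => on1
        · exact hI u hu w hw
      · split_ifs <;> simp [hi]
      · simp only [List.map_cons, List.map_nil, List.cons.injEq, and_true] at hl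
        obtain ⟨rfl, rfl, rfl, rfl, rfl⟩ := hl
        refine ⟨?_, ?_, ?_, ?_⟩ <;> simp
    · refine ⟨hI, fun i hi => hi, fun a b c d e hl hp => ?_⟩
      simp only [List.map_cons, List.map_nil, List.cons.injEq, and_true] at hl
      obtain ⟨rfl, rfl, rfl, rfl, rfl⟩ := hl
      exact absurd hp hg

/-- Delete the edges that lie on no path on five vertices. -/
def pruneEdges : Cmd :=
  .seq flagPaths (loops [10, 11] (guard [isz (.get 7 (idx 10 11))] (delEdge 10 11)))

/-- One pass is enough: deleting edges on no such path destroys none of the paths, so every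
surviving edge keeps its path. -/
theorem pruneEdges_spec {N : ℕ} {s : State} (h : Env N s) {G : SimpleGraph ℕ}
    (hG : Rep N (s.arr 2) G) (h7 : ∀ u < N, ∀ w < N, s.arr 7 (u * N + w) = 0) :
    ∃ G', Rep N ((pruneEdges.run s).arr 2) G' ∧ G' ≤ G ∧ (∀ κ, Yes G' κ ↔ Yes G κ) ∧
      ∀ u w, G'.Adj u w → OnP5 G' u w := by
  have hflag := flagPaths_spec h hG h7
  have F₁ := frame_run flagPaths s
  set s₁ := flagPaths.run s with hs₁
  have E₁ : Env N s₁ := h.of_frame F₁ (by decide) (by decide)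
  have hsw := delete_sweep (xs := [10, 11]) (es := [isz (.get 7 (idx 10 11))]) (x := 10) (y := 11)
    (by decide) E₁ (by decide) (G := G) (by rwa [F₁.arr 2 (by decide)])
    (fun G' => ∀ u w, G.Adj u w → OnP5 G u w → G'.Adj u w) (fun u w h _ => h)
    (fun l G' => ∀ u w, l = [u, w] → G'.Adj u w → OnP5 G u w)
    (fun l G₁ G₂ hle hq u w hl h => hq u w hl (hle h)) ?_
  · obtain ⟨G', hrep, hle, hJ, hQ⟩ := hsw
    have hp : ∀ a b c d e, IsP5 G a b c d e → IsP5 G' a b c d e := fun a b c d e hp =>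
      ⟨hJ _ _ hp.1 ⟨_, _, _, Or.inl hp⟩, hJ _ _ hp.2.1 ⟨_, _, _, Or.inr (Or.inr (Or.inl hp))⟩,
        hJ _ _ hp.2.2.1 ⟨_, _, _, Or.inr (Or.inr (Or.inr hp.reverse))⟩,
        hJ _ _ hp.2.2.2.1 ⟨_, _, _, Or.inr (Or.inl hp.reverse)⟩, hp.2.2.2.2⟩
    refine ⟨G', hrep, hle, fun κ => ⟨yes_of_isP5_imp hp, fun hY => hY.anti hle⟩, fun u w huw => ?_⟩
    have h1 := hrep.supp _ _ huw
    have h2 := hrep.supp _ _ huw.symm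
    obtain ⟨x, y, z, h⟩ := hQ [u, w] rfl (by simp [h1, h2]) u w rfl huw
    exact ⟨x, y, z, h.imp (hp _ _ _ _ _) (Or.imp (hp _ _ _ _ _)
      (Or.imp (hp _ _ _ _ _) (hp _ _ _ _ _)))⟩
  · intro s' hF hE hlt G' hrep hle hJ
    have h10 : s'.reg 10 < N := hlt 10 (by simp)
    have h11 : s'.reg 11 < N := hlt 11 (by simp)
    have hiff : s'.arr 7 (s'.reg 10 * N + s'.reg 11) ≠ 0 ↔ OnP5 G (s'.reg 10) (s'.reg 11) := by
      rw [hF.arr 7 (by decide)]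
      exact hflag _ h10 _ h11
    simp only [List.forall_mem_cons, eval_isz, eval_get, eval_idx hE h10, List.not_mem_nil,
      false_imp_iff, implies_true, and_true, List.map_cons, List.map_nil, List.cons.injEq]
    refine ⟨fun h0 => ⟨h10, h11, fun u w huw hon => del_adj.2 ⟨hJ u w huw hon, ?_, ?_⟩, ?_⟩, ?_⟩
    · rintro ⟨rfl, rfl⟩
      exact hiff.2 hon h0
    · rintro ⟨rfl, rfl⟩
      exact hiff.2 hon.symm h0
    · rintro u w ⟨rfl, rfl⟩ hadj
      exact absurd ⟨rfl, rfl⟩ (del_adj.1 hadj).2.1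
    · rintro h0 u w ⟨rfl, rfl⟩ -
      exact hiff.1 h0

/-! ### Superfluous pendant vertices -/

/-- The vertex `x` has at least two neighbors. -/
def Branches (G : SimpleGraph ℕ) (x : ℕ) : Prop := ∃ y z, G.Adj x y ∧ G.Adj x z ∧ y ≠ z

theorem IsP5.swap_leaf {G : SimpleGraph ℕ} {x x' v b c d e : ℕ} (hx : ∀ z, G.Adj x z → z = v)
    (hx' : ∀ z, G.Adj x' z → z = v) (h' : G.Adj x' v) (hp : IsP5 G x b c d e) :
    IsP5 G x' b c d e ∧ e ≠ x := by
  obtain ⟨h1, h2, h3, h4, h5, h6, h7, h8, h9, h10⟩ := hp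
  obtain rfl := hx b h1
  refine ⟨⟨h', h2, h3, h4, ?_, ?_, ?_, h8, h9, h10⟩, Ne.symm h7⟩
  · rintro rfl
    exact h8 (hx' d h3).symm
  · rintro rfl
    exact h2.ne (hx' c h3.symm).symm
  · rintro rfl
    exact h8 (hx' d h4.symm).symm

/-- A pendant vertex occurs on a path only as an end, where its twin `x'` can take its place. -/
theorem IsP5.exists_del {G : SimpleGraph ℕ} {x x' v a b c d e : ℕ} (hne : x ≠ x')
    (hx : ∀ z, G.Adj x z → z = v) (hx' : ∀ z, G.Adj x' z → z = v) (h' : G.Adj x' v)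
    (hp : IsP5 G a b c d e) : ∃ a' e', IsP5 (del G x v) a' b c d e' ∧ (a ≠ x → a' = a) ∧
      (e ≠ x → e' = e) := by
  have avoid : ∀ a b c d e, IsP5 G a b c d e → a ≠ x → e ≠ x → IsP5 (del G x v) a b c d e := by
    rintro a b c d e ⟨h1, h2, h3, h4, h5, h6, h7, h8, h9, h10⟩ ha he
    have hb : b ≠ x := by
      rintro rfl
      exact h5 ((hx a h1.symm).trans (hx c h2).symm)
    have hc : c ≠ x := by
      rintro rfl
      exact h8 ((hx b h2.symm).trans (hx d h3).symm)
    have hd : d ≠ x := by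
      rintro rfl
      exact h10 ((hx c h3.symm).trans (hx e h4).symm)
    have tr : ∀ y z, y ≠ x → z ≠ x → G.Adj y z → (del G x v).Adj y z := fun y z hy hz h =>
      del_adj.2 ⟨h, fun e => hy e.1, fun e => hz e.2⟩
    exact ⟨tr _ _ ha hb h1, tr _ _ hb hc h2, tr _ _ hc hd h3, tr _ _ hd he h4, h5, h6, h7, h8, h9,
      h10⟩
  by_cases ha : a = x
  · subst ha
    obtain ⟨h1, h2⟩ := hp.swap_leaf hx hx' h'
    exact ⟨x', e, avoid _ _ _ _ _ h1 (Ne.symm hne) h2, fun h => absurd rfl h, fun _ => rfl⟩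
  by_cases he : e = x
  · subst he
    obtain ⟨h1, h2⟩ := hp.reverse.swap_leaf hx hx' h'
    exact ⟨a, x', avoid _ _ _ _ _ h1.reverse h2 (Ne.symm hne), fun _ => rfl, fun h => absurd rfl h⟩
  · exact ⟨a, e, avoid _ _ _ _ _ hp ha he, fun _ => rfl, fun _ => rfl⟩

theorem OnP5.del_leaf {G : SimpleGraph ℕ} {x x' v u w : ℕ} (hne : x ≠ x')
    (hx : ∀ z, G.Adj x z → z = v) (hx' : ∀ z, G.Adj x' z → z = v) (h' : G.Adj x' v)
    (huw : (del G x v).Adj u w) (h : OnP5 G u w) : OnP5 (del G x v) u w := by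
  obtain ⟨hG, h1, h2⟩ := del_adj.1 huw
  have hu : u ≠ x := by
    rintro rfl
    exact h1 ⟨rfl, hx w hG⟩
  have hw : w ≠ x := by
    rintro rfl
    exact h2 ⟨hx u hG.symm, rfl⟩
  obtain ⟨a, b, c, hp | hp | hp | hp⟩ := h <;>
  obtain ⟨a', e', hp', ha, he⟩ := hp.exists_del hne hx hx' h'
  · exact ⟨_, _, _, Or.inl (ha hu ▸ hp')⟩
  · exact ⟨_, _, _, Or.inr (Or.inl (ha hw ▸ hp'))⟩
  · exact ⟨_, _, _, Or.inr (Or.inr (Or.inl hp'))⟩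
  · exact ⟨_, _, _, Or.inr (Or.inr (Or.inr hp'))⟩

/-- A path through the pendant edge ends in `x`, so it leaves `v` by another edge. -/
theorem OnP5.branches {G : SimpleGraph ℕ} {x v : ℕ} (hx : ∀ z, G.Adj x z → z = v)
    (h : OnP5 G v x) : Branches G v := by
  obtain ⟨a, b, c, hp | hp | hp | hp⟩ := h
  · exact absurd (hx _ hp.2.1).symm hp.2.2.2.2.1
  · exact ⟨x, a, hp.1.symm, hp.2.1, hp.2.2.2.2.1⟩
  · exact absurd (hx _ hp.2.2.1).symm hp.2.2.2.2.2.2.2.1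
  · exact absurd (hx _ hp.1.symm) hp.2.2.2.2.1

/-- Mark the vertices with at least two neighbors in array `8`. -/
def markBranches : Cmd :=
  loops [10, 11, 12] (guard [adj 10 11, adj 10 12, neq (.var 11) (.var 12)]
    (.store 8 (.var 10) (.lit 1)))

theorem markBranches_spec {N : ℕ} {s : State} (h : Env N s) {G : SimpleGraph ℕ}
    (hG : Rep N (s.arr 2) G) (h8 : ∀ x < N, s.arr 8 x = 0) :
    ∀ x < N, (markBranches.run s).arr 8 x ≠ 0 ↔ Branches G x := by
  have hsw := run_loops_sweep (xs := [10, 11, 12]) (fun s => s.arr 8)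
    (by decide : markBranches.wf = true) s (fun s x _ v => rfl)
    (fun F => ∀ x < N, F x ≠ 0 → Branches G x)
    (fun A B => ∀ i, A i ≠ 0 → B i ≠ 0) (fun A i h => h)
    (fun A B C h h' i hi => h' i (h i hi))
    (fun l F => ∀ x y z, l = [x, y, z] → G.Adj x y → G.Adj x z → y ≠ z → F x ≠ 0)
    (fun l A B hR hq x y z hl h1 h2 h3 => hR _ (hq x y z hl h1 h2 h3)) ?_
    (fun x hx hne => absurd (h8 x hx) hne)
  · obtain ⟨h1, -, h2⟩ := hsw
    refine fun x hx => ⟨h1 x hx, ?_⟩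
    rintro ⟨y, z, hy, hz, hne⟩
    have h3 := hG.supp _ _ hy.symm
    have h4 := hG.supp _ _ hz.symm
    exact h2 [x, y, z] rfl (by simp [h.size, hx, h3, h4]) x y z rfl hy hz hne
  · rintro s' hF hlt hI
    rw [h.size] at hlt
    have hE := h.of_frame hF (by decide) (by decide)
    have hrep : Rep N (s'.arr 2) G := by rwa [hF.arr 2 (by decide)]
    have h10 := hlt 10 (by simp)
    have h11 := hlt 11 (by simp)
    have h12 := hlt 12 (by simp)
    rw [run_guard]
    split_ifs with hg <;> simp only [List.forall_mem_cons, eval_adj hE hrep h10 h11,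
      eval_adj hE hrep h10 h12, eval_neq, eval_var, List.not_mem_nil, false_imp_iff, implies_true,
      and_true] at hg
    · simp only [run, eval_var, eval_lit, State.arr_setArr, if_true, Function.update_apply]
      refine ⟨fun x hx => ?_, fun i hi => ?_, fun x y z hl _ _ _ => ?_⟩
      · split_ifs with e
        · exact fun _ => ⟨_, _, e ▸ hg.1, e ▸ hg.2.1, hg.2.2⟩
        · exact hI x hx
      · split_ifs <;> simp [hi]
      · simp only [List.map_cons, List.cons.injEq] at hl
        simp [hl.1]
    · refine ⟨hI, fun i hi => hi, fun x y z hl h1 h2 h3 => ?_⟩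
      simp only [List.map_cons, List.map_nil, List.cons.injEq, and_true] at hl
      obtain ⟨rfl, rfl, rfl⟩ := hl
      exact absurd ⟨h1, h2, h3⟩ hg

/-- Delete all but one of the pendant neighbors of every vertex. -/
def pruneLeaves : Cmd :=
  .seq markBranches (loops [10, 11, 12] (guard [adj 10 12, adj 11 12, neq (.var 10) (.var 11),
    isz (.get 8 (.var 10)), isz (.get 8 (.var 11))] (delEdge 10 12)))

/-- The marks are computed once, before any deletion. They stay valid because no branching vertex
becomes pendant: when `x` is cut off from `v`, the pendant edge to `x'` still lies on a path on five
vertices, so `v` keeps two neighbors. -/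
theorem pruneLeaves_spec {N : ℕ} {s : State} (h : Env N s) {G : SimpleGraph ℕ}
    (hG : Rep N (s.arr 2) G) (h8 : ∀ x < N, s.arr 8 x = 0)
    (hon : ∀ u w, G.Adj u w → OnP5 G u w) :
    ∃ G', Rep N ((pruneLeaves.run s).arr 2) G' ∧ G' ≤ G ∧ (∀ κ, Yes G' κ ↔ Yes G κ) ∧
      (∀ u w, G'.Adj u w → OnP5 G' u w) ∧ NoTwinPendants G' := by
  have hmark := markBranches_spec h hG h8
  have F₁ := frame_run markBranches s
  set s₁ := markBranches.run s with hs₁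
  have E₁ : Env N s₁ := h.of_frame F₁ (by decide) (by decide)
  have hsw := delete_sweep (xs := [10, 11, 12]) (es := [adj 10 12, adj 11 12,
    neq (.var 10) (.var 11), isz (.get 8 (.var 10)), isz (.get 8 (.var 11))]) (x := 10) (y := 12)
    (by decide) E₁ (by decide) (G := G) (by rwa [F₁.arr 2 (by decide)])
    (fun G' => (∀ κ, Yes G' κ → Yes G κ) ∧ (∀ u w, G'.Adj u w → OnP5 G' u w) ∧
      ∀ x, Branches G x → Branches G' x) ⟨fun κ h => h, hon, fun x h => h⟩
    (fun l G' => ∀ x x' v, l = [x, x', v] → ¬ Branches G x → ¬ Branches G x' → G'.Adj x v →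
      G'.Adj x' v → x = x')
    (fun l G₁ G₂ hle hq x x' v hl h1 h2 h3 h4 => hq x x' v hl h1 h2 (hle h3) (hle h4)) ?_
  · obtain ⟨G', hrep, hle, ⟨hJ1, hJ2, hJ3⟩, hQ⟩ := hsw
    refine ⟨G', hrep, hle, fun κ => ⟨hJ1 κ, fun hY => hY.anti hle⟩, hJ2,
      fun b w w' hwb hwb' hw hw' => ?_⟩
    have nb : ∀ w, (∀ z, G'.Adj w z → z = b) → ¬ Branches G w := by
      intro w hw hbr
      obtain ⟨y, z, h1, h2, h3⟩ := hJ3 w hbr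
      exact h3 ((hw y h1).trans (hw z h2).symm)
    have h1 := hrep.supp _ _ hwb
    have h2 := hrep.supp _ _ hwb'
    have h3 := hrep.supp _ _ hwb.symm
    exact hQ [w, w', b] rfl (by simp [h1, h2, h3]) w w' b rfl (nb w hw) (nb w' hw') hwb hwb'
  · rintro s' hF hE hlt G' hrep hle ⟨hJ1, hJ2, hJ3⟩
    have h10 : s'.reg 10 < N := hlt 10 (by simp)
    have h11 : s'.reg 11 < N := hlt 11 (by simp)
    have h12 : s'.reg 12 < N := hlt 12 (by simp)
    have hb : ∀ x < N, s'.arr 8 x = 0 ↔ ¬ Branches G x := by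
      intro x hx
      rw [hF.arr 8 (by decide), ← hmark x hx, not_not]
    simp only [List.forall_mem_cons, eval_adj hE hrep h10 h12, eval_adj hE hrep h11 h12, eval_neq,
      eval_isz, eval_get, eval_var, hb _ h10, hb _ h11, List.not_mem_nil,
      false_imp_iff, implies_true, and_true, List.map_cons, List.map_nil, List.cons.injEq]
    generalize s'.reg 10 = x at *
    generalize s'.reg 11 = x' at *
    generalize s'.reg 12 = v at *
    refine ⟨?_, ?_⟩
    · rintro ⟨g1, g2, g3, g4, g5⟩
      have only : ∀ x, G'.Adj x v → ¬ Branches G x → ∀ z, G'.Adj x z → z = v := by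
        intro x hxv hbr z hz
        by_contra hne
        exact hbr ⟨z, v, hle hz, hle hxv, hne⟩
      have hx := only x g1 g4
      have hx' := only x' g2 g5
      have hdel : (del G' x v).Adj x' v :=
        del_adj.2 ⟨g2, fun e => g3 e.1.symm, fun e => g2.ne e.1⟩
      have hon' : ∀ u w, (del G' x v).Adj u w → OnP5 (del G' x v) u w := fun u w huw =>
        OnP5.del_leaf g3 hx hx' g2 huw (hJ2 u w (del_le _ _ _ huw))
      refine ⟨h10, h12, ⟨fun κ hY => hJ1 κ ?_, hon', fun y hy => ?_⟩, ?_⟩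
      · refine yes_of_twin_pendants (fun y z hyz => ?_) hx hx' hdel hY
        rw [del_adj]
        tauto
      · by_cases hyv : y = v
        · subst hyv
          exact (hon' _ _ hdel.symm).branches fun z hz => hx' z (del_le _ _ _ hz)
        · have hyx : y ≠ x := fun e => g4 (e ▸ hy)
          obtain ⟨z₁, z₂, h1, h2, h3⟩ := hJ3 y hy
          exact ⟨z₁, z₂, del_adj.2 ⟨h1, fun e => hyx e.1, fun e => hyv e.1⟩,
            del_adj.2 ⟨h2, fun e => hyx e.1, fun e => hyv e.1⟩, h3⟩
      · rintro y y' w ⟨rfl, rfl, rfl⟩ - - hadj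
        exact absurd ⟨rfl, rfl⟩ (del_adj.1 hadj).2.1
    · rintro hg y y' w ⟨rfl, rfl, rfl⟩ h1 h2 h3 h4
      by_contra hne
      exact hg ⟨h3, h4, hne, h1, h2⟩

end PathVertexCover

namespace PathVertexCover

open SimpleGraph RAM RAM.Cmd

/-! ### Packing disjoint paths -/

/-- Greedily pack disjoint paths on five vertices; array `9` marks their vertices, and register `5`
counts the paths. -/
def packPaths : Cmd :=
  loops [10, 11, 12, 13, 14] (guard (pathGuard ++ [isz (.get 9 (.var 10)), isz (.get 9 (.var 11)),
    isz (.get 9 (.var 12)), isz (.get 9 (.var 13)), isz (.get 9 (.var 14))])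
    (.seq (.store 9 (.var 10) (.lit 1)) (.seq (.store 9 (.var 11) (.lit 1))
      (.seq (.store 9 (.var 12) (.lit 1)) (.seq (.store 9 (.var 13) (.lit 1))
        (.seq (.store 9 (.var 14) (.lit 1)) (.assign 5 (suc (.var 5)))))))))

/-- The properties of the vertex set `M` of `c` disjoint paths on five vertices. -/
def PackInv (G : SimpleGraph ℕ) (M : Finset ℕ) (c : ℕ) : Prop :=
  M.card = 5 * c ∧ ∀ S, Hits G S → c ≤ (S ∩ M).card

theorem PackInv.step {G : SimpleGraph ℕ} {M : Finset ℕ} {m a b c d e : ℕ} (h : PackInv G M m)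
    (hp : IsP5 G a b c d e) (ha : a ∉ M) (hb : b ∉ M) (hc : c ∉ M) (hd : d ∉ M) (he : e ∉ M) :
    PackInv G (M ∪ {a, b, c, d, e}) (m + 1) := by
  have hdis : Disjoint M {a, b, c, d, e} := by simp [ha, hb, hc, hd, he]
  constructor
  · rw [Finset.card_union_of_disjoint hdis, h.1]
    have hp' := hp
    obtain ⟨h1, h2, h3, h4, h5, h6, h7, h8, h9, h10⟩ := hp'
    have : ({a, b, c, d, e} : Finset ℕ).card = 5 := by
      rw [Finset.card_insert_of_notMem (by simp [h1.ne, h5, h6, h7]),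
        Finset.card_insert_of_notMem (by simp [h2.ne, h8, h9]),
        Finset.card_insert_of_notMem (by simp [h3.ne, h10]),
        Finset.card_insert_of_notMem (by simp [h4.ne]), Finset.card_singleton]
    rw [this]
    ring
  · intro S hS
    have h1 := h.2 S hS
    rw [Finset.inter_union_distrib_left, Finset.card_union_of_disjoint
      (hdis.mono Finset.inter_subset_right Finset.inter_subset_right)]
    have : 0 < (S ∩ {a, b, c, d, e}).card := by
      rw [Finset.card_pos]
      rcases hS _ _ _ _ _ hp with h | h | h | h | h
      · exact ⟨a, by simp [h]⟩
      · exact ⟨b, by simp [h]⟩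
      · exact ⟨c, by simp [h]⟩
      · exact ⟨d, by simp [h]⟩
      · exact ⟨e, by simp [h]⟩
    omega

theorem packPaths_spec {N : ℕ} {s : State} (h : Env N s) {G : SimpleGraph ℕ}
    (hG : Rep N (s.arr 2) G) (h9 : ∀ x < N, s.arr 9 x = 0) (h5 : s.reg 5 = 0) :
    ∃ M, PackInv G M ((packPaths.run s).reg 5) ∧ Hits G M := by
  have hsw := run_loops_sweep (xs := [10, 11, 12, 13, 14])
    (fun s => (s.arr 9, s.reg 5)) (by decide : packPaths.wf = true) s
    (by
      intro s x hx v
      simp only [List.mem_cons, List.not_mem_nil, or_false] at hx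
      rcases hx with rfl | rfl | rfl | rfl | rfl <;> simp)
    (fun a => ∃ M : Finset ℕ, (∀ i < N, a.1 i ≠ 0 ↔ i ∈ M) ∧ PackInv G M a.2)
    (fun a b => ∀ i, a.1 i ≠ 0 → b.1 i ≠ 0) (fun a i h => h)
    (fun a b c h h' i hi => h' i (h i hi))
    (fun l p => ∀ a b c d e, l = [a, b, c, d, e] → IsP5 G a b c d e →
      p.1 a ≠ 0 ∨ p.1 b ≠ 0 ∨ p.1 c ≠ 0 ∨ p.1 d ≠ 0 ∨ p.1 e ≠ 0)
    (fun l p q hR hq a b c d e hl hp => (hq a b c d e hl hp).imp (hR _) (Or.imp (hR _)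
      (Or.imp (hR _) (Or.imp (hR _) (hR _))))) ?_
    ⟨∅, fun i hi => by simp [h9 i hi], by simp [h5], fun S _ => by simp [h5]⟩
  · obtain ⟨⟨M, h1, h2⟩, -, h3⟩ := hsw
    refine ⟨M, h2, fun a b c d e hp => ?_⟩
    have ha := hG.supp _ _ hp.1
    have hb := hG.supp _ _ hp.2.1
    have hc := hG.supp _ _ hp.2.2.1
    have hd := hG.supp _ _ hp.2.2.2.1
    have he := hG.supp _ _ hp.2.2.2.1.symm
    have := h3 [a, b, c, d, e] rfl (by simp [h.size, ha, hb, hc, hd, he]) a b c d e rfl hp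
    rwa [h1 a ha, h1 b hb, h1 c hc, h1 d hd, h1 e he] at this
  · rintro s' hF hlt ⟨M, hM, hinv⟩
    rw [h.size] at hlt
    have hE := h.of_frame hF (by decide) (by decide)
    have hrep : Rep N (s'.arr 2) G := by rwa [hF.arr 2 (by decide)]
    have hm : ∀ x ∈ [10, 11, 12, 13, 14], (s'.arr 9 (s'.reg x) = 0 ↔ s'.reg x ∉ M) := by
      intro x hx
      rw [← hM _ (hlt x hx), not_not]
    have m10 := hm 10 (by simp)
    have m11 := hm 11 (by simp)
    have m12 := hm 12 (by simp)
    have m13 := hm 13 (by simp)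
    have m14 := hm 14 (by simp)
    rw [run_guard]
    split_ifs with hg <;> rw [List.forall_mem_append, pathGuard_iff hE hrep hlt] at hg <;>
    simp only [List.forall_mem_cons, eval_isz, eval_get, eval_var, m10, m11, m12, m13, m14,
      List.not_mem_nil, false_imp_iff, implies_true, and_true] at hg
    · obtain ⟨hp, n10, n11, n12, n13, n14⟩ := hg
      simp only [run, eval_var, eval_lit, eval_suc, State.arr_setArr, State.reg_setArr,
        State.arr_setReg, State.reg_setReg, if_true]
      refine ⟨⟨_, fun i hi => ?_, hinv.step hp n10 n11 n12 n13 n14⟩, fun i hi => ?_, ?_⟩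
      · simp only [Finset.mem_union, Finset.mem_insert, Finset.mem_singleton, ← hM i hi,
          Function.update_apply]
        split_ifs <;> simp [*]
      · simp only [Function.update_apply]
        split_ifs <;> simp [hi]
      · intro a b c d e hl _
        simp only [List.map_cons, List.map_nil, List.cons.injEq, and_true] at hl
        obtain ⟨rfl, rfl, rfl, rfl, rfl⟩ := hl
        exact Or.inr (Or.inr (Or.inr (Or.inr (by simp))))
    · refine ⟨⟨M, hM, hinv⟩, fun i hi => hi, ?_⟩
      intro a b c d e hl hp
      simp only [List.map_cons, List.map_nil, List.cons.injEq, and_true] at hl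
      obtain ⟨rfl, rfl, rfl, rfl, rfl⟩ := hl
      by_contra! hn
      exact hg ⟨hp, m10.1 hn.1, m11.1 hn.2.1, m12.1 hn.2.2.1, m13.1 hn.2.2.2.1, m14.1 hn.2.2.2.2⟩

/-! ### Filling tables -/

/-- A sweep that fills a table. -/
theorem fill_sweep {N a : ℕ} {es : List Expr} {ei ev : Expr}
    (hwf : (loops [10, 11] (guard es (.store a ei ev))).wf) {s₀ : State} (h : s₀.reg 2 = N)
    (P : ℕ → ℕ → Prop) (pos val : ℕ → ℕ → ℕ)
    (hinj : ∀ i j i' j', i < N → j < N → i' < N → j' < N → P i j → P i' j' →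
      pos i j = pos i' j' → i = i' ∧ j = j')
    (hs : ∀ s, Frame (loops [10, 11] (guard es (.store a ei ev))).wregs
        (loops [10, 11] (guard es (.store a ei ev))).warrs s₀ s → s.reg 10 < N → s.reg 11 < N →
      ((∀ e ∈ es, e.eval s ≠ 0) ↔ P (s.reg 10) (s.reg 11)) ∧
      (P (s.reg 10) (s.reg 11) → ei.eval s = pos (s.reg 10) (s.reg 11) ∧
        ev.eval s = val (s.reg 10) (s.reg 11))) :
    (∀ i < N, ∀ j < N, P i j →
      ((loops [10, 11] (guard es (.store a ei ev))).run s₀).arr a (pos i j) = val i j) ∧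
    ∀ p, (∀ i < N, ∀ j < N, P i j → pos i j ≠ p) →
      ((loops [10, 11] (guard es (.store a ei ev))).run s₀).arr a p = s₀.arr a p := by
  have hsw := run_loops_sweep (fun s => s.arr a) hwf s₀ (fun s x _ v => rfl)
    (fun A => ∀ p, (∀ i < N, ∀ j < N, P i j → pos i j ≠ p) → A p = s₀.arr a p)
    (fun A B => ∀ i < N, ∀ j < N, P i j → A (pos i j) = val i j → B (pos i j) = val i j)
    (fun A i _ j _ _ h => h) (fun A B C h h' i hi j hj hp hv => h' i hi j hj hp (h i hi j hj hp hv))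
    (fun l A => ∀ i < N, ∀ j < N, l = [i, j] → P i j → A (pos i j) = val i j)
    (fun l A B hR hq i hi j hj hl hp => hR i hi j hj hp (hq i hi j hj hl hp)) ?_ (fun p _ => rfl)
  · obtain ⟨h1, -, h2⟩ := hsw
    exact ⟨fun i hi j hj hp => h2 [i, j] rfl (by simp [h, hi, hj]) i hi j hj rfl hp, h1⟩
  · intro s hF hlt hI
    have h10 : s.reg 10 < N := by simpa [h] using hlt 10 (by simp)
    have h11 : s.reg 11 < N := by simpa [h] using hlt 11 (by simp)
    obtain ⟨s1, s2⟩ := hs s hF h10 h11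
    rw [run_guard]
    split_ifs with hg
    · have hP := s1.1 hg
      obtain ⟨s3, s4⟩ := s2 hP
      simp only [run, s3, s4, State.arr_setArr, if_true, Function.update_apply]
      refine ⟨fun p hp => ?_, fun i hi j hj hp hv => ?_, fun i hi j hj hl hp => ?_⟩
      · rw [if_neg (fun e => hp _ h10 _ h11 hP e.symm)]
        exact hI p hp
      · split_ifs with e
        · obtain ⟨e1, e2⟩ := hinj _ _ _ _ hi hj h10 h11 hp hP e
          rw [e1, e2]
        · exact hv
      · simp only [List.map_cons, List.map_nil, List.cons.injEq, and_true] at hl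
        rw [hl.1, hl.2, if_pos rfl]
    · refine ⟨hI, fun i _ j _ _ h => h, fun i hi j hj hl hp => ?_⟩
      simp only [List.map_cons, List.map_nil, List.cons.injEq, and_true] at hl
      obtain ⟨rfl, rfl⟩ := hl
      exact absurd (s1.2 hp) hg

/-- Write the multiples of register `r` to array `a`. -/
def rows (a r : ℕ) : Cmd := .loop 10 (.store a (suc (.var 10)) (.add (.get a (.var 10)) (.var r)))

/-- The machine cannot multiply, so row offsets of matrices come from a table built by repeated
addition. -/
theorem rows_spec {a r : ℕ} (hr : r ≠ 10) {s : State} (h : s.arr a 0 = 0) :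
    ∀ i ≤ s.reg 2, ((rows a r).run s).arr a i = i * s.reg r := by
  have hind := run_loop_induction (x := 10)
    (c := .store a (suc (.var 10)) (.add (.get a (.var 10)) (.var r))) (by simp [wf, wregs]) s
    (fun i s' => ∀ p ≤ i, s'.arr a p = p * s.reg r) ?_ ?_
  · exact hind
  · intro p hp
    obtain rfl : p = 0 := by omega
    simpa using h
  · intro i s' hi hs' hF hP p hp
    have er : s'.reg r = s.reg r := hF.reg r (by simp [wregs, hr])
    simp only [run, State.arr_setReg, State.arr_setArr, if_true, Function.update_apply, eval_suc,
      hs', Expr.eval, er]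
    split_ifs with e
    · rw [e, hP i le_rfl]
      ring
    · exact hP p (by omega)

/-! ### A trivial no-instance -/

/-- The path on the vertices `0, …, 4`. -/
def shortPath : SimpleGraph ℕ where
  Adj i j := i < 5 ∧ j < 5 ∧ (i + 1 = j ∨ j + 1 = i)
  symm := ⟨fun _ _ h => ⟨h.2.1, h.1, h.2.2.symm⟩⟩
  loopless := ⟨fun i h => by omega⟩

theorem not_yes_shortPath : ¬ Yes shortPath 1 := by
  rintro ⟨S, hS, hH⟩
  obtain rfl : S = ∅ := by
    rw [← Finset.card_eq_zero]
    omega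
  simpa using hH 0 1 2 3 4 (by simp [IsP5, shortPath])

/-- If register `5` is not smaller than register `1`, replace the instance by a no-instance. -/
def replaceNo : Cmd :=
  .cond (.lt (.var 5) (.var 1)) .skip (.seq (loops [10, 11] (guard [] (.store 2 (idx 10 11)
    (.lt (.lit 2) (.add (.add (.lt (.var 10) (.lit 5)) (.lt (.var 11) (.lit 5)))
      (.add (.eq (suc (.var 10)) (.var 11)) (.eq (suc (.var 11)) (.var 10))))))))
    (.assign 1 (.lit 1)))

theorem replaceNo_spec {N : ℕ} {s : State} (h : Env N s) (hN : 5 ≤ N) :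
    (s.reg 5 < s.reg 1 ∧ replaceNo.run s = s) ∨
    (s.reg 1 ≤ s.reg 5 ∧ Rep N ((replaceNo.run s).arr 2) shortPath ∧
      (replaceNo.run s).reg 1 = 1) := by
  have hf := fill_sweep (N := N) (a := 2) (es := []) (ei := idx 10 11)
    -- The two successor relations exclude each other, so the sum of the four indicators exceeds 2
    -- exactly at the edges of the short path.
    (ev := .lt (.lit 2) (.add (.add (.lt (.var 10) (.lit 5)) (.lt (.var 11) (.lit 5)))
      (.add (.eq (suc (.var 10)) (.var 11)) (.eq (suc (.var 11)) (.var 10)))))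
    (by decide) h.size (fun _ _ => True) (fun i j => i * N + j)
    (fun i j => if i < 5 ∧ j < 5 ∧ (i + 1 = j ∨ j + 1 = i) then 1 else 0)
    (fun i j i' j' _ hj _ hj' _ _ e => (index_eq_iff hj hj').1 e) ?_
  · rw [replaceNo]
    simp only [run, eval_lt, eval_var]
    split_ifs with hc
    · exact Or.inl ⟨hc, rfl⟩
    · refine Or.inr ⟨by omega, ⟨fun i j hi hj => ?_, fun i j hij => hij.1.trans_le hN⟩, by simp⟩
      rw [State.arr_setReg, hf.1 i hi j hj trivial]
      simp only [shortPath, ne_eq, ite_eq_right_iff, one_ne_zero, imp_false, not_not]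
  · intro s' hF h10 h11
    have hE := h.of_frame hF (by decide) (by decide)
    refine ⟨by simp, fun _ => ⟨eval_idx hE h10, ?_⟩⟩
    simp only [Expr.eval, suc]
    by_cases h1 : s'.reg 10 < 5 <;> by_cases h2 : s'.reg 11 < 5 <;>
    by_cases h3 : s'.reg 10 + 1 = s'.reg 11 <;> by_cases h4 : s'.reg 11 + 1 = s'.reg 10 <;>
    simp only [h1, h2, h3, h4, if_true, if_false, true_and, false_and, or_true, or_false,
      or_self] <;> first | omega | rfl

end PathVertexCover

namespace PathVertexCover

open SimpleGraph RAM RAM.Cmd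

/-! ### Input and output -/

/-- Copy the input graph to array `2`, and increment register `1`. -/
def input : Cmd :=
  .seq (rows 1 2) (.seq (rows 12 0) (.seq (loops [10, 11] (guard [.lt (.var 10) (.var 0),
    .lt (.var 11) (.var 0)] (.store 2 (idx 10 11) (.get 0 (.add (.get 12 (.var 10)) (.var 11))))))
    (.assign 1 (suc (.var 1)))))

/-- The graph of an instance as a graph on the natural numbers. -/
def Instance.natGraph (I : Instance) : SimpleGraph ℕ := I.graph.map Fin.valEmbedding

theorem Instance.natGraph_adj (I : Instance) (i j : Fin I.n) :
    I.natGraph.Adj i j ↔ I.graph.Adj i j :=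
  SimpleGraph.map_adj_apply (f := Fin.valEmbedding)

theorem Instance.lt_of_natGraph_adj (I : Instance) {x y : ℕ} (h : I.natGraph.Adj x y) :
    x < I.n := by
  obtain ⟨-, i, j, -, rfl, -⟩ := h
  exact i.2

theorem Instance.isYes_iff (I : Instance) : I.IsYes 5 ↔ Yes I.natGraph (I.k + 1) :=
  isYes_iff_yes (fun i : Fin I.n => (i : ℕ)) Fin.val_injective
    (fun i j => (I.natGraph_adj i j).symm)
    fun x _ h => ⟨⟨x, I.lt_of_natGraph_adj h⟩, rfl⟩

theorem input_spec {I : Instance} {s : State} (h : I.IsInitial s) {N : ℕ} (hN : I.n ≤ N) :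
    Env N (input.run (s.setReg 2 N)) ∧
    Rep N ((input.run (s.setReg 2 N)).arr 2) I.natGraph ∧
    (input.run (s.setReg 2 N)).reg 1 = I.k + 1 := by
  obtain ⟨⟨hn, hk, hadj⟩, hr, h0, ha⟩ := h
  set s₀ := s.setReg 2 N with hs₀
  set c := loops [10, 11] (guard [.lt (.var 10) (.var 0),
    .lt (.var 11) (.var 0)] (.store 2 (idx 10 11) (.get 0 (.add (.get 12 (.var 10)) (.var 11)))))
    with hc
  have F₁ := frame_run (rows 1 2) s₀
  have R₁ := rows_spec (a := 1) (r := 2) (by decide) (s := s₀) (ha 1 0 (by decide))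
  set s₁ := (rows 1 2).run s₀ with hs₁
  have F₂ := frame_run (rows 12 0) s₁
  have R₂ := rows_spec (a := 12) (r := 0) (by decide) (s := s₁)
    (by rw [F₁.arr 12 (by decide)]; exact ha 12 0 (by decide))
  set s₂ := (rows 12 0).run s₁ with hs₂
  have F₃ := frame_run c s₂
  have e0 : s₀.reg 2 = N := by simp [hs₀]
  have E₁ : Env N s₁ := ⟨by rw [F₁.reg 2 (by decide), e0], fun i hi => by
    rw [R₁ i (by omega), e0]⟩
  have E₂ : Env N s₂ := E₁.of_frame F₂ (by decide) (by decide)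
  have n1 : s₁.reg 0 = I.n := by
    rw [F₁.reg 0 (by decide), hs₀, State.reg_setReg, if_neg (by decide), hn]
  have n2 : s₂.reg 0 = I.n := by rw [F₂.reg 0 (by decide), n1]
  rw [E₁.size, n1] at R₂
  have hrun : input.run s₀ = (c.run s₂).setReg 1 ((c.run s₂).reg 1 + 1) := rfl
  have hf := fill_sweep (N := N) (a := 2) (es := [.lt (.var 10) (.var 0), .lt (.var 11) (.var 0)])
    (ei := idx 10 11) (ev := .get 0 (.add (.get 12 (.var 10)) (.var 11)))
    (by decide) (s₀ := s₂) E₂.size (fun i j => i < I.n ∧ j < I.n) (fun i j => i * N + j)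
    (fun i j => s₂.arr 0 (i * I.n + j))
    (fun i j i' j' _ hj _ hj' _ _ e => (index_eq_iff hj hj').1 e) ?_
  · rw [hrun]
    refine ⟨?_, ⟨fun i j hi hj => ?_, fun i j hij => (I.lt_of_natGraph_adj hij).trans_le hN⟩, ?_⟩
    · have E₃ := E₂.of_frame F₃ (by decide) (by decide)
      exact ⟨by simpa using E₃.size, by simpa using E₃.row⟩
    · rw [State.arr_setReg]
      have e2 : s₂.arr 0 = s.arr 0 := by rw [F₂.arr 0 (by decide), F₁.arr 0 (by decide)]; rfl
      by_cases hij : i < I.n ∧ j < I.n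
      · rw [hf.1 i hi j hj hij, e2]
        have h1 := hadj ⟨i, hij.1⟩ ⟨j, hij.2⟩
        rw [← I.natGraph_adj] at h1
        by_cases hA : I.natGraph.Adj i j
        · simp [h1.1 hA, hA]
        · simp [h1.2 hA, hA]
      · rw [hf.2 _ fun i' hi' j' hj' hp e => ?_]
        · rw [F₂.arr 2 (by decide), F₁.arr 2 (by decide)]
          have : s₀.arr 2 (i * N + j) = 0 := ha 2 _ (by decide)
          rw [this]
          refine iff_of_false (by simp) fun hA => hij ⟨I.lt_of_natGraph_adj hA,
            I.lt_of_natGraph_adj hA.symm⟩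
        · obtain ⟨rfl, rfl⟩ := (index_eq_iff hj' hj).1 e
          exact hij hp
    · rw [State.reg_setReg, if_pos rfl, F₃.reg 1 (by decide), F₂.reg 1 (by decide),
        F₁.reg 1 (by decide), hs₀, State.reg_setReg, if_neg (by decide), hk]
  · intro s' hF h10 h11
    have hE := E₂.of_frame hF (by decide) (by decide)
    have r0 : s'.reg 0 = I.n := by rw [hF.reg 0 (by decide), n2]
    refine ⟨by simp [r0], fun hP => ⟨eval_idx hE h10, ?_⟩⟩
    simp only [Expr.eval, hF.arr 0 (by decide), hF.arr 12 (by decide), R₂ _ h10.le]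

/-- Mark the vertices with at least one neighbor in array `10`. -/
def markSupport : Cmd := loops [10, 11] (guard [adj 10 11] (.store 10 (.var 10) (.lit 1)))

theorem markSupport_spec {N : ℕ} {s : State} (h : Env N s) {G : SimpleGraph ℕ}
    (hG : Rep N (s.arr 2) G) (h10 : ∀ x < N, s.arr 10 x = 0) :
    ∀ x < N, (markSupport.run s).arr 10 x ≠ 0 ↔ ∃ y, G.Adj x y := by
  have hsw := run_loops_sweep (xs := [10, 11]) (fun s => s.arr 10)
    (by decide : markSupport.wf = true) s (fun s x _ v => rfl)
    (fun F => ∀ x < N, F x ≠ 0 → ∃ y, G.Adj x y)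
    (fun A B => ∀ i, A i ≠ 0 → B i ≠ 0) (fun A i h => h)
    (fun A B C h h' i hi => h' i (h i hi))
    (fun l F => ∀ x y, l = [x, y] → G.Adj x y → F x ≠ 0)
    (fun l A B hR hq x y hl h1 => hR _ (hq x y hl h1)) ?_
    (fun x hx hne => absurd (h10 x hx) hne)
  · obtain ⟨h1, -, h2⟩ := hsw
    refine fun x hx => ⟨h1 x hx, ?_⟩
    rintro ⟨y, hy⟩
    have h3 := hG.supp _ _ hy.symm
    exact h2 [x, y] rfl (by simp [h.size, hx, h3]) x y rfl hy
  · rintro s' hF hlt hI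
    rw [h.size] at hlt
    have hE := h.of_frame hF (by decide) (by decide)
    have hrep : Rep N (s'.arr 2) G := by rwa [hF.arr 2 (by decide)]
    have h10 := hlt 10 (by simp)
    have h11 := hlt 11 (by simp)
    rw [run_guard]
    split_ifs with hg <;> simp only [List.forall_mem_cons, eval_adj hE hrep h10 h11,
      List.not_mem_nil, false_imp_iff, implies_true, and_true] at hg
    · simp only [run, eval_var, eval_lit, State.arr_setArr, if_true, Function.update_apply]
      refine ⟨fun x hx => ?_, fun i hi => ?_, fun x y hl _ => ?_⟩
      · split_ifs with e
        · exact fun _ => ⟨_, e ▸ hg⟩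
        · exact hI x hx
      · split_ifs <;> simp [hi]
      · simp only [List.map_cons, List.cons.injEq] at hl
        simp [hl.1]
    · refine ⟨hI, fun i hi => hi, fun x y hl h1 => ?_⟩
      simp only [List.map_cons, List.map_nil, List.cons.injEq, and_true] at hl
      obtain ⟨rfl, rfl⟩ := hl
      exact absurd h1 hg

/-- List the marked vertices in array `11`; register `6` counts them. -/
def listSupport : Cmd :=
  .loop 10 (guard [.get 10 (.var 10)] (.seq (.store 11 (.var 6) (.var 10))
    (.assign 6 (suc (.var 6)))))

theorem listSupport_spec {N : ℕ} {s : State} (h : s.reg 2 = N) (h6 : s.reg 6 = 0) :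
    (listSupport.run s).reg 6 ≤ N ∧
    (∀ p < (listSupport.run s).reg 6, (listSupport.run s).arr 11 p < N ∧
      s.arr 10 ((listSupport.run s).arr 11 p) ≠ 0) ∧
    (∀ p < (listSupport.run s).reg 6, ∀ q < (listSupport.run s).reg 6,
      (listSupport.run s).arr 11 p = (listSupport.run s).arr 11 q → p = q) ∧
    ∀ x < N, s.arr 10 x ≠ 0 → ∃ p < (listSupport.run s).reg 6,
      (listSupport.run s).arr 11 p = x := by
  have hind := run_loop_induction (x := 10) (c := guard [.get 10 (.var 10)]
    (.seq (.store 11 (.var 6) (.var 10)) (.assign 6 (suc (.var 6))))) (by decide) s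
    (fun i s' => s'.reg 6 ≤ i ∧
      (∀ p < s'.reg 6, s'.arr 11 p < i ∧ s.arr 10 (s'.arr 11 p) ≠ 0) ∧
      (∀ p < s'.reg 6, ∀ q < s'.reg 6, s'.arr 11 p = s'.arr 11 q → p = q) ∧
      ∀ x < i, s.arr 10 x ≠ 0 → ∃ p < s'.reg 6, s'.arr 11 p = x) ?_ ?_
  · rwa [h] at hind
  · simp [h6]
  · rintro i s' hi hs' hF ⟨h1, h2, h3, h4⟩
    rw [run_guard]
    have e10 : s'.arr 10 = s.arr 10 := hF.arr 10 (by decide)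
    simp only [List.mem_singleton, forall_eq, eval_get, eval_var, hs', e10]
    split_ifs with hg
    · simp only [run, eval_var, eval_suc, State.arr_setReg, State.arr_setArr, State.reg_setReg,
        State.reg_setArr, if_true, show (6 : ℕ) ≠ 10 by decide, if_false, hs',
        Function.update_apply]
      refine ⟨by omega, fun p hp => ?_, fun p hp q hq => ?_, fun x hx hx0 => ?_⟩
      · split_ifs with e
        · exact ⟨by omega, hg⟩
        · exact ⟨(h2 p (by omega)).1.trans (Nat.lt_succ_self i), (h2 p (by omega)).2⟩
      · split_ifs with e1 e2 e2
        · intro _; omega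
        · intro e3
          have := (h2 q (by omega)).1
          omega
        · intro e3
          have := (h2 p (by omega)).1
          omega
        · exact h3 p (by omega) q (by omega)
      · rcases Nat.lt_succ_iff_lt_or_eq.1 hx with hx | rfl
        · obtain ⟨p, hp, hpx⟩ := h4 x hx hx0
          exact ⟨p, by omega, by rw [if_neg (by omega), hpx]⟩
        · exact ⟨s'.reg 6, by omega, by rw [if_pos rfl]⟩
    · simp only [State.arr_setReg, State.reg_setReg, show (6 : ℕ) ≠ 10 by decide, if_false]
      refine ⟨by omega, fun p hp => ⟨(h2 p hp).1.trans (Nat.lt_succ_self i), (h2 p hp).2⟩, h3,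
        fun x hx hx0 => ?_⟩
      rcases Nat.lt_succ_iff_lt_or_eq.1 hx with hx | rfl
      · exact h4 x hx hx0
      · exact absurd hx0 hg

/-- Output the graph without its isolated vertices, and decrement register `1`. -/
def output : Cmd :=
  .seq markSupport (.seq listSupport (.seq (rows 13 6) (.seq (loops [10, 11] (guard
    [.lt (.var 10) (.var 6), .lt (.var 11) (.var 6)] (.store 0 (.add (.get 13 (.var 10)) (.var 11))
      (.lt (.lit 0) (.get 2 (.add (.get 1 (.get 11 (.var 10))) (.get 11 (.var 11))))))))
    (.seq (.assign 0 (.var 6)) (.assign 1 (.sub (.var 1) (.lit 1)))))))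

/-- Without isolated vertices, a bound on the edges also bounds the number of vertices. `φ` is the
list of the remaining vertices, and the decrement turns κ back into k. -/
theorem output_spec {N : ℕ} {s : State} (h : Env N s) {G : SimpleGraph ℕ}
    (hG : Rep N (s.arr 2) G) (h10 : ∀ x < N, s.arr 10 x = 0) (h6 : s.reg 6 = 0)
    (h13 : s.arr 13 0 = 0) :
    ∃ (m : ℕ) (φ : Fin m → ℕ), Function.Injective φ ∧ (∀ p, ∃ y, G.Adj (φ p) y) ∧
      (∀ x y, G.Adj x y → x ∈ Set.range φ) ∧
      (⟨m, G.comap φ, s.reg 1 - 1⟩ : Instance).HeldBy (output.run s) := by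
  have M := markSupport_spec h hG h10
  have F₁ := frame_run markSupport s
  set s₁ := markSupport.run s with hs₁
  have E₁ : Env N s₁ := h.of_frame F₁ (by decide) (by decide)
  have L := listSupport_spec E₁.size (by rw [F₁.reg 6 (by decide), h6])
  have F₂ := frame_run listSupport s₁
  set s₂ := listSupport.run s₁ with hs₂
  have E₂ : Env N s₂ := E₁.of_frame F₂ (by decide) (by decide)
  have R := rows_spec (a := 13) (r := 6) (by decide) (s := s₂)
    (by rw [F₂.arr 13 (by decide), F₁.arr 13 (by decide), h13])
  have F₃ := frame_run (rows 13 6) s₂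
  set s₃ := (rows 13 6).run s₂ with hs₃
  have E₃ : Env N s₃ := E₂.of_frame F₃ (by decide) (by decide)
  have G₃ : Rep N (s₃.arr 2) G := by
    rw [F₃.arr 2 (by decide), F₂.arr 2 (by decide), F₁.arr 2 (by decide)]
    exact hG
  obtain ⟨L1, L2, L3, L4⟩ := L
  have e11 : s₃.arr 11 = s₂.arr 11 := F₃.arr 11 (by decide)
  have e6 : s₃.reg 6 = s₂.reg 6 := F₃.reg 6 (by decide)
  rw [E₂.size, ← e6] at R
  rw [← e11, ← e6] at L2 L3 L4
  rw [← e6] at L1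
  set m := s₃.reg 6 with hm
  set c := loops [10, 11] (guard
    [.lt (.var 10) (.var 6), .lt (.var 11) (.var 6)] (.store 0 (.add (.get 13 (.var 10)) (.var 11))
      (.lt (.lit 0) (.get 2 (.add (.get 1 (.get 11 (.var 10))) (.get 11 (.var 11))))))) with hc
  have F₄ := frame_run c s₃
  have hrun : output.run s = ((c.run s₃).setReg 0 ((c.run s₃).reg 6)).setReg 1
      (((c.run s₃).setReg 0 ((c.run s₃).reg 6)).reg 1 - 1) := rfl
  have hf := fill_sweep (N := N) (a := 0) (es := [.lt (.var 10) (.var 6), .lt (.var 11) (.var 6)])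
    (ei := .add (.get 13 (.var 10)) (.var 11))
    (ev := .lt (.lit 0) (.get 2 (.add (.get 1 (.get 11 (.var 10))) (.get 11 (.var 11)))))
    (by decide) (s₀ := s₃) E₃.size (fun i j => i < m ∧ j < m) (fun i j => i * m + j)
    (fun i j => if 0 < s₃.arr 2 (s₃.arr 11 i * N + s₃.arr 11 j) then 1 else 0)
    (fun i j i' j' _ _ _ _ hp hp' e => (index_eq_iff hp.2 hp'.2).1 e) ?_
  · refine ⟨m, fun p => s₃.arr 11 p, fun p q e => Fin.ext (L3 p p.2 q q.2 e),
      fun p => (M _ (L2 p p.2).1).1 (L2 p p.2).2, fun x y hxy => ?_, ?_⟩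
    · have hx := hG.supp _ _ hxy
      obtain ⟨p, hp, e⟩ := L4 x hx ((M x hx).2 ⟨y, hxy⟩)
      exact ⟨⟨p, hp⟩, e⟩
    · rw [hrun]
      refine ⟨?_, ?_, fun i j => ?_⟩
      · simp only [State.reg_setReg, show (0 : ℕ) ≠ 1 by decide, if_false, if_true]
        rw [F₄.reg 6 (by decide)]
      · simp only [State.reg_setReg, show (1 : ℕ) ≠ 0 by decide, if_false, if_true]
        rw [F₄.reg 1 (by decide), F₃.reg 1 (by decide), F₂.reg 1 (by decide),
          F₁.reg 1 (by decide)]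
      · have hi : (i : ℕ) < m := i.2
        have hj : (j : ℕ) < m := j.2
        have hv := hf.1 i (hi.trans_le L1) j (hj.trans_le L1) ⟨hi, hj⟩
        have hval := G₃.val _ _ (L2 i hi).1 (L2 j hj).1
        simp only [State.arr_setReg, SimpleGraph.comap_adj]
        rw [hv, ← hval]
        constructor
        · intro h; rw [if_pos (Nat.pos_of_ne_zero h)]
        · intro h; rw [if_neg fun hp => h hp.ne']
  · intro s' hF h10 h11
    have r6 : s'.reg 6 = m := hF.reg 6 (by decide)
    refine ⟨by simp [r6], fun hP => ⟨?_, ?_⟩⟩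
    · simp only [Expr.eval, hF.arr 13 (by decide), R _ h10.le]
    · simp only [Expr.eval, hF.arr 2 (by decide), hF.arr 1 (by decide), hF.arr 11 (by decide),
        E₃.row _ (L2 _ hP.1).1]

/-! ### The kernelization -/

/-- The reductions. -/
def reduce : Cmd :=
  .seq reduceVertices (.seq pruneEdges (.seq pruneLeaves (.seq packPaths replaceNo)))

/-- With κ or more disjoint paths there is no solution, and the short path with κ = 1 is output;
otherwise at most k paths were packed and |M| ≤ 5k. In both cases κ is positive, so decrementing it
in the end is exact. -/
theorem reduce_spec {N n k : ℕ} {s : State} (h : Env N s) {G : SimpleGraph ℕ}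
    (hG : Rep N (s.arr 2) G) (hsupp : ∀ i j, G.Adj i j → i < n) (hN : 3 * n + 5 ≤ N)
    (h1 : s.reg 1 = k + 1) (h5 : s.reg 5 = 0) (h7 : ∀ p, s.arr 7 p = 0) (h8 : ∀ p, s.arr 8 p = 0)
    (h9 : ∀ p, s.arr 9 p = 0) :
    ∃ G', Rep N ((reduce.run s).arr 2) G' ∧ 0 < (reduce.run s).reg 1 ∧
      (reduce.run s).reg 1 ≤ k + 1 ∧ (Yes G' ((reduce.run s).reg 1) ↔ Yes G (k + 1)) ∧
      ∃ E : Finset (Sym2 ℕ), E.card ≤ max 4 (245 * k ^ 2 + 245 * k) ∧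
        ∀ u w, G'.Adj u w → s(u, w) ∈ E := by
  obtain ⟨G₁, R₁, le₁, Y₁, κ₁, T₁⟩ := reduceVertices_spec h hG hsupp hN
  have F₁ := frame_run reduceVertices s
  set s₁ := reduceVertices.run s with hs₁
  have E₁ : Env N s₁ := h.of_frame F₁ (by decide) (by decide)
  obtain ⟨G₂, R₂, le₂, Y₂, P₂⟩ := pruneEdges_spec E₁ R₁ fun u _ w _ => by
    rw [F₁.arr 7 (by decide)]; exact h7 _
  have F₂ := frame_run pruneEdges s₁
  set s₂ := pruneEdges.run s₁ with hs₂
  have E₂ : Env N s₂ := E₁.of_frame F₂ (by decide) (by decide)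
  obtain ⟨G₃, R₃, le₃, Y₃, P₃, T₃⟩ := pruneLeaves_spec E₂ R₂ (fun x _ => by
    rw [F₂.arr 8 (by decide), F₁.arr 8 (by decide)]; exact h8 _) P₂
  have F₃ := frame_run pruneLeaves s₂
  set s₃ := pruneLeaves.run s₂ with hs₃
  have E₃ : Env N s₃ := E₂.of_frame F₃ (by decide) (by decide)
  obtain ⟨M, ⟨M1, M2⟩, M3⟩ := packPaths_spec E₃ R₃ (fun x _ => by
    rw [F₃.arr 9 (by decide), F₂.arr 9 (by decide), F₁.arr 9 (by decide)]; exact h9 _) (by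
    rw [F₃.reg 5 (by decide), F₂.reg 5 (by decide), F₁.reg 5 (by decide), h5])
  have F₄ := frame_run packPaths s₃
  set s₄ := packPaths.run s₃ with hs₄
  have E₄ : Env N s₄ := E₃.of_frame F₄ (by decide) (by decide)
  have e1 : s₄.reg 1 = s₁.reg 1 := by
    rw [F₄.reg 1 (by decide), F₃.reg 1 (by decide), F₂.reg 1 (by decide)]
  have hY : Yes G₃ (s₄.reg 1) ↔ Yes G (k + 1) := by
    rw [Y₃, Y₂, e1, Y₁, h1]
  have hrun : reduce.run s = replaceNo.run s₄ := rfl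
  rw [hrun]
  rw [h1] at κ₁ T₁
  rcases replaceNo_spec E₄ (by omega) with ⟨hc, hr⟩ | ⟨hc, hr, hr1⟩
  · rw [hr]
    refine ⟨G₃, ?_, by omega, by omega, hY, ?_⟩
    · rw [F₄.arr 2 (by decide)]
      exact R₃
    · have hMN : ∀ v, Tame G₃ (k + 1) v := by
        intro v
        by_cases hv : v < N
        · exact ((T₁ v hv).anti le₂).anti le₃
        · exact ⟨∅, ∅, by simp, by simp, fun y z hy => absurd (R₃.supp _ _ hy) hv,
            fun y hy => absurd (R₃.supp _ _ hy) hv⟩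
      obtain ⟨E, hE, hE'⟩ := exists_edges_card_le (k := k) M3 (by omega) (fun v _ => hMN v) P₃ T₃
      -- The count gives 230 in place of 245.
      exact ⟨E, hE.trans (le_max_of_le_right (by omega)), hE'⟩
  · rw [hr1]
    refine ⟨shortPath, hr, Nat.one_pos, by omega, iff_of_false not_yes_shortPath ?_,
      {s(0, 1), s(1, 2), s(2, 3), s(3, 4)}, le_max_of_le_left Finset.card_le_four, ?_⟩
    · rw [← hY]
      rintro ⟨S, hS, hH⟩
      have h3 := M2 S hH
      have h4 := Finset.card_le_card (Finset.inter_subset_left (s₁ := S) (s₂ := M))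
      omega
    · rintro u w ⟨hu, hw, huw⟩
      interval_cases u <;> interval_cases w <;> simp at huw ⊢

/-- The kernelization. -/
def kernel : Cmd := .seq input (.seq reduce output)

/-- A bound for the size of the kernel. -/
def sizeBound (k : ℕ) : ℕ := (2 * (245 * k ^ 2 + 245 * k + 4)) ^ 2 + k

theorem kernel_spec {I : Instance} {s : State} (h : I.IsInitial s) :
    ∃ J : Instance, J.HeldBy (kernel.run (s.setReg 2 (3 * I.n + 5))) ∧ (J.IsYes 5 ↔ I.IsYes 5) ∧
      J.numEdges ≤ max 4 (245 * I.k ^ 2 + 245 * I.k) ∧ J.size ≤ sizeBound I.k := by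
  set N := 3 * I.n + 5 with hN
  obtain ⟨E₁, R₁, κ₁⟩ := input_spec h (N := N) (by omega)
  have F₁ := frame_run input (s.setReg 2 N)
  set s₁ := input.run (s.setReg 2 N) with hs₁
  have hz : ∀ a, a ∉ input.warrs → a ≠ 0 → ∀ p, s₁.arr a p = 0 := by
    intro a ha ha0 p
    rw [F₁.arr a ha]
    exact h.2.2.2 a p ha0
  have hreg : ∀ x, x ∉ input.wregs → 3 ≤ x → s₁.reg x = 0 := by
    intro x hx hx3
    rw [F₁.reg x hx, State.reg_setReg, if_neg (by omega)]
    exact h.2.1 x (by omega)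
  obtain ⟨G, R₂, κ0, κ₂, hY, E, hE, hE'⟩ := reduce_spec E₁ R₁
    (fun i j hij => I.lt_of_natGraph_adj hij) le_rfl κ₁ (hreg 5 (by decide) (by norm_num))
    (hz 7 (by decide) (by decide)) (hz 8 (by decide) (by decide)) (hz 9 (by decide) (by decide))
  have F₂ := frame_run reduce s₁
  set s₂ := reduce.run s₁ with hs₂
  have E₂ : Env N s₂ := E₁.of_frame F₂ (by decide) (by decide)
  obtain ⟨m, φ, hφ, hdeg, hsupp, hheld⟩ := output_spec E₂ R₂
    (fun x _ => by rw [F₂.arr 10 (by decide)]; exact hz 10 (by decide) (by decide) x)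
    (by rw [F₂.reg 6 (by decide)]; exact hreg 6 (by decide) (by norm_num))
    (by rw [F₂.arr 13 (by decide)]; exact hz 13 (by decide) (by decide) 0)
  refine ⟨⟨m, G.comap φ, s₂.reg 1 - 1⟩, hheld, ?_, ?_, ?_⟩
  · rw [isYes_iff_yes (I := ⟨m, G.comap φ, s₂.reg 1 - 1⟩) φ hφ (fun i j => Iff.rfl) hsupp,
      I.isYes_iff, ← hY, Nat.sub_add_cancel κ0]
  · refine le_trans ?_ hE
    rw [Instance.numEdges, ← Set.ncard_image_of_injective _ (Sym2.map.injective hφ),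
      ← Set.ncard_coe_finset]
    refine Set.ncard_le_ncard ?_ E.finite_toSet
    rintro _ ⟨e, he, rfl⟩
    induction e with
    | _ i j => exact hE' _ _ he
  -- Every vertex of the output is an end of an edge in `E`.
  · have hm : m ≤ 2 * E.card := by
      have hsub : Finset.univ.image φ ⊆ E.biUnion fun e => e.toFinset := by
        intro x hx
        obtain ⟨p, -, rfl⟩ := Finset.mem_image.1 hx
        obtain ⟨y, hy⟩ := hdeg p
        exact Finset.mem_biUnion.2 ⟨_, hE' _ _ hy, by simp⟩
      have h1 := Finset.card_le_card hsub
      rw [Finset.card_image_of_injective _ hφ, Finset.card_univ, Fintype.card_fin] at h1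
      have h2 := Finset.card_biUnion_le_card_mul E (fun e => e.toFinset) 2 fun e _ => by
        rw [Sym2.card_toFinset]
        split_ifs <;> omega
      omega
    have hm' : m ≤ 2 * (245 * I.k ^ 2 + 245 * I.k + 4) :=
      hm.trans (Nat.mul_le_mul_left _ (hE.trans (by omega)))
    exact Nat.add_le_add (Nat.pow_le_pow_left hm' 2)
      (show s₂.reg 1 - 1 ≤ I.k by omega)

/-! ### Computability of the size bound and uniqueness of the initial state -/

theorem computable_sizeBound : Computable sizeBound := by
  have hid : Primrec (fun k : ℕ => k) := Primrec.id
  have hsq : Primrec (fun k : ℕ => k ^ 2) := by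
    simpa only [pow_two] using Primrec.nat_mul.comp hid hid
  have hb : Primrec (fun k : ℕ => 2 * (245 * k ^ 2 + 245 * k + 4)) :=
    Primrec.nat_mul.comp (Primrec.const 2) (Primrec.nat_add.comp (Primrec.nat_add.comp
      (Primrec.nat_mul.comp (Primrec.const 245) hsq)
      (Primrec.nat_mul.comp (Primrec.const 245) hid)) (Primrec.const 4))
  have hb2 : Primrec (fun k : ℕ => (2 * (245 * k ^ 2 + 245 * k + 4)) ^ 2) := by
    simpa only [pow_two] using Primrec.nat_mul.comp hb hb
  exact (Primrec.nat_add.comp hb2 hid).to_comp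

/-- The initial state on an instance. -/
noncomputable def Instance.initial (I : Instance) : State where
  reg x := if x = 0 then I.n else if x = 1 then I.k else 0
  arr a p := by
    classical
    exact if ∃ i j : Fin I.n, I.graph.Adj i j ∧ a = 0 ∧ p = i * I.n + j then 1 else 0

theorem Instance.isInitial_initial (I : Instance) : I.IsInitial I.initial := by
  refine ⟨⟨rfl, rfl, fun i j => ⟨fun h => if_pos ⟨i, j, h, rfl, rfl⟩, fun h => if_neg ?_⟩⟩,
    fun x hx => ?_, fun p hp => if_neg ?_, fun a p ha => if_neg fun ⟨_, _, _, h, _⟩ => ha h⟩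
  · rintro ⟨i', j', h', -, e⟩
    obtain ⟨e1, e2⟩ := (index_eq_iff j.2 j'.2).1 e
    rw [Fin.ext e1, Fin.ext e2] at h
    exact h h'
  · simp only [initial]
    rw [if_neg (by omega), if_neg (by omega)]
  · rintro ⟨i, j, -, -, rfl⟩
    have h1 := i.2
    have h2 := j.2
    have h3 : (i + 1 : ℕ) * I.n ≤ I.n * I.n := Nat.mul_le_mul_right _ h1
    rw [Nat.succ_mul] at h3
    rw [pow_two] at hp
    omega

/-- The input determines the whole memory, so a function read off from the run on this one state is
computed from every initial state. -/
theorem Instance.IsInitial.eq_initial {I : Instance} {s : State} (h : I.IsInitial s) :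
    s = I.initial := by
  obtain ⟨⟨h1, h2, h3⟩, h4, h5, h6⟩ := h
  obtain ⟨⟨g1, g2, g3⟩, g4, g5, g6⟩ := I.isInitial_initial
  have hreg : s.reg = I.initial.reg := by
    funext x
    rcases Nat.lt_or_ge x 2 with hx | hx
    · interval_cases x
      · rw [h1, g1]
      · rw [h2, g2]
    · rw [h4 x hx, g4 x hx]
  have harr : s.arr = I.initial.arr := by
    funext a p
    by_cases ha : a = 0
    · subst ha
      rcases Nat.lt_or_ge p (I.n ^ 2) with hp | hp
      · have hn : 0 < I.n := by
          rcases Nat.eq_zero_or_pos I.n with e | e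
          · rw [e] at hp
            exact absurd hp (by simp)
          · exact e
        have hq : p / I.n < I.n := Nat.div_lt_of_lt_mul (by rwa [pow_two] at hp)
        have hr : p % I.n < I.n := Nat.mod_lt _ hn
        have e : p = (⟨p / I.n, hq⟩ : Fin I.n) * I.n + (⟨p % I.n, hr⟩ : Fin I.n) :=
          (Nat.div_add_mod' p I.n).symm
        rw [e]
        by_cases hA : I.graph.Adj ⟨p / I.n, hq⟩ ⟨p % I.n, hr⟩
        · rw [(h3 _ _).1 hA, (g3 _ _).1 hA]
        · rw [(h3 _ _).2 hA, (g3 _ _).2 hA]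
      · rw [h5 p hp, g5 p hp]
    · rw [h6 a p ha, g6 a p ha]
  cases s
  simp_all

theorem eval_le_eval (p : Polynomial ℕ) {a b : ℕ} (h : a ≤ b) : p.eval a ≤ p.eval b := by
  rw [Polynomial.eval_eq_sum_range, Polynomial.eval_eq_sum_range]
  exact Finset.sum_le_sum fun i _ => Nat.mul_le_mul_left _ (Nat.pow_le_pow_left h i)

end PathVertexCover

open PathVertexCover RAM in
theorem mainTheorem2 :
    ∃ f : PathVertexCover.Instance → PathVertexCover.Instance,
      PathVertexCover.IsKernelization 5 f ∧
        ∀ I : PathVertexCover.Instance, (f I).numEdges ≤ max 4 (245 * I.k ^ 2 + 245 * I.k) := by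
  choose f hheld hyes hedges hsize using fun I : Instance => kernel_spec I.isInitial_initial
  -- Register `2` is set to 3n + 5 by additions, at cost 7 for the expression and 1 for the
  -- assignment.
  refine ⟨f, ⟨⟨.seq (.assign 2 (.add (.var 0) (.add (.var 0) (.add (.var 0) (.lit 5)))))
    kernel.prog, (8 : Polynomial ℕ) + kernel.time.comp (3 * Polynomial.X + 5), ?_⟩, hyes, sizeBound,
    computable_sizeBound, hsize⟩, hedges⟩
  intro I s hs
  obtain rfl := hs.eq_initial
  obtain ⟨t, ht, he⟩ := Cmd.exec_run kernel (by decide) (I.initial.setReg 2 (3 * I.n + 5))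
  have hval : (Expr.add (.var 0) (.add (.var 0) (.add (.var 0) (.lit 5)))).eval I.initial =
      3 * I.n + 5 := by
    simp only [Expr.eval, hs.1.1]
    ring
  have ha := Exec.assign 2 (.add (.var 0) (.add (.var 0) (.add (.var 0) (.lit 5)))) I.initial
  rw [hval] at ha
  refine ⟨_, _, ha.seq he, ?_, hheld I⟩
  have hn : I.n ≤ I.size := (Nat.le_self_pow two_ne_zero _).trans (Nat.le_add_right _ _)
  have hle := eval_le_eval kernel.time (show 3 * I.n + 5 ≤ 3 * I.size + 5 by omega)
  simp only [State.reg_setReg, if_true] at ht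
  simp only [Expr.cost, Polynomial.eval_add, Polynomial.eval_comp, Polynomial.eval_mul,
    Polynomial.eval_X, Polynomial.eval_ofNat]
  omega
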